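/- An approval-based election $E=(C,V)$ consists of a set $C=\{c_1,\dots,c_m\}$ of candidates and voters $V=(v_1,\dots,v_n)$, where each voter $v$ approves a set $A(v)\subseteq C$. The approval score $\mathrm{app}_E(c)$ of a candidate $c$ is the number of voters that approve $c$. For a committee size $k\in\{1,\dots,m\}$, the AV winning committees of $E$ are the $k$-element sets $S\subseteq C$ for which $\sum_{c\in S}\mathrm{app}_E(c)$ is maximum among all $k$-element subsets of $C$. A way of adding (respectively, removing) $B$ approvals is a set of exactly $B$ pairs $(v,c)\in V\times C$ such that $c\notin A(v)$ (respectively, $c\in A(v)$) for every pair in the set; performing it makes $v$ approve (respectively, no longer approve) $c$, for each of these pairs $(v,c)$. **Theorem.** Each of the following two problems is in $\mathrm{FP}$: given an election $E$, a committee size $k\in\{1,\dots,m\}$ and an integer $B\ge 0$, compute the number of ways of adding $B$ approvals (respectively, the number of ways of removing $B$ approvals) after which the set of AV winning committees of size $k$ is the same as in $E$. That is, each of these two functions is computed by a Turing machine whose running time is bounded by a polynomial in the length of the input; here the input consists of $k$ and $B$ in binary and of the $n\times m$ approval matrix of $E$, and the output is written in binary. -/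

import Mathlib

/-- An approval-based election with candidate set `C` and voter set `V`:
every voter `v` approves the set `ballot v` of candidates. -/
structure ApprovalElection (C V : Type*) where
  ballot : V → Finset C

namespace ApprovalElection

variable {C V : Type*} [Fintype C] [DecidableEq C] [Fintype V] [DecidableEq V]

/-- The approval score of a candidate: the number of voters that approve it. -/
def app (E : ApprovalElection C V) (c : C) : ℕ :=
  (Finset.univ.filter fun v : V => c ∈ E.ballot v).card

/-- The AV score of a committee. -/
def avScore (E : ApprovalElection C V) (S : Finset C) : ℕ :=
  ∑ c ∈ S, E.app c

/-- The family of AV winning committees: the size-`k` committees of highest AV score. -/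
def avWinners (E : ApprovalElection C V) (k : ℕ) : Finset (Finset C) :=
  (Finset.powersetCard k Finset.univ).filter fun S =>
    ∀ T ∈ Finset.powersetCard k (Finset.univ : Finset C), E.avScore T ≤ E.avScore S

/-- The pairs (voter, candidate) such that the voter approves the candidate. -/
def approvals (E : ApprovalElection C V) : Finset (V × C) :=
  Finset.univ.filter fun p => p.2 ∈ E.ballot p.1

/-- The pairs (voter, candidate) such that the voter does not approve the candidate. -/
def nonApprovals (E : ApprovalElection C V) : Finset (V × C) :=
  Finset.univ.filter fun p => p.2 ∉ E.ballot p.1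

/-- The election obtained from `E` by adding the approvals in `P`. -/
def addApprovals (E : ApprovalElection C V) (P : Finset (V × C)) : ApprovalElection C V where
  ballot v := Finset.univ.filter fun c => c ∈ E.ballot v ∨ (v, c) ∈ P

/-- The election obtained from `E` by removing the approvals in `P`. -/
def removeApprovals (E : ApprovalElection C V) (P : Finset (V × C)) : ApprovalElection C V where
  ballot v := Finset.univ.filter fun c => c ∈ E.ballot v ∧ (v, c) ∉ P

/-- The number of ways to add `B` approvals (the number of `B`-element sets of
currently absent approvals) such that the set of AV winning committees of size `k`
does not change. -/
def avAddCount (E : ApprovalElection C V) (k B : ℕ) : ℕ :=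
  ((Finset.powersetCard B E.nonApprovals).filter fun P =>
    (E.addApprovals P).avWinners k = E.avWinners k).card

/-- The number of ways to remove `B` approvals (the number of `B`-element sets of
currently present approvals) such that the set of AV winning committees of size `k`
does not change. -/
def avRemoveCount (E : ApprovalElection C V) (k B : ℕ) : ℕ :=
  ((Finset.powersetCard B E.approvals).filter fun P =>
    (E.removeApprovals P).avWinners k = E.avWinners k).card

end ApprovalElection

/-- An input of the counting problems: an election with candidates `c_1, …, c_m` and voters
`v_1, …, v_n`, a committee size `k ∈ {1, …, m}`, and a number `B` of operations. -/
structure AVCountingInput where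
  m : ℕ
  n : ℕ
  election : ApprovalElection (Fin m) (Fin n)
  k : ℕ
  one_le_k : 1 ≤ k
  k_le_m : k ≤ m
  B : ℕ

namespace AVCountingInput

open Computability

/-- A natural number in binary, followed by a separator. -/
def encodeNumber (x : ℕ) : List Γ' :=
  (encodeNat x).map Γ'.bit ++ [Γ'.comma]

/-- The column of the approval matrix that belongs to candidate `c` (one bit per voter, telling
whether the voter approves `c`), followed by a separator. -/
def encodeColumn (I : AVCountingInput) (c : Fin I.m) : List Γ' :=
  (List.finRange I.n).map (fun v => Γ'.bit (decide (c ∈ I.election.ballot v))) ++ [Γ'.comma]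

/-- The input as a string: `k` and `B` in binary, then the approval matrix, column by column.
The values `m` and `n` are the number and the length of the columns. -/
def encode (I : AVCountingInput) : List Γ' :=
  encodeNumber I.k ++ encodeNumber I.B ++ (List.finRange I.m).flatMap I.encodeColumn

/-- The counting problem for adding approvals, as a function of the input. -/
def addCount (I : AVCountingInput) : ℕ :=
  I.election.avAddCount I.k I.B

/-- The counting problem for removing approvals, as a function of the input. -/
def removeCount (I : AVCountingInput) : ℕ :=
  I.election.avRemoveCount I.k I.B

end AVCountingInput

/-- The counting problem `f`, with inputs encoded by `enc`, is in FP: some (multi-stack) Turing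
machine, started on the code of any input `a`, halts with the binary representation of `f a`
after a number of steps that is at most a fixed polynomial in the length of the code of `a`. -/
def CountingInFP {α Γ : Type} (enc : α → List Γ) (f : α → ℕ) : Prop :=
  Nonempty (Turing.TM2ComputableInPolyTime enc Computability.encodeNat f)

/-! Combinatorics. Choose `t` so that fewer than `k` candidates score above `t` and at least `k`
score at least `t`. The winning committees are those `k`-sets that contain everyone above `t` and
nobody below it (`mem_scoreWinners`). So the winners survive a change of scores exactly when some
threshold `t'` cuts the new scores in the same way. If exactly `k` candidates reach `t`, only the
cut between "at least `t`" and "below `t`" matters (`scoreWinners_eq_iff_of_card_eq`). Otherwise the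
classes above, at and below `t` must all be preserved (`scoreWinners_eq_iff_of_lt_card`).

For fixed `t'` this confines each new score, separately, to an interval. A way of adding or removing
approvals is a choice of a new approver set for each candidate, and the sets of a given size are
counted by a binomial coefficient. Hence the ways that respect the intervals and have the right
total are counted by a coefficient of a product of univariate polynomials. It is read off from the
value of the product at `2 ^ N` with `N > n * m`, which is large enough to keep the coefficients
apart (`card_box`). Summing over `t'` gives `card_eq_tableCount`. In the tie-free case `t'` is not
unique, and a difference of two coefficients selects the largest one.

Complexity. The input word is coded as one number `X` whose binary size is twice the word length.
`PolyC` is a class of functions on tuples of numbers computed by stack programs in polynomial time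
and with polynomial output size. As in Cobham's characterisation, it is closed under composition,
pairing, case distinction and recursion on notation with an a priori size bound (`PolyC.bitLoop`).
From these come multiplication, shifts, and sums and products of length at most the size of a
computed number, and with them the counting formula as a function of `X`. Finally
`countingInFP_of_polyC` compiles such a function to a machine that meets the required encoding. -/

/-! ### Structured programs and their compilation to multi-stack machines -/

/-- Structured programs over a family of stacks `k : K` with alphabets `Γ k` and a finite
register of type `σ`. -/
inductive StackCmd {K : Type} (Γ : K → Type) (σ : Type) : Type
  | push (k : K) (f : σ → Γ k)
  | pop (k : K) (f : σ → Option (Γ k) → σ)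
  | load (f : σ → σ)
  | seq (c d : StackCmd Γ σ)
  | ite (b : σ → Bool) (c d : StackCmd Γ σ)
  | loop (b : σ → Bool) (c : StackCmd Γ σ)

namespace StackCmd

open Turing StateTransition

variable {K : Type} {Γ : K → Type} {σ : Type}

/-- The labels of the machine code of a program. -/
def Label : StackCmd Γ σ → Type
  | push _ _ => Unit
  | pop _ _ => Unit
  | load _ => Unit
  | seq c d => c.Label ⊕ d.Label
  | ite _ c d => Option (c.Label ⊕ d.Label)
  | loop _ c => Option c.Label

/-- The label at which the execution of a program starts. -/
def entry : (c : StackCmd Γ σ) → c.Label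
  | push _ _ => ()
  | pop _ _ => ()
  | load _ => ()
  | seq c _ => Sum.inl c.entry
  | ite _ _ _ => none
  | loop _ _ => none

/-- The labels of a program form a finite type. -/
@[reducible] noncomputable def labelFintype : (c : StackCmd Γ σ) → Fintype c.Label
  | push _ _ => inferInstanceAs (Fintype Unit)
  | pop _ _ => inferInstanceAs (Fintype Unit)
  | load _ => inferInstanceAs (Fintype Unit)
  | seq c d =>
    letI := c.labelFintype
    letI := d.labelFintype
    inferInstanceAs (Fintype (c.Label ⊕ d.Label))
  | ite _ c d =>
    letI := c.labelFintype
    letI := d.labelFintype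
    inferInstanceAs (Fintype (Option (c.Label ⊕ d.Label)))
  | loop _ c =>
    letI := c.labelFintype
    inferInstanceAs (Fintype (Option c.Label))

/-- The machine code of a program, with labels embedded by `emb` and exit label `exit`. -/
def code {Λ : Type} : (c : StackCmd Γ σ) → (c.Label → Λ) → Λ → c.Label → TM2.Stmt Γ Λ σ
  | push k f, _, exit, _ => .push k f (.goto fun _ => exit)
  | pop k f, _, exit, _ => .pop k f (.goto fun _ => exit)
  | load f, _, exit, _ => .load f (.goto fun _ => exit)
  | seq c d, emb, exit, l =>
    match l with
    | .inl l => c.code (fun x => emb (.inl x)) (emb (.inr d.entry)) l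
    | .inr l => d.code (fun x => emb (.inr x)) exit l
  | ite b c d, emb, exit, l =>
    match l with
    | none => .branch b (.goto fun _ => emb (some (.inl c.entry)))
        (.goto fun _ => emb (some (.inr d.entry)))
    | some (.inl l) => c.code (fun x => emb (some (.inl x))) exit l
    | some (.inr l) => d.code (fun x => emb (some (.inr x))) exit l
  | loop b c, emb, exit, l =>
    match l with
    | none => .branch b (.goto fun _ => emb (some c.entry)) (.goto fun _ => exit)
    | some l => c.code (fun x => emb (some x)) (emb none) l

variable [DecidableEq K]

/-- `c.Exec v s v' s' T`: started with register `v` and stacks `s`, the program `c` ends with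
register `v'` and stacks `s'` after at most `T` steps. -/
def Exec (c : StackCmd Γ σ) (v : σ) (s : ∀ k, List (Γ k)) (v' : σ) (s' : ∀ k, List (Γ k))
    (T : ℕ) : Prop :=
  ∀ (Λ : Type) (M : Λ → TM2.Stmt Γ Λ σ) (emb : c.Label → Λ) (exit : Λ),
    (∀ l, M (emb l) = c.code emb exit l) →
      Nonempty (EvalsToInTime (TM2.step M) ⟨some (emb c.entry), v, s⟩
        (some ⟨some exit, v', s'⟩) T)

/-- A single step of a transition system. -/
def evalsToInTimeOne {α : Type} {f : α → Option α} {a b : α} (h : f a = some b) :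
    EvalsToInTime f a (some b) 1 :=
  ⟨⟨1, by simpa [flip] using h⟩, le_rfl⟩

variable {c d : StackCmd Γ σ} {v v' v'' : σ} {s s' s'' : ∀ k, List (Γ k)} {T T' : ℕ}

theorem Exec.mono (h : c.Exec v s v' s' T) (hT : T ≤ T') : c.Exec v s v' s' T' :=
  fun Λ M emb exit hM =>
    let ⟨e⟩ := h Λ M emb exit hM
    ⟨⟨e.toEvalsTo, e.steps_le_m.trans hT⟩⟩

theorem Exec.push (k : K) (f : σ → Γ k) (v : σ) (s : ∀ k, List (Γ k)) :
    (push k f).Exec v s v (Function.update s k (f v :: s k)) 1 :=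
  fun _ _ _ _ hM => ⟨evalsToInTimeOne (by simp [hM, code])⟩

theorem Exec.pop (k : K) (f : σ → Option (Γ k) → σ) (v : σ) (s : ∀ k, List (Γ k)) :
    (pop k f).Exec v s (f v (s k).head?) (Function.update s k (s k).tail) 1 :=
  fun _ _ _ _ hM => ⟨evalsToInTimeOne (by simp [hM, code])⟩

theorem Exec.load (f : σ → σ) (v : σ) (s : ∀ k, List (Γ k)) :
    (load f : StackCmd Γ σ).Exec v s (f v) s 1 :=
  fun _ _ _ _ hM => ⟨evalsToInTimeOne (by simp [hM, code])⟩

theorem step_branch_true {Λ : Type} {M : Λ → TM2.Stmt Γ Λ σ} {b : σ → Bool} {l l₁ l₂ : Λ}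
    (h : M l = .branch b (.goto fun _ => l₁) (.goto fun _ => l₂)) (hb : b v = true) :
    TM2.step M ⟨some l, v, s⟩ = some ⟨some l₁, v, s⟩ := by
  simp [h, hb]

theorem step_branch_false {Λ : Type} {M : Λ → TM2.Stmt Γ Λ σ} {b : σ → Bool} {l l₁ l₂ : Λ}
    (h : M l = .branch b (.goto fun _ => l₁) (.goto fun _ => l₂)) (hb : b v = false) :
    TM2.step M ⟨some l, v, s⟩ = some ⟨some l₂, v, s⟩ := by
  simp [h, hb]

/-- `Exec` quantifies over every machine that contains the code and over every exit label. The run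
of `c` can therefore be taken with the entry of `d` as its exit, and the two runs are concatenated.
-/
theorem Exec.seq (h : c.Exec v s v' s' T) (h' : d.Exec v' s' v'' s'' T') :
    (seq c d).Exec v s v'' s'' (T + T') := fun Λ M emb exit hM => by
  obtain ⟨e⟩ := h Λ M (fun x => emb (.inl x)) (emb (.inr d.entry)) fun l => hM (.inl l)
  obtain ⟨e'⟩ := h' Λ M (fun x => emb (.inr x)) exit fun l => hM (.inr l)
  -- `EvalsToInTime.trans` puts the time of the second run first.
  rw [add_comm]
  exact ⟨EvalsToInTime.trans _ _ _ _ _ _ e e'⟩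

theorem Exec.ite_true {b : σ → Bool} (hb : b v = true) (h : c.Exec v s v' s' T) :
    (ite b c d).Exec v s v' s' (T + 1) := fun Λ M emb exit hM => by
  obtain ⟨e⟩ := h Λ M (fun x => emb (some (.inl x))) exit fun l => hM (some (.inl l))
  exact ⟨EvalsToInTime.trans _ _ _ _ _ _ (evalsToInTimeOne (step_branch_true (hM none) hb)) e⟩

theorem Exec.ite_false {b : σ → Bool} (hb : b v = false) (h : d.Exec v s v' s' T) :
    (ite b c d).Exec v s v' s' (T + 1) := fun Λ M emb exit hM => by
  obtain ⟨e⟩ := h Λ M (fun x => emb (some (.inr x))) exit fun l => hM (some (.inr l))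
  exact ⟨EvalsToInTime.trans _ _ _ _ _ _ (evalsToInTimeOne (step_branch_false (hM none) hb)) e⟩

theorem Exec.loop_false {b : σ → Bool} (hb : b v = false) :
    (loop b c).Exec v s v s 1 := fun _ _ _ _ hM =>
  ⟨evalsToInTimeOne (step_branch_false (hM none) hb)⟩

theorem Exec.loop_true {b : σ → Bool} (hb : b v = true) (h : c.Exec v s v' s' T)
    (h' : (loop b c).Exec v' s' v'' s'' T') :
    (loop b c).Exec v s v'' s'' (T + T' + 1) := fun Λ M emb exit hM => by
  obtain ⟨e⟩ := h Λ M (fun x => emb (some x)) (emb none) fun l => hM (some l)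
  obtain ⟨e'⟩ := h' Λ M emb exit hM
  rw [add_comm T]
  exact ⟨EvalsToInTime.trans _ _ _ _ _ _ (evalsToInTimeOne (step_branch_true (hM none) hb))
    (EvalsToInTime.trans _ _ _ _ _ _ e e')⟩

end StackCmd

/-! ### Work stacks and moving blocks of bits -/

/-- The work stacks of the machines that compute with natural numbers. -/
inductive WorkStack
  | input
  | data
  | aux
  | tmp
  | copy
  deriving DecidableEq

instance : Fintype WorkStack where
  elems := {.input, .data, .aux, .tmp, .copy}
  complete w := by cases w <;> simp

namespace NumProg

open Computability (Γ')

/-- The alphabets of the stacks: the output stack `none` holds bits, the others hold symbols. -/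
@[reducible] def Alphabet : Option WorkStack → Type
  | none => Bool
  | some _ => Γ'

/-- The registers of the machines: two symbols and a carry bit. -/
abbrev Reg : Type := Option Γ' × Option Γ' × Bool

/-- The initial contents of the registers. -/
def reg₀ : Reg := (none, none, false)

/-- The programs computing with natural numbers. -/
abbrev Cmd : Type := StackCmd Alphabet Reg

/-- All stacks, given by the output stack and the work stacks. -/
def allStacks (o : List Bool) (s : WorkStack → List Γ') : ∀ k, List (Alphabet k)
  | none => o
  | some w => s w

theorem update_allStacks_some (o : List Bool) (s : WorkStack → List Γ') (w : WorkStack)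
    (l : List Γ') :
    Function.update (allStacks o s) (some w) l = allStacks o (Function.update s w l) := by
  funext k
  cases k with
  | none => simp [allStacks]
  | some w' =>
    rcases eq_or_ne w' w with rfl | h
    · simp [allStacks]
    · simp [allStacks, h]

theorem update_allStacks_none (o l : List Bool) (s : WorkStack → List Γ') :
    Function.update (allStacks o s) none l = allStacks l s := by
  funext k
  cases k <;> simp [allStacks]

/-- Execution on the work stacks, with empty output stack. -/
def Exec (c : Cmd) (v : Reg) (s : WorkStack → List Γ') (v' : Reg) (s' : WorkStack → List Γ')
    (T : ℕ) : Prop :=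
  StackCmd.Exec c v (allStacks [] s) v' (allStacks [] s') T

variable {c d : Cmd} {v v' v'' v₁ : Reg} {s s' s'' s₁ : WorkStack → List Γ'} {T T' T₁ : ℕ}

theorem Exec.congr (h : Exec c v s v' s' T) (hv : v' = v₁) (hs : s' = s₁) (hT : T ≤ T₁) :
    Exec c v s v₁ s₁ T₁ := by
  subst hv hs
  exact StackCmd.Exec.mono h hT

theorem Exec.congr_start (h : Exec c v s v' s' T) (hs : s = s₁) : Exec c v s₁ v' s' T := by
  subst hs
  exact h

theorem Exec.mono (h : Exec c v s v' s' T) (hT : T ≤ T₁) : Exec c v s v' s' T₁ :=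
  h.congr rfl rfl hT

/-- Push a symbol onto a work stack. -/
def push (w : WorkStack) (f : Reg → Γ') : Cmd := .push (some w) f

/-- Pop a symbol from a work stack. -/
def pop (w : WorkStack) (f : Reg → Option Γ' → Reg) : Cmd := .pop (some w) f

/-- Pop a symbol into the first register. -/
def popFst (w : WorkStack) : Cmd := pop w fun v a => (a, v.2)

/-- Pop a symbol into the second register. -/
def popSnd (w : WorkStack) : Cmd := pop w fun v a => (v.1, a, v.2.2)

/-- Reset the registers. -/
def reset : Cmd := .load fun _ => reg₀

theorem Exec.push (w : WorkStack) (f : Reg → Γ') (v : Reg) (s : WorkStack → List Γ') :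
    Exec (push w f) v s v (Function.update s w (f v :: s w)) 1 := by
  have h := StackCmd.Exec.push (Γ := Alphabet) (some w) f v (allStacks [] s)
  rwa [update_allStacks_some] at h

theorem Exec.pop (w : WorkStack) (f : Reg → Option Γ' → Reg) (v : Reg)
    (s : WorkStack → List Γ') :
    Exec (pop w f) v s (f v (s w).head?) (Function.update s w (s w).tail) 1 := by
  have h := StackCmd.Exec.pop (Γ := Alphabet) (some w) f v (allStacks [] s)
  rwa [update_allStacks_some] at h

theorem Exec.popFst (w : WorkStack) (v : Reg) (s : WorkStack → List Γ') :
    Exec (popFst w) v s ((s w).head?, v.2) (Function.update s w (s w).tail) 1 :=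
  Exec.pop w _ v s

theorem Exec.popSnd (w : WorkStack) (v : Reg) (s : WorkStack → List Γ') :
    Exec (popSnd w) v s (v.1, (s w).head?, v.2.2) (Function.update s w (s w).tail) 1 :=
  Exec.pop w _ v s

theorem Exec.load (f : Reg → Reg) (v : Reg) (s : WorkStack → List Γ') :
    Exec (.load f) v s (f v) s 1 :=
  StackCmd.Exec.load f v _

theorem Exec.reset (v : Reg) (s : WorkStack → List Γ') : Exec reset v s reg₀ s 1 :=
  Exec.load _ v s

theorem Exec.seq (h : Exec c v s v' s' T) (h' : Exec d v' s' v'' s'' T') :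
    Exec (.seq c d) v s v'' s'' (T + T') :=
  StackCmd.Exec.seq h h'

theorem Exec.ite_true {b : Reg → Bool} (hb : b v = true) (h : Exec c v s v' s' T) :
    Exec (.ite b c d) v s v' s' (T + 1) :=
  StackCmd.Exec.ite_true hb h

theorem Exec.ite_false {b : Reg → Bool} (hb : b v = false) (h : Exec d v s v' s' T) :
    Exec (.ite b c d) v s v' s' (T + 1) :=
  StackCmd.Exec.ite_false hb h

theorem Exec.loop_false {b : Reg → Bool} (hb : b v = false) : Exec (.loop b c) v s v s 1 :=
  StackCmd.Exec.loop_false hb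

theorem Exec.loop_true {b : Reg → Bool} (hb : b v = true) (h : Exec c v s v' s' T)
    (h' : Exec (.loop b c) v' s' v'' s'' T') : Exec (.loop b c) v s v'' s'' (T + T' + 1) :=
  StackCmd.Exec.loop_true hb h h'

/-- Whether a popped symbol is a bit. -/
def isBit : Option Γ' → Bool
  | some (.bit _) => true
  | _ => false

/-- The value of a popped bit. -/
def bitVal : Option Γ' → Bool
  | some (.bit b) => b
  | _ => false

/-- A popped symbol. -/
def sym (a : Option Γ') : Γ' := a.getD .comma

/-- Move a block of bits from one stack to another, reversing it, and drop the next symbol. -/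
def moveBits (a b : WorkStack) : Cmd :=
  .seq (popFst a) (.seq (.loop (fun v => isBit v.1) (.seq (push b fun v => sym v.1) (popFst a)))
    reset)

/-- Move a block of bits from one stack to two others, reversing it, and drop the next symbol. -/
def moveBitsTwice (a b b' : WorkStack) : Cmd :=
  .seq (popFst a) (.seq (.loop (fun v => isBit v.1)
    (.seq (push b fun v => sym v.1) (.seq (push b' fun v => sym v.1) (popFst a)))) reset)

/-- Drop a number. -/
def drop (a : WorkStack) : Cmd :=
  .seq (popFst a) (.seq (.loop (fun v => isBit v.1) (popFst a)) reset)

/-- One symbol is always popped ahead: the register holds the head of the remaining word and the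
stack its tail. The condition `hR` makes the loop stop right after the block. -/
theorem exec_moveBits_loop {a b : WorkStack} (hab : a ≠ b) {R : List Γ'}
    (hR : isBit R.head? = false) (l : List Bool) : ∀ (v : Reg) (s : WorkStack → List Γ'),
    v.1 = (l.map Γ'.bit ++ R).head? → s a = (l.map Γ'.bit ++ R).tail →
    Exec (.loop (fun v => isBit v.1) (.seq (push b fun v => sym v.1) (popFst a))) v s
      (R.head?, v.2)
      (Function.update (Function.update s b (l.reverse.map Γ'.bit ++ s b)) a R.tail)
      (3 * l.length + 1) := by
  induction l with
  | nil =>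
    intro v s hv hs
    simp only [List.map_nil, List.nil_append, List.reverse_nil] at hv hs ⊢
    refine (Exec.loop_false (by simp [hv, hR])).congr (by rw [← hv]) ?_ (by simp)
    rw [Function.update_eq_self, ← hs, Function.update_eq_self]
  | cons x l ih =>
    intro v s hv hs
    simp only [List.map_cons, List.cons_append, List.head?_cons, List.tail_cons] at hv hs
    refine (Exec.loop_true (by simp [hv, isBit]) ((Exec.push _ _ _ _).seq (Exec.popFst _ _ _))
      (ih _ _ ?_ ?_)).congr rfl ?_ ?_
    · simp [hab, hs]
    · simp [hab, hs]
    · funext w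
      rcases eq_or_ne w a with rfl | hwa
      · simp
      rcases eq_or_ne w b with rfl | hwb
      · simp [hwa, hv, sym]
      · simp [hwa, hwb]
    · simp only [List.length_cons]
      omega

theorem exec_moveBits {a b : WorkStack} (hab : a ≠ b) {R : List Γ'} (hR : isBit R.head? = false)
    {l : List Bool} {v : Reg} {s : WorkStack → List Γ'} (hs : s a = l.map Γ'.bit ++ R) :
    Exec (moveBits a b) v s reg₀
      (Function.update (Function.update s b (l.reverse.map Γ'.bit ++ s b)) a R.tail)
      (3 * l.length + 3) := by
  refine ((Exec.popFst _ _ _).seq ((exec_moveBits_loop hab hR l _ _ ?_ ?_).seq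
    (Exec.reset _ _))).congr rfl ?_ (by omega)
  · simp [hs]
  · simp [hs]
  · funext w
    rcases eq_or_ne w a with rfl | hwa
    · simp
    rcases eq_or_ne w b with rfl | hwb
    · simp [hwa]
    · simp [hwa, hwb]

theorem exec_moveBitsTwice_loop {a b b' : WorkStack} (hab : a ≠ b) (hab' : a ≠ b') (hbb : b ≠ b')
    {R : List Γ'} (hR : isBit R.head? = false) (l : List Bool) :
    ∀ (v : Reg) (s : WorkStack → List Γ'),
    v.1 = (l.map Γ'.bit ++ R).head? → s a = (l.map Γ'.bit ++ R).tail →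
    Exec (.loop (fun v => isBit v.1) (.seq (push b fun v => sym v.1)
        (.seq (push b' fun v => sym v.1) (popFst a)))) v s (R.head?, v.2)
      (Function.update (Function.update (Function.update s b (l.reverse.map Γ'.bit ++ s b))
        b' (l.reverse.map Γ'.bit ++ s b')) a R.tail) (4 * l.length + 1) := by
  induction l with
  | nil =>
    intro v s hv hs
    simp only [List.map_nil, List.nil_append, List.reverse_nil] at hv hs ⊢
    refine (Exec.loop_false (by simp [hv, hR])).congr (by rw [← hv]) ?_ (by simp)
    rw [Function.update_eq_self, Function.update_eq_self, ← hs, Function.update_eq_self]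
  | cons x l ih =>
    intro v s hv hs
    simp only [List.map_cons, List.cons_append, List.head?_cons, List.tail_cons] at hv hs
    refine (Exec.loop_true (by simp [hv, isBit]) ((Exec.push _ _ _ _).seq
      ((Exec.push _ _ _ _).seq (Exec.popFst _ _ _))) (ih _ _ ?_ ?_)).congr rfl ?_ ?_
    · simp [hab, hab', hs]
    · simp [hab, hab', hs]
    · funext w
      rcases eq_or_ne w a with rfl | hwa
      · simp
      rcases eq_or_ne w b with rfl | hwb
      · simp [hwa, hbb, hv, sym]
      rcases eq_or_ne w b' with rfl | hwb'
      · simp [hwa, hwb, hv, sym]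
      · simp [hwa, hwb, hwb']
    · simp only [List.length_cons]
      omega

theorem exec_moveBitsTwice {a b b' : WorkStack} (hab : a ≠ b) (hab' : a ≠ b') (hbb : b ≠ b')
    {R : List Γ'} (hR : isBit R.head? = false)
    {l : List Bool} {v : Reg} {s : WorkStack → List Γ'} (hs : s a = l.map Γ'.bit ++ R) :
    Exec (moveBitsTwice a b b') v s reg₀
      (Function.update (Function.update (Function.update s b (l.reverse.map Γ'.bit ++ s b))
        b' (l.reverse.map Γ'.bit ++ s b')) a R.tail) (4 * l.length + 3) := by
  refine ((Exec.popFst _ _ _).seq ((exec_moveBitsTwice_loop hab hab' hbb hR l _ _ ?_ ?_).seq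
    (Exec.reset _ _))).congr rfl ?_ (by omega)
  · simp [hs]
  · simp [hs]
  · funext w
    rcases eq_or_ne w a with rfl | hwa
    · simp
    rcases eq_or_ne w b with rfl | hwb
    · simp [hwa, hbb]
    rcases eq_or_ne w b' with rfl | hwb'
    · simp [hwa]
    · simp [hwa, hwb, hwb']

theorem exec_drop_loop {a : WorkStack} {R : List Γ'} (hR : isBit R.head? = false)
    (l : List Bool) : ∀ (v : Reg) (s : WorkStack → List Γ'),
    v.1 = (l.map Γ'.bit ++ R).head? → s a = (l.map Γ'.bit ++ R).tail →
    Exec (.loop (fun v => isBit v.1) (popFst a)) v s (R.head?, v.2)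
      (Function.update s a R.tail) (2 * l.length + 1) := by
  induction l with
  | nil =>
    intro v s hv hs
    simp only [List.map_nil, List.nil_append] at hv hs
    refine (Exec.loop_false (by simp [hv, hR])).congr (by rw [← hv]) ?_ (by simp)
    rw [← hs, Function.update_eq_self]
  | cons x l ih =>
    intro v s hv hs
    simp only [List.map_cons, List.cons_append, List.head?_cons, List.tail_cons] at hv hs
    refine (Exec.loop_true (by simp [hv, isBit]) (Exec.popFst _ _ _)
      (ih _ _ ?_ ?_)).congr rfl ?_ ?_
    · simp [hs]
    · simp [hs]
    · simp
    · simp only [List.length_cons]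
      omega

theorem exec_drop {a : WorkStack} {R : List Γ'} (hR : isBit R.head? = false)
    {l : List Bool} {v : Reg} {s : WorkStack → List Γ'} (hs : s a = l.map Γ'.bit ++ R) :
    Exec (drop a) v s reg₀ (Function.update s a R.tail) (2 * l.length + 3) := by
  refine ((Exec.popFst _ _ _).seq ((exec_drop_loop hR l _ _ ?_ ?_).seq
    (Exec.reset _ _))).congr rfl ?_ (by omega)
  · simp [hs]
  · simp [hs]
  · simp

end NumProg

namespace NumProg

open Computability (Γ')

/-! ### Bit lists -/

/-- The number with a given list of binary digits, least significant digit first. -/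
def ofBits : List Bool → ℕ
  | [] => 0
  | b :: l => Nat.bit b (ofBits l)

theorem ofBits_eq_headD_tail (l : List Bool) :
    ofBits l = (l.headD false).toNat + 2 * ofBits l.tail := by
  cases l with
  | nil => simp [ofBits]
  | cons b l => cases b <;> simp [ofBits, Nat.bit_val]; omega

theorem bits_bit (b : Bool) (n : ℕ) (h : n = 0 → b = true) :
    (Nat.bit b n).bits = b :: n.bits := Nat.bits_append_bit n b h

/-- `Nat.bits` never ends in `false`, so the only digits lost are the zeros at the high end of the
list. -/
theorem bits_ofBits (l : List Bool) : (ofBits l).bits = l.rdropWhile (fun b => !b) := by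
  induction l with
  | nil => simp [ofBits]
  | cons b l ih =>
    rw [List.rdropWhile, List.reverse_cons, List.dropWhile_append]
    rw [List.rdropWhile] at ih
    by_cases h : ofBits l = 0
    · rw [h, Nat.zero_bits, eq_comm, List.reverse_eq_nil_iff] at ih
      cases b <;> simp [ih, ofBits, h, Nat.bit_val]
    · rw [ofBits, bits_bit b _ fun h' => absurd h' h, ih]
      have hne : l.reverse.dropWhile (fun b => !b) ≠ [] := fun h' => by
        rw [h', List.reverse_nil] at ih
        exact h (by rw [← Nat.size_eq_zero, ← Nat.size_eq_bits_len, ih, List.length_nil])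
      simp [hne]

theorem ofBits_bits (n : ℕ) : ofBits n.bits = n := by
  induction n using Nat.binaryRec' with
  | zero => simp [ofBits]
  | bit b n h ih => rw [bits_bit b n h, ofBits, ih]

theorem ofBits_append (l l' : List Bool) :
    ofBits (l ++ l') = ofBits l + 2 ^ l.length * ofBits l' := by
  induction l with
  | nil => simp [ofBits]
  | cons b l ih =>
    simp only [List.cons_append, ofBits, ih, Nat.bit_val, List.length_cons, pow_succ]
    ring

theorem ofBits_lt (l : List Bool) : ofBits l < 2 ^ l.length := by
  induction l with
  | nil => simp [ofBits]
  | cons b l ih =>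
    simp only [ofBits, Nat.bit_val, List.length_cons, pow_succ]
    cases b <;> simp <;> omega

/-- The carry of the digitwise addition or (if `neg`) subtraction. -/
def carry (neg a b c : Bool) : Bool := ((a ^^ neg) && (b || c)) || (b && c)

/-- The first `n` digits of the sum or (if `neg`) the difference of two bit lists, and the
final carry. -/
def digits (neg : Bool) : ℕ → Bool → List Bool → List Bool → List Bool × Bool
  | 0, c, _, _ => ([], c)
  | n + 1, c, l, l' =>
    let r := digits neg n (carry neg (l.headD false) (l'.headD false) c) l.tail l'.tail
    ((l.headD false ^^ (l'.headD false ^^ c)) :: r.1, r.2)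

theorem length_digits (neg : Bool) (n : ℕ) : ∀ (c : Bool) (l l' : List Bool),
    (digits neg n c l l').1.length = n := by
  induction n with
  | zero => intros; rfl
  | succ n ih => intros; simp [digits, ih]

theorem digits_add (n : ℕ) : ∀ (c : Bool) (l l' : List Bool), l.length ≤ n → l'.length ≤ n →
    ofBits (digits false n c l l').1 + 2 ^ n * (digits false n c l l').2.toNat =
      ofBits l + ofBits l' + c.toNat := by
  induction n with
  | zero =>
    intro c l l' hl hl'
    rw [List.length_eq_zero_iff.1 (Nat.le_zero.1 hl), List.length_eq_zero_iff.1 (Nat.le_zero.1 hl')]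
    simp [digits, ofBits]
  | succ n ih =>
    intro c l l' hl hl'
    have h := ih (carry false (l.headD false) (l'.headD false) c) l.tail l'.tail
      (by simp; omega) (by simp; omega)
    rw [ofBits_eq_headD_tail l, ofBits_eq_headD_tail l']
    simp only [digits, ofBits, Nat.bit_val, pow_succ]
    -- The full-adder identity for a single digit.
    have key : (l.headD false ^^ (l'.headD false ^^ c)).toNat +
        2 * (carry false (l.headD false) (l'.headD false) c).toNat =
        (l.headD false).toNat + (l'.headD false).toNat + c.toNat := by
      cases l.headD false <;> cases l'.headD false <;> cases c <;> rfl
    linarith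

/-- A borrow out of the last digit is worth `2 ^ n`. As the digits represent less than `2 ^ n`, with
`c = false` the borrow is set exactly when the difference is negative, which is how truncated
subtraction is detected. -/
theorem digits_sub (n : ℕ) : ∀ (c : Bool) (l l' : List Bool), l.length ≤ n → l'.length ≤ n →
    ofBits (digits true n c l l').1 + ofBits l' + c.toNat =
      ofBits l + 2 ^ n * (digits true n c l l').2.toNat := by
  induction n with
  | zero =>
    intro c l l' hl hl'
    rw [List.length_eq_zero_iff.1 (Nat.le_zero.1 hl), List.length_eq_zero_iff.1 (Nat.le_zero.1 hl')]
    simp [digits, ofBits]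
  | succ n ih =>
    intro c l l' hl hl'
    have h := ih (carry true (l.headD false) (l'.headD false) c) l.tail l'.tail
      (by simp; omega) (by simp; omega)
    rw [ofBits_eq_headD_tail l, ofBits_eq_headD_tail l']
    simp only [digits, ofBits, Nat.bit_val, pow_succ]
    have key : (l.headD false ^^ (l'.headD false ^^ c)).toNat +
        (l'.headD false).toNat + c.toNat = (l.headD false).toNat +
        2 * (carry true (l.headD false) (l'.headD false) c).toNat := by
      cases l.headD false <;> cases l'.headD false <;> cases c <;> rfl
    linarith

/-! ### Numbers on stacks -/

/-- The code of a number: its binary digits and a separator. -/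
def enc (x : ℕ) : List Γ' := x.bits.map Γ'.bit ++ [Γ'.comma]

/-- The code of a list of numbers. -/
def encList (l : List ℕ) : List Γ' := l.flatMap enc

@[simp] theorem encList_nil : encList [] = [] := rfl

@[simp] theorem encList_cons (x : ℕ) (l : List ℕ) : encList (x :: l) = enc x ++ encList l := rfl

@[simp] theorem encList_append (l l' : List ℕ) : encList (l ++ l') = encList l ++ encList l' :=
  List.flatMap_append

theorem length_enc (x : ℕ) : (enc x).length = x.size + 1 := by
  simp [enc, Nat.size_eq_bits_len]

/-- The work stacks with given contents, the input stack being empty. -/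
def work (d f t u : List Γ') : WorkStack → List Γ'
  | .input => []
  | .data => d
  | .aux => f
  | .tmp => t
  | .copy => u

section work

variable (d f t u l : List Γ')

@[simp] theorem work_data : work d f t u .data = d := rfl
@[simp] theorem work_aux : work d f t u .aux = f := rfl
@[simp] theorem work_tmp : work d f t u .tmp = t := rfl
@[simp] theorem work_copy : work d f t u .copy = u := rfl

@[simp] theorem update_work_data : Function.update (work d f t u) .data l = work l f t u := by
  funext w
  cases w <;> rfl

@[simp] theorem update_work_aux : Function.update (work d f t u) .aux l = work d l t u := by
  funext w
  cases w <;> rfl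

@[simp] theorem update_work_tmp : Function.update (work d f t u) .tmp l = work d f l u := by
  funext w
  cases w <;> rfl

@[simp] theorem update_work_copy : Function.update (work d f t u) .copy l = work d f t l := by
  funext w
  cases w <;> rfl

end work

/-- Move a number from one stack to another. -/
def moveNum (a b : WorkStack) : Cmd :=
  .seq (moveBits a .tmp) (.seq (push b fun _ => .comma) (moveBits .tmp b))

/-- Copy a number from one stack to another. -/
def copyNum (a b : WorkStack) : Cmd :=
  .seq (moveBits a .tmp) (.seq (push a fun _ => .comma) (.seq (push b fun _ => .comma)
    (moveBitsTwice .tmp a b)))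

variable {s : WorkStack → List Γ'} {R F : List Γ'}

/-- Each `moveBits` reverses the digits, so the detour through `.tmp` restores their order. The
separator swallowed by the first pass is pushed again in between. -/
theorem exec_moveNum {a b : WorkStack} (ha : a ≠ .tmp) (hb : b ≠ .tmp) (hab : a ≠ b) {x : ℕ}
    {v : Reg} (hs : s a = enc x ++ R) (ht : s .tmp = []) :
    Exec (moveNum a b) v s reg₀
      (Function.update (Function.update s a R) b (enc x ++ s b)) (7 * (enc x).length) := by
  refine ((exec_moveBits (l := x.bits) (R := .comma :: R) ha rfl (by simp [hs, enc])).seq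
    ((Exec.push _ _ _ _).seq
      (exec_moveBits (l := x.bits.reverse) (R := []) hb.symm rfl ?_))).congr rfl ?_ ?_
  · simp [ha.symm, hb.symm, ht]
  · funext w
    rcases eq_or_ne w .tmp with rfl | hwt
    · simp [ha.symm, hb.symm, ht]
    rcases eq_or_ne w b with rfl | hwb
    · simp [hb, hab.symm, enc]
    rcases eq_or_ne w a with rfl | hwa
    · simp [hwt, hwb]
    · simp [hwt, hwb, hwa]
  · simp only [enc, List.length_reverse, List.length_append, List.length_map, List.length_singleton]
    omega

theorem exec_copyNum {a b : WorkStack} (ha : a ≠ .tmp) (hb : b ≠ .tmp) (hab : a ≠ b) {x : ℕ}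
    {v : Reg} (hs : s a = enc x ++ R) (ht : s .tmp = []) :
    Exec (copyNum a b) v s reg₀
      (Function.update s b (enc x ++ s b)) (8 * (enc x).length) := by
  refine ((exec_moveBits (l := x.bits) (R := .comma :: R) ha rfl (by simp [hs, enc])).seq
    ((Exec.push _ _ _ _).seq ((Exec.push _ _ _ _).seq
      (exec_moveBitsTwice (l := x.bits.reverse) (R := []) ha.symm hb.symm hab rfl ?_)))).congr
      rfl ?_ ?_
  · simp [ha.symm, hb.symm, ht]
  · funext w
    rcases eq_or_ne w .tmp with rfl | hwt
    · simp [hb.symm, ht]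
    rcases eq_or_ne w b with rfl | hwb
    · simp [hb, hab.symm, enc]
    rcases eq_or_ne w a with rfl | hwa
    · simp [hwt, hwb, hs, enc]
    · simp [hwt, hwb, hwa]
  · simp only [enc, List.length_reverse, List.length_append, List.length_map, List.length_singleton]
    omega

theorem exec_dropNum {x : ℕ} {v : Reg} {t u : List Γ'} :
    Exec (drop .data) v (work (enc x ++ R) F t u) reg₀ (work R F t u) (3 * (enc x).length) := by
  refine (exec_drop (l := x.bits) (R := .comma :: R) rfl (by simp [enc])).congr rfl ?_ ?_
  · simp
  · simp only [enc, List.length_append, List.length_map, List.length_singleton]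
    omega

/-- Push the number zero. -/
def pushZero : Cmd := push .data fun _ => .comma

theorem exec_pushZero : Exec pushZero reg₀ (work R F [] []) reg₀ (work (enc 0 ++ R) F [] []) 1 :=
  (Exec.push _ _ _ _).congr rfl (by simp [enc]) le_rfl

/-- Replace the top number `x` by `2 * x + 1`. -/
def doubleSucc : Cmd := push .data fun _ => .bit true

theorem exec_doubleSucc {x : ℕ} : Exec doubleSucc reg₀ (work (enc x ++ R) F [] []) reg₀
    (work (enc (2 * x + 1) ++ R) F [] []) 1 := by
  exact (Exec.push _ _ _ _).congr rfl (by simp [enc]) le_rfl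

/-- Halve the top number. -/
def halve : Cmd :=
  .seq (popFst .data) (.seq (.ite (fun v => isBit v.1) reset (push .data fun _ => .comma)) reset)

theorem exec_halve {x : ℕ} : Exec halve reg₀ (work (enc x ++ R) F [] []) reg₀
    (work (enc (x / 2) ++ R) F [] []) 4 := by
  induction x using Nat.binaryRec' with
  | zero =>
    -- The code of zero is a bare separator, which has been popped and must be put back.
    refine ((Exec.popFst _ _ _).seq ((Exec.ite_false ?_ (Exec.push _ _ _ _)).seq
      (Exec.reset _ _))).congr rfl ?_ (by omega)
    · simp [enc, isBit]
    · simp [enc]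
  | bit b x h _ =>
    refine ((Exec.popFst _ _ _).seq ((Exec.ite_true ?_ (Exec.reset _ _)).seq
      (Exec.reset _ _))).congr rfl ?_ (by omega)
    · simp [enc, bits_bit b x h, isBit]
    · simp [enc, bits_bit b x h]

/-- Remove the leading zeros of a reversed bit list. -/
def stripTmp : Cmd :=
  .seq (popFst .tmp) (.seq (.loop (fun v => decide (v.1 = some (.bit false))) (popFst .tmp))
    (.seq (.ite (fun v => isBit v.1) (push .tmp fun v => sym v.1) reset) reset))

theorem exec_stripTmp_loop {d f u : List Γ'} (l : List Bool) : ∀ v : Reg,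
    v.1 = (l.map Γ'.bit).head? →
    Exec (.loop (fun v => decide (v.1 = some (.bit false))) (popFst .tmp)) v
      (work d f (l.map Γ'.bit).tail u) (((l.dropWhile (fun b => !b)).map Γ'.bit).head?, v.2)
      (work d f ((l.dropWhile (fun b => !b)).map Γ'.bit).tail u) (2 * l.length + 1) := by
  induction l with
  | nil =>
    intro v hv
    exact (Exec.loop_false (by simp [hv])).congr (Prod.ext (by simpa using hv) rfl) (by simp)
      (by omega)
  | cons b l ih =>
    intro v hv
    cases b with
    | true =>
      refine (Exec.loop_false (by simp [hv])).congr ?_ (by simp) (by omega)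
      simp only [List.map_cons, List.head?_cons] at hv
      simp [← hv]
    | false =>
      have h := Exec.popFst .tmp v (work d f (l.map Γ'.bit) u)
      simp only [work_tmp, update_work_tmp] at h
      refine (Exec.loop_true (by simp [hv]) h (ih ((l.map Γ'.bit).head?, v.2) rfl)).congr ?_ ?_ ?_
      · simp
      · simp
      · simp only [List.length_cons]
        omega

theorem exec_stripTmp {d f u : List Γ'} (l : List Bool) (v : Reg) :
    Exec stripTmp v (work d f (l.map Γ'.bit) u) reg₀
      (work d f ((l.dropWhile (fun b => !b)).map Γ'.bit) u) (2 * l.length + 5) := by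
  have h1 := (exec_stripTmp_loop (d := d) (f := f) (u := u) l ((l.map Γ'.bit).head?, v.2) rfl)
  have h0 := (Exec.popFst .tmp v (work d f (l.map Γ'.bit) u))
  simp only [work_tmp, update_work_tmp] at h0
  cases h : l.dropWhile (fun b => !b) with
  | nil =>
    rw [h] at h1
    exact (h0.seq (h1.seq ((Exec.ite_false (by simp [isBit]) (Exec.reset _ _)).seq
      (Exec.reset _ _)))).congr rfl (by simp) (by omega)
  | cons b l' =>
    rw [h] at h1
    exact (h0.seq (h1.seq ((Exec.ite_true (by simp [isBit]) (Exec.push _ _ _ _)).seq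
      (Exec.reset _ _)))).congr rfl (by simp [sym]) (by omega)

end NumProg

/-! ### Digitwise addition and truncated subtraction -/

namespace NumProg

open Computability (Γ')

/-- One step of the digitwise addition or subtraction. -/
def arithStep (neg : Bool) : Cmd :=
  .seq (push .tmp fun v => .bit (bitVal v.1 ^^ (bitVal v.2.1 ^^ v.2.2)))
    (.seq (.load fun v => (v.1, v.2.1, carry neg (bitVal v.1) (bitVal v.2.1) v.2.2))
      (.seq (.ite (fun v => isBit v.1) (popFst .aux) (.load id))
        (.ite (fun v => isBit v.2.1) (popSnd .data) (.load id))))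

/-- Replace the two top numbers by their sum or (if `neg`) their difference. -/
def arith (neg : Bool) : Cmd :=
  .seq (moveNum .data .aux) (.seq (popFst .aux) (.seq (popSnd .data)
    (.seq (.loop (fun v => isBit v.1 || isBit v.2.1) (arithStep neg))
      (.seq (.ite (fun v => v.2.2) (if neg then drop .tmp else push .tmp fun _ => .bit true) reset)
        (.seq stripTmp (.seq (push .data fun _ => .comma) (moveBits .tmp .data)))))))

variable {R F : List Γ'}

theorem exec_pop_ite_aux (l : List Bool) (v : Reg) (d t u : List Γ')
    (hv : v.1 = (l.map Γ'.bit ++ .comma :: F).head?) :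
    Exec (.ite (fun v => isBit v.1) (popFst .aux) (.load id)) v
      (work d (l.map Γ'.bit ++ .comma :: F).tail t u)
      ((l.tail.map Γ'.bit ++ .comma :: F).head?, v.2)
      (work d (l.tail.map Γ'.bit ++ .comma :: F).tail t u) 2 := by
  cases l with
  | nil =>
    refine (Exec.ite_false (by simp [hv, isBit]) (Exec.load _ _ _)).congr ?_ rfl le_rfl
    exact Prod.ext (by simpa using hv) rfl
  | cons b l =>
    exact (Exec.ite_true (by simp [hv, isBit]) (Exec.popFst _ _ _)).congr (by simp) (by simp) le_rfl

theorem exec_pop_ite_data (l : List Bool) (v : Reg) (f t u : List Γ')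
    (hv : v.2.1 = (l.map Γ'.bit ++ .comma :: R).head?) :
    Exec (.ite (fun v => isBit v.2.1) (popSnd .data) (.load id)) v
      (work (l.map Γ'.bit ++ .comma :: R).tail f t u)
      (v.1, (l.tail.map Γ'.bit ++ .comma :: R).head?, v.2.2)
      (work (l.tail.map Γ'.bit ++ .comma :: R).tail f t u) 2 := by
  cases l with
  | nil =>
    refine (Exec.ite_false (by simp [hv, isBit]) (Exec.load _ _ _)).congr ?_ rfl le_rfl
    exact Prod.ext rfl (Prod.ext (by simpa using hv) rfl)
  | cons b l =>
    exact (Exec.ite_true (by simp [hv, isBit]) (Exec.popSnd _ _ _)).congr (by simp) (by simp) le_rfl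

theorem bitVal_head (l : List Bool) (R : List Γ') :
    bitVal (l.map Γ'.bit ++ .comma :: R).head? = l.headD false := by
  cases l <;> simp [bitVal]

theorem isBit_head (l : List Bool) (R : List Γ') :
    isBit (l.map Γ'.bit ++ .comma :: R).head? = !l.isEmpty := by
  cases l <;> simp [isBit]

/-- The registers hold the current digits of both numbers and the carry. An exhausted number leaves
its separator in the register; its `bitVal` is `false`, so the shorter number is padded with zeros.
-/
theorem exec_arith_loop (neg : Bool) (n : ℕ) : ∀ (l l' : List Bool) (c : Bool) (t u : List Γ'),
    max l.length l'.length = n →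
    Exec (.loop (fun v => isBit v.1 || isBit v.2.1) (arithStep neg))
      ((l.map Γ'.bit ++ .comma :: F).head?, (l'.map Γ'.bit ++ .comma :: R).head?, c)
      (work (l'.map Γ'.bit ++ .comma :: R).tail (l.map Γ'.bit ++ .comma :: F).tail t u)
      (some .comma, some .comma, (digits neg n c l l').2)
      (work R F ((digits neg n c l l').1.reverse.map Γ'.bit ++ t) u) (7 * n + 1) := by
  induction n with
  | zero =>
    intro l l' c t u h
    rw [Nat.max_eq_zero_iff, List.length_eq_zero_iff, List.length_eq_zero_iff] at h
    obtain ⟨rfl, rfl⟩ := h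
    exact Exec.loop_false rfl
  | succ n ih =>
    intro l l' c t u h
    have ht := ih l.tail l'.tail (carry neg (l.headD false) (l'.headD false) c)
      (.bit (l.headD false ^^ (l'.headD false ^^ c)) :: t) u (by simp; omega)
    have h1 := Exec.push .tmp (fun v => .bit (bitVal v.1 ^^ (bitVal v.2.1 ^^ v.2.2)))
      ((l.map Γ'.bit ++ .comma :: F).head?, (l'.map Γ'.bit ++ .comma :: R).head?, c)
      (work (l'.map Γ'.bit ++ .comma :: R).tail (l.map Γ'.bit ++ .comma :: F).tail t u)
    simp only [bitVal_head, work_tmp, update_work_tmp] at h1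
    have h2 := Exec.load (fun v => (v.1, v.2.1, carry neg (bitVal v.1) (bitVal v.2.1) v.2.2))
      ((l.map Γ'.bit ++ .comma :: F).head?, (l'.map Γ'.bit ++ .comma :: R).head?, c)
      (work (l'.map Γ'.bit ++ .comma :: R).tail (l.map Γ'.bit ++ .comma :: F).tail
        (.bit (l.headD false ^^ (l'.headD false ^^ c)) :: t) u)
    simp only [bitVal_head] at h2
    refine (Exec.loop_true ?_ (h1.seq (h2.seq ((exec_pop_ite_aux l _ _ _ _ rfl).seq
      (exec_pop_ite_data l' _ _ _ _ rfl)))) ht).congr ?_ ?_ ?_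
    · simp only [isBit_head]
      cases l
      · cases l'
        · simp at h
        · simp
      · simp
    · simp [digits]
    · simp [digits]
    · omega

theorem exec_arith (neg : Bool) (x y : ℕ) : Exec (arith neg) reg₀
    (work (enc x ++ enc y ++ R) F [] []) reg₀ (work (enc (if neg then x - y else x + y) ++ R) F [] [])
    (40 * ((enc x).length + (enc y).length)) := by
  set n := max x.bits.length y.bits.length with hn
  have hx : x.bits.length ≤ n := le_max_left _ _
  have hy : y.bits.length ≤ n := le_max_right _ _
  have h0 := exec_moveNum (a := .data) (b := .aux) (x := x) (v := reg₀) (R := enc y ++ R)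
    (s := work (enc x ++ enc y ++ R) F [] []) (by decide) (by decide) (by decide) (by simp) rfl
  simp only [update_work_data, work_aux, update_work_aux] at h0
  have h1 := Exec.popFst .aux reg₀ (work (enc y ++ R) (enc x ++ F) [] [])
  have h2 := Exec.popSnd .data ((enc x ++ F).head?, reg₀.2) (work (enc y ++ R) (enc x ++ F).tail [] [])
  simp only [work_aux, work_data, update_work_data, update_work_aux] at h1 h2
  have h3 := exec_arith_loop (R := R) (F := F) neg n x.bits y.bits false [] [] rfl
  simp only [enc, List.append_assoc, List.singleton_append] at h0 h1 h2 ⊢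
  have hlen := length_digits neg n false x.bits y.bits
  -- On `.tmp` the most significant digit lies on top, so stripping removes leading zeros and the
  -- last move turns the digits round again.
  have hlast : ∀ (l : List Bool) (v : Reg), ofBits l = (if neg then x - y else x + y) → l.length ≤ n + 1 →
      Exec (.seq stripTmp (.seq (push .data fun _ => .comma) (moveBits .tmp .data))) v
      (work R F (l.reverse.map Γ'.bit) []) reg₀
      (work (enc (if neg then x - y else x + y) ++ R) F [] []) (5 * n + 20) := by
    intro l v hl hll
    have h5 := exec_stripTmp (d := R) (f := F) (u := []) l.reverse v
    have h6 := Exec.push .data (fun _ => .comma) reg₀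
      (work R F ((l.reverse.dropWhile fun b => !b).map Γ'.bit) [])
    simp only [work_data, update_work_data] at h6
    have h7 := exec_moveBits (a := .tmp) (b := .data) (R := []) (l := l.reverse.dropWhile fun b => !b)
      (v := reg₀) (s := work (.comma :: R) F ((l.reverse.dropWhile fun b => !b).map Γ'.bit) [])
      (by decide) rfl (by simp)
    refine (h5.seq (h6.seq h7)).congr rfl ?_ ?_
    · simp [enc, ← hl, bits_ofBits, List.rdropWhile]
    · have := (List.dropWhile_sublist (fun b => !b) (l := l.reverse)).length_le
      simp only [List.length_reverse] at this ⊢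
      omega
  have hadd := digits_add n false x.bits y.bits hx hy
  have hsub := digits_sub n false x.bits y.bits hx hy
  have hlt := ofBits_lt (digits neg n false x.bits y.bits).1
  rw [hlen] at hlt
  simp only [ofBits_bits, Bool.toNat_false, add_zero] at hadd hsub
  -- A final carry becomes an additional top digit of a sum. For a difference it means `x < y`, so
  -- all digits are dropped and the empty list represents the value `0`.
  have hmid : ∃ l : List Bool, ofBits l = (if neg then x - y else x + y) ∧ l.length ≤ n + 1 ∧
      Exec (.ite (fun v => v.2.2) (if neg then drop .tmp else push .tmp fun _ => .bit true) reset)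
        (some .comma, some .comma, (digits neg n false x.bits y.bits).2)
        (work R F ((digits neg n false x.bits y.bits).1.reverse.map Γ'.bit) [])
        (if neg || !(digits neg n false x.bits y.bits).2 then reg₀ else
          (some .comma, some .comma, (digits neg n false x.bits y.bits).2))
        (work R F (l.reverse.map Γ'.bit) []) (2 * n + 4) := by
    cases hc : (digits neg n false x.bits y.bits).2 with
    | false =>
      refine ⟨(digits neg n false x.bits y.bits).1, ?_, by omega,
        (Exec.ite_false rfl (Exec.reset _ _)).congr (by simp) rfl (by omega)⟩
      cases neg with
      | false => simpa [hc] using hadd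
      | true =>
        simp only [hc, Bool.toNat_false, mul_zero, add_zero] at hsub
        simp only [if_true]
        omega
    | true =>
      cases neg with
      | false =>
        refine ⟨(digits false n false x.bits y.bits).1 ++ [true], ?_, by simp [hlen],
          (Exec.ite_true rfl (Exec.push _ _ _ _)).congr (by simp) (by simp) (by omega)⟩
        simp [ofBits_append, hlen, ofBits, hc, ← hadd]
      | true =>
        refine ⟨[], ?_, by simp, (Exec.ite_true rfl
          (exec_drop (l := (digits true n false x.bits y.bits).1.reverse) (R := []) rfl
            (by simp))).congr (by simp) (by simp) (by simp [hlen])⟩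
        simp only [hc, Bool.toNat_true, mul_one] at hsub
        simp only [ofBits, if_true]
        omega
  obtain ⟨l, hl, hll, hmid⟩ := hmid
  rw [List.append_nil] at h3
  refine (h0.seq (h1.seq (h2.seq (h3.seq (hmid.seq (hlast l _ hl hll)))))).congr rfl ?_ ?_
  · simp [enc]
  · simp only [List.length_append, List.length_map, List.length_singleton]
    omega

theorem exec_add (x y : ℕ) : Exec (arith false) reg₀ (work (enc x ++ enc y ++ R) F [] []) reg₀
    (work (enc (x + y) ++ R) F [] []) (40 * ((enc x).length + (enc y).length)) :=
  exec_arith false x y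

theorem exec_sub (x y : ℕ) : Exec (arith true) reg₀ (work (enc x ++ enc y ++ R) F [] []) reg₀
    (work (enc (x - y) ++ R) F [] []) (40 * ((enc x).length + (enc y).length)) :=
  exec_arith true x y

end NumProg

/-! ### Polynomial bounds -/

/-- `T` is bounded by a polynomial in `m`. -/
def PolyBdd {β : Type} (m T : β → ℕ) : Prop :=
  ∃ p : Polynomial ℕ, ∀ b, T b ≤ p.eval (m b)

/-- Coefficients in `ℕ` make evaluation monotone; this is what lets bounds be composed. -/
theorem Polynomial.eval_le_eval_of_le (p : Polynomial ℕ) {x y : ℕ} (h : x ≤ y) :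
    p.eval x ≤ p.eval y := by
  rw [Polynomial.eval_eq_sum, Polynomial.eval_eq_sum]
  exact Finset.sum_le_sum fun i _ => Nat.mul_le_mul_left _ (Nat.pow_le_pow_left h i)

namespace PolyBdd

variable {β γ : Type} {m T T' : β → ℕ}

theorem const (n : ℕ) : PolyBdd m fun _ => n := ⟨Polynomial.C n, by simp⟩

theorem self : PolyBdd m m := ⟨Polynomial.X, by simp⟩

theorem add (h : PolyBdd m T) (h' : PolyBdd m T') : PolyBdd m fun b => T b + T' b := by
  obtain ⟨p, hp⟩ := h
  obtain ⟨q, hq⟩ := h'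
  exact ⟨p + q, fun b => by simpa using Nat.add_le_add (hp b) (hq b)⟩

theorem mul (h : PolyBdd m T) (h' : PolyBdd m T') : PolyBdd m fun b => T b * T' b := by
  obtain ⟨p, hp⟩ := h
  obtain ⟨q, hq⟩ := h'
  exact ⟨p * q, fun b => by simpa using Nat.mul_le_mul (hp b) (hq b)⟩

theorem of_le (h : PolyBdd m T') (hle : ∀ b, T b ≤ T' b) : PolyBdd m T := by
  obtain ⟨p, hp⟩ := h
  exact ⟨p, fun b => (hle b).trans (hp b)⟩

theorem comp {m' S : γ → ℕ} (h : PolyBdd m' S) (φ : β → γ)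
    (hφ : PolyBdd m fun b => m' (φ b)) : PolyBdd m fun b => S (φ b) := by
  obtain ⟨p, hp⟩ := h
  obtain ⟨q, hq⟩ := hφ
  refine ⟨p.comp q, fun b => (hp _).trans ?_⟩
  rw [Polynomial.eval_comp]
  exact p.eval_le_eval_of_le (hq b)

end PolyBdd

/-! ### Tuples of numbers and polynomial-time functions between them -/

/-- Types whose elements are tuples of natural numbers. -/
class NatTuple (β : Type) where
  /-- the number of components -/
  arity : ℕ
  /-- the components -/
  toList : β → List ℕ
  length_toList : ∀ b, (toList b).length = arity

namespace NatTuple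

instance : NatTuple ℕ where
  arity := 1
  toList n := [n]
  length_toList _ := rfl

instance {β γ : Type} [NatTuple β] [NatTuple γ] : NatTuple (β × γ) where
  arity := arity β + arity γ
  toList p := toList p.1 ++ toList p.2
  length_toList p := by simp [length_toList]

@[simp] theorem toList_pair {β γ : Type} [NatTuple β] [NatTuple γ] (b : β) (c : γ) :
    toList (b, c) = toList b ++ toList c := rfl

end NatTuple

namespace NumProg

open Computability (Γ')
open NatTuple

variable {α β γ δ : Type} [NatTuple α] [NatTuple β] [NatTuple γ] [NatTuple δ]

/-- The code of a tuple on a stack. -/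
def code (b : β) : List Γ' := encList (toList b)

/-- The length of the code of a tuple. -/
def width (b : β) : ℕ := (code b).length

@[simp] theorem code_pair (b : β) (c : γ) : code (b, c) = code b ++ code c := encList_append _ _

@[simp] theorem code_nat (n : ℕ) : code n = enc n := List.append_nil _

@[simp] theorem width_pair (b : β) (c : γ) : width (b, c) = width b + width c := by
  simp [width]

@[simp] theorem width_nat (n : ℕ) : width n = n.size + 1 := by simp [width, length_enc]

/-- Repeat a program. -/
def rep (c : Cmd) : ℕ → Cmd
  | 0 => reset
  | n + 1 => .seq c (rep c n)

variable {R F U : List Γ'}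

/-- Moving number by number reverses the order within a block; a second move undoes this wherever
the lemma is used. -/
theorem exec_moveBlock_data_aux (l : List ℕ) : ∀ (v : Reg) (F : List Γ'),
    Exec (rep (moveNum .data .aux) l.length) v (work (encList l ++ R) F [] U) reg₀
      (work R (encList l.reverse ++ F) [] U) (7 * (encList l).length + 1) := by
  induction l with
  | nil => exact fun v F => Exec.reset _ _
  | cons x l ih =>
    intro v F
    refine ((exec_moveNum (x := x) (R := encList l ++ R) (by decide) (by decide) (by decide)
      (by simp) rfl).seq ((ih reg₀ (enc x ++ F)).congr_start (by simp))).congr rfl ?_ ?_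
    · simp
    · simp only [encList_cons, List.length_append]
      omega

theorem exec_moveBlock_aux_data (l : List ℕ) : ∀ (v : Reg) (R : List Γ'),
    Exec (rep (moveNum .aux .data) l.length) v (work R (encList l ++ F) [] U) reg₀
      (work (encList l.reverse ++ R) F [] U) (7 * (encList l).length + 1) := by
  induction l with
  | nil => exact fun v F => Exec.reset _ _
  | cons x l ih =>
    intro v R
    refine ((exec_moveNum (x := x) (R := encList l ++ F) (by decide) (by decide) (by decide)
      (by simp) rfl).seq ((ih reg₀ (enc x ++ R)).congr_start (by simp))).congr rfl ?_ ?_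
    · simp
    · simp only [encList_cons, List.length_append]
      omega

theorem exec_moveBlock_copy_data (l : List ℕ) : ∀ (v : Reg) (R : List Γ'),
    Exec (rep (moveNum .copy .data) l.length) v (work R F [] (encList l ++ U)) reg₀
      (work (encList l.reverse ++ R) F [] U) (7 * (encList l).length + 1) := by
  induction l with
  | nil => exact fun v F => Exec.reset _ _
  | cons x l ih =>
    intro v R
    refine ((exec_moveNum (x := x) (R := encList l ++ U) (by decide) (by decide) (by decide)
      (by simp) rfl).seq ((ih reg₀ (enc x ++ R)).congr_start (by simp))).congr rfl ?_ ?_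
    · simp
    · simp only [encList_cons, List.length_append]
      omega

theorem exec_copyBlock (l : List ℕ) : ∀ (v : Reg) (F U : List Γ'),
    Exec (rep (.seq (copyNum .data .copy) (moveNum .data .aux)) l.length) v
      (work (encList l ++ R) F [] U) reg₀
      (work R (encList l.reverse ++ F) [] (encList l.reverse ++ U))
      (15 * (encList l).length + 1) := by
  induction l with
  | nil => exact fun v F U => Exec.reset _ _
  | cons x l ih =>
    intro v F U
    have h1 := exec_copyNum (a := .data) (b := .copy) (x := x) (R := encList l ++ R) (v := v)
      (s := work (enc x ++ (encList l ++ R)) F [] U) (by decide) (by decide) (by decide) rfl rfl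
    have h2 := exec_moveNum (a := .data) (b := .aux) (x := x) (R := encList l ++ R) (v := reg₀)
      (s := work (enc x ++ (encList l ++ R)) F [] (enc x ++ U)) (by decide) (by decide) (by decide)
      rfl rfl
    simp only [work_copy, update_work_copy, update_work_data, update_work_aux, work_aux] at h1 h2
    refine (((h1.seq h2).seq (ih reg₀ (enc x ++ F) (enc x ++ U))).congr_start (by simp)).congr
      rfl ?_ ?_
    · simp
    · simp only [encList_cons, List.length_append]
      omega

theorem exec_dropBlock (l : List ℕ) : ∀ v : Reg,
    Exec (rep (drop .data) l.length) v (work (encList l ++ R) F [] U) reg₀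
      (work R F [] U) (3 * (encList l).length + 1) := by
  induction l with
  | nil => exact fun v => Exec.reset _ _
  | cons x l ih =>
    intro v
    refine (((exec_dropNum (x := x) (R := encList l ++ R)).seq (ih reg₀)).congr_start
      (by simp)).congr rfl rfl ?_
    simp only [encList_cons, List.length_append]
    omega

theorem length_encList_reverse (l : List ℕ) :
    (encList l.reverse).length = (encList l).length := by
  induction l with
  | nil => rfl
  | cons x l ih => simp [ih, add_comm]

/-- Copy the block of `r` numbers that lies under the top `i` numbers. -/
def pick (i r : ℕ) : Cmd :=
  .seq (rep (moveNum .data .aux) i)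
    (.seq (rep (.seq (copyNum .data .copy) (moveNum .data .aux)) r)
      (.seq (rep (moveNum .aux .data) r) (.seq (rep (moveNum .aux .data) i)
        (rep (moveNum .copy .data) r))))

/-- Both blocks travel to `.aux` and back, while a reversed duplicate of the lower block waits on
`.copy` and is put back in order when moved on top. -/
theorem exec_pick (l l' : List ℕ) (v : Reg) :
    Exec (pick l.length l'.length) v (work (encList l ++ (encList l' ++ R)) F [] []) reg₀
      (work (encList l' ++ (encList l ++ (encList l' ++ R))) F [] [])
      (50 * (encList l ++ encList l').length + 5) := by
  have h3 := exec_moveBlock_aux_data (F := encList l.reverse ++ F) (U := encList l'.reverse)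
    l'.reverse reg₀ R
  have h4 := exec_moveBlock_aux_data (F := F) (U := encList l'.reverse)
    l.reverse reg₀ (encList l' ++ R)
  have h5 := exec_moveBlock_copy_data (F := F) (U := [])
    l'.reverse reg₀ (encList l ++ (encList l' ++ R))
  simp only [List.reverse_reverse, List.length_reverse, length_encList_reverse, List.append_nil] at h3 h4 h5
  have h2 := exec_copyBlock (R := R) l' reg₀ (encList l.reverse ++ F) []
  rw [List.append_nil] at h2
  refine ((exec_moveBlock_data_aux l v F).seq (h2.seq
    (h3.seq (h4.seq h5)))).congr rfl rfl ?_
  simp only [List.length_append]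
  omega

/-- Functions between tuples of natural numbers that are computable in polynomial time. -/
structure PolyC (φ : β → γ) : Prop where
  exists_program : ∃ (c : Cmd) (T : β → ℕ),
    PolyBdd width T ∧ PolyBdd width (fun b => width (φ b)) ∧
    ∀ (b : β) (R F : List Γ'), Exec c reg₀ (work (code b ++ R) F [] []) reg₀
      (work (code (φ b) ++ (code b ++ R)) F [] []) (T b)

namespace PolyC

theorem congr {φ ψ : β → γ} (h : PolyC φ) (e : ∀ b, φ b = ψ b) : PolyC ψ := by
  rwa [← funext e]

theorem fst : PolyC (Prod.fst : β × γ → β) := by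
  refine ⟨pick 0 (arity β), fun p => 50 * width p.1 + 5, ?_, ?_, fun ⟨b, c⟩ R F => ?_⟩
  · exact (((PolyBdd.const 50).mul PolyBdd.self).add (PolyBdd.const 5)).of_le fun p => by
      obtain ⟨b, c⟩ := p
      simp only [width_pair]
      omega
  · exact PolyBdd.self.of_le fun p => by
      obtain ⟨b, c⟩ := p
      simp
  · have h := exec_pick (R := code c ++ R) (F := F) [] (toList b) reg₀
    rw [length_toList] at h
    exact (h.congr_start (by simp [code])).congr rfl (by simp [code]) (by simp [width, code])

theorem snd : PolyC (Prod.snd : β × γ → γ) := by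
  refine ⟨pick (arity β) (arity γ), fun p => 50 * width p + 5, ?_, ?_, fun ⟨b, c⟩ R F => ?_⟩
  · exact ((PolyBdd.const 50).mul PolyBdd.self).add (PolyBdd.const 5)
  · exact PolyBdd.self.of_le fun p => by
      obtain ⟨b, c⟩ := p
      simp
  · have h := exec_pick (R := R) (F := F) (toList b) (toList c) reg₀
    rw [length_toList, length_toList] at h
    exact (h.congr_start (by simp [code])).congr rfl (by simp [code]) (by simp [width, code])

theorem id : PolyC (fun b : β => b) := by
  refine ⟨pick 0 (arity β), fun p => 50 * width p + 5, ?_, PolyBdd.self, fun p R F => ?_⟩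
  · exact ((PolyBdd.const 50).mul PolyBdd.self).add (PolyBdd.const 5)
  · have h := exec_pick (R := R) (F := F) [] (toList p) reg₀
    rw [length_toList] at h
    exact (h.congr_start (by simp [code])).congr rfl (by simp [code]) (by simp [width, code])

/-- The running time of `ψ` is polynomial in the width of `φ b`; the output bound contained in
`PolyC` makes it polynomial in the width of `b`. The result is parked on `.aux` while the
intermediate value is dropped. -/
theorem comp {ψ : γ → δ} {φ : β → γ} (hψ : PolyC ψ) (hφ : PolyC φ) :
    PolyC fun b => ψ (φ b) := by
  obtain ⟨c, T, hT, hs, hc⟩ := hφ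
  obtain ⟨c', T', hT', hs', hc'⟩ := hψ
  refine ⟨.seq c (.seq c' (.seq (rep (moveNum .data .aux) (arity δ))
    (.seq (rep (drop .data) (arity γ)) (rep (moveNum .aux .data) (arity δ))))),
    fun b => T b + (T' (φ b) + (14 * width (ψ (φ b)) + 3 * width (φ b) + 3)),
    hT.add ((hT'.comp φ hs).add ((((PolyBdd.const 14).mul (hs'.comp φ hs)).add
      ((PolyBdd.const 3).mul hs)).add (PolyBdd.const 3))), hs'.comp φ hs, fun b R F => ?_⟩
  have h3 := exec_moveBlock_data_aux (F := F) (U := [])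
    (R := code (φ b) ++ (code b ++ R)) (toList (ψ (φ b))) reg₀
  have h4 := exec_dropBlock (F := encList (toList (ψ (φ b))).reverse ++ F) (U := [])
    (R := code b ++ R) (toList (φ b)) reg₀
  have h5 := exec_moveBlock_aux_data (F := F) (U := []) (toList (ψ (φ b))).reverse reg₀ (code b ++ R)
  rw [List.length_reverse, List.reverse_reverse, length_encList_reverse] at h5
  rw [length_toList] at h3 h4 h5
  refine ((hc b R F).seq ((hc' (φ b) _ F).seq (h3.seq (h4.seq h5)))).congr rfl rfl ?_
  simp only [width, code]
  omega

/-- The first value is parked on `.aux`, so that the argument is on top again for the second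
program. -/
theorem pair {φ : β → γ} {ψ : β → δ} (hφ : PolyC φ) (hψ : PolyC ψ) :
    PolyC fun b => (φ b, ψ b) := by
  obtain ⟨c, T, hT, hs, hc⟩ := hφ
  obtain ⟨c', T', hT', hs', hc'⟩ := hψ
  refine ⟨.seq c (.seq (rep (moveNum .data .aux) (arity γ)) (.seq c'
    (rep (moveNum .aux .data) (arity γ)))),
    fun b => T b + (T' b + (14 * width (φ b) + 2)),
    hT.add (hT'.add (((PolyBdd.const 14).mul hs).add (PolyBdd.const 2))),
    (hs.add hs').of_le fun b => by simp, fun b R F => ?_⟩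
  have h3 := exec_moveBlock_data_aux (F := F) (U := []) (R := code b ++ R) (toList (φ b)) reg₀
  have h5 := exec_moveBlock_aux_data (F := F) (U := []) (toList (φ b)).reverse reg₀
    (code (ψ b) ++ (code b ++ R))
  rw [List.length_reverse, List.reverse_reverse, length_encList_reverse] at h5
  rw [length_toList] at h3 h5
  refine ((hc b R F).seq (h3.seq ((hc' b R _).seq h5))).congr rfl ?_ ?_
  · simp [code]
  · simp only [width, code]
    omega

/-- A function computed by a program that replaces the argument by the value. -/
theorem of_replace {φ : β → γ} (c : Cmd) (T : β → ℕ) (hT : PolyBdd width T)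
    (hs : PolyBdd width fun b => width (φ b)) (hc : ∀ (b : β) (R F : List Γ'),
      Exec c reg₀ (work (code b ++ R) F [] []) reg₀ (work (code (φ b) ++ R) F [] []) (T b)) :
    PolyC φ := by
  obtain ⟨c₀, T₀, hT₀, -, hc₀⟩ := PolyC.id (β := β)
  exact ⟨.seq c₀ c, fun b => T₀ b + T b, hT₀.add hT, hs,
    fun b R F => (hc₀ b R F).seq (hc b _ F)⟩

theorem zero : PolyC fun _ : β => 0 :=
  ⟨pushZero, fun _ => 1, PolyBdd.const 1, (PolyBdd.const 1).of_le (by simp), fun b R F => by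
    simpa using exec_pushZero⟩

theorem doubleSucc : PolyC fun x : ℕ => 2 * x + 1 :=
  of_replace NumProg.doubleSucc (fun _ => 1) (PolyBdd.const 1)
    ((PolyBdd.self.add (PolyBdd.const 1)).of_le fun x => by
      have h := Nat.size_bit (b := true) (n := x) (by simp)
      rw [Nat.bit_val, Bool.toNat_true] at h
      simp [h])
    fun b R F => by simpa using exec_doubleSucc

theorem halve : PolyC fun x : ℕ => x / 2 :=
  of_replace NumProg.halve (fun _ => 4) (PolyBdd.const 4)
    (PolyBdd.self.of_le fun x => by
      simpa using Nat.size_le_size (Nat.div_le_self x 2))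
    fun b R F => by simpa using exec_halve

/-- Subadditivity is weaker than the usual maximum plus one, but it has the same form as the bound
for products, so `PolyC.fold` can treat sums and products together. -/
theorem size_add_le (x y : ℕ) : (x + y).size ≤ x.size + y.size := by
  rcases Nat.eq_zero_or_pos x with rfl | hx
  · simp
  rcases Nat.eq_zero_or_pos y with rfl | hy
  · simp
  rw [Nat.size_le]
  have h1 := Nat.lt_size_self x
  have h2 := Nat.lt_size_self y
  have h3 : 2 ≤ 2 ^ x.size := Nat.le_self_pow (by simpa [Nat.size_eq_zero] using hx.ne') 2
  have h4 : 2 ≤ 2 ^ y.size := Nat.le_self_pow (by simpa [Nat.size_eq_zero] using hy.ne') 2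
  rw [pow_add]
  nlinarith

theorem size_mul_le (x y : ℕ) : (x * y).size ≤ x.size + y.size := by
  rw [Nat.size_le, pow_add]
  exact Nat.mul_lt_mul'' (Nat.lt_size_self x) (Nat.lt_size_self y)

theorem add_pair : PolyC fun p : ℕ × ℕ => p.1 + p.2 :=
  of_replace (arith false) (fun p => 40 * width p) ((PolyBdd.const 40).mul PolyBdd.self)
    (PolyBdd.self.of_le fun p => by
      obtain ⟨x, y⟩ := p
      have := size_add_le x y
      simp
      omega)
    fun ⟨x, y⟩ R F => ((exec_add (R := R) (F := F) x y).congr_start (by simp)).congr rfl (by simp)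
      (by simp [length_enc])

theorem sub_pair : PolyC fun p : ℕ × ℕ => p.1 - p.2 :=
  of_replace (arith true) (fun p => 40 * width p) ((PolyBdd.const 40).mul PolyBdd.self)
    (PolyBdd.self.of_le fun p => by
      obtain ⟨x, y⟩ := p
      have := Nat.size_le_size (Nat.sub_le x y)
      simp
      omega)
    fun ⟨x, y⟩ R F => ((exec_sub (R := R) (F := F) x y).congr_start (by simp)).congr rfl (by simp)
      (by simp [length_enc])

end PolyC

end NumProg

/-! ### Case distinction and bounded recursion on notation -/

namespace NumProg

open Computability (Γ')
open NatTuple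

variable {β γ : Type} [NatTuple β] [NatTuple γ] {R F : List Γ'}

/-- Read the top symbol of the data stack into the first register. -/
def peek : Cmd := .seq (popFst .data) (push .data fun v => sym v.1)

theorem exec_peek (x : ℕ) (v : Reg) : Exec peek v (work (enc x ++ R) F [] [])
    ((enc x).head?, v.2) (work (enc x ++ R) F [] []) 2 := by
  refine ((Exec.popFst _ _ _).seq (Exec.push _ _ _ _)).congr ?_ ?_ le_rfl
  · cases h : x.bits <;> simp [enc, h]
  · cases h : x.bits <;> simp [enc, h, sym]

/-- Only zero has no binary digits, so testing for zero means inspecting one symbol. -/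
theorem isBit_head_enc (x : ℕ) : isBit (enc x).head? = decide (x ≠ 0) := by
  have h : isBit (enc x).head? = !x.bits.isEmpty := isBit_head x.bits []
  have h' : x.bits = [] ↔ x = 0 := by
    rw [← List.length_eq_zero_iff, Nat.size_eq_bits_len, Nat.size_eq_zero]
  rw [h]
  by_cases hx : x = 0
  · simp [hx]
  · simp [hx, mt h'.1 hx]

namespace PolyC

theorem ite_ne_zero {t : β → ℕ} {f g : β → γ} (ht : PolyC t) (hf : PolyC f) (hg : PolyC g) :
    PolyC fun b => if t b ≠ 0 then f b else g b := by
  obtain ⟨c, T, hT, hs, hc⟩ := ht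
  obtain ⟨c₁, T₁, hT₁, hs₁, hc₁⟩ := hf
  obtain ⟨c₂, T₂, hT₂, hs₂, hc₂⟩ := hg
  refine ⟨.seq c (.seq peek (.ite (fun v => isBit v.1) (.seq (drop .data) c₁)
    (.seq (drop .data) c₂))), fun b => T b + (3 * width (t b) + T₁ b + T₂ b + 3),
    hT.add (((((PolyBdd.const 3).mul hs).add hT₁).add hT₂).add (PolyBdd.const 3)),
    (hs₁.add hs₂).of_le fun b => ?_, fun b R F => ?_⟩
  · split_ifs <;> omega
  · have h := hc b R F
    have hw : width (t b) = (enc (t b)).length := by simp [width]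
    rw [code_nat] at h
    beta_reduce
    by_cases h0 : t b = 0
    · rw [if_neg (not_not.2 h0)]
      exact (h.seq ((exec_peek _ _).seq (Exec.ite_false (by simp [isBit_head_enc, h0])
        (exec_dropNum.seq (hc₂ b R F))))).mono (by omega)
    · rw [if_pos h0]
      exact (h.seq ((exec_peek _ _).seq (Exec.ite_true (by simp [isBit_head_enc, h0])
        (exec_dropNum.seq (hc₁ b R F))))).mono (by omega)

end PolyC

/-- Recursion on notation: starting with `r`, apply `h y'` for each proper prefix `y'` of the
binary representation of `y`, the longest one first. -/
def bitLoop (h : ℕ → ℕ → ℕ) (y r : ℕ) : ℕ :=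
  if y = 0 then r else bitLoop h (y / 2) (h (y / 2) r)
termination_by y
decreasing_by omega

theorem bitLoop_zero (h : ℕ → ℕ → ℕ) (r : ℕ) : bitLoop h 0 r = r := by
  rw [bitLoop, if_pos rfl]

theorem bitLoop_of_ne_zero (h : ℕ → ℕ → ℕ) {y : ℕ} (hy : y ≠ 0) (r : ℕ) :
    bitLoop h y r = bitLoop h (y / 2) (h (y / 2) r) := by
  rw [bitLoop, if_neg hy]

theorem size_div_two_add_one {y : ℕ} (hy : y ≠ 0) : (y / 2).size + 1 = y.size := by
  have h := Nat.size_bit (b := y.bodd) (n := y.div2) (by rwa [Nat.bit_bodd_div2])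
  rw [Nat.bit_bodd_div2, Nat.div2_val] at h
  exact h.symm

/-- The body of the loop that performs a recursion on notation. -/
def bitLoopBody (c : Cmd) : Cmd :=
  .seq reset (.seq halve (.seq (moveNum .aux .data) (.seq c (.seq (moveNum .data .aux)
    (.seq (drop .data) peek)))))

/-- The accumulator rests on `.aux`; once it is moved on top of the halved counter and `b`, the
stack shows exactly the argument `(r, y / 2, b)` of `h`. There are `y.size` rounds. The invariant
`P` keeps the accumulator below `S` bits and each call of `h` below time `W`. -/
theorem exec_bitLoop {h : ℕ × ℕ × β → ℕ} {c : Cmd} {T : ℕ × ℕ × β → ℕ}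
    (hc : ∀ (p : ℕ × ℕ × β) (R F : List Γ'), Exec c reg₀ (work (code p ++ R) F [] []) reg₀
      (work (code (h p) ++ (code p ++ R)) F [] []) (T p))
    (b : β) (P : ℕ → ℕ → Prop) (S W : ℕ)
    (hP : ∀ y r, y ≠ 0 → P y r → P (y / 2) (h (r, y / 2, b)))
    (hS : ∀ y r, P y r → r.size ≤ S) (hT : ∀ y r, y ≠ 0 → P y r → T (r, y / 2, b) ≤ W) :
    ∀ (n y r : ℕ) (v : Option Γ' × Bool), y.size = n → P y r →
    P 0 (bitLoop (fun y r => h (r, y, b)) y r) ∧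
    ∃ v', Exec (.loop (fun v => isBit v.1) (bitLoopBody c)) ((enc y).head?, v)
      (work (enc y ++ (code b ++ R)) (enc r ++ F) [] []) v'
      (work (enc 0 ++ (code b ++ R)) (enc (bitLoop (fun y r => h (r, y, b)) y r) ++ F) [] [])
      (n * (W + 20 * (S + 1) + 10) + 1) := by
  intro n
  induction n with
  | zero =>
    intro y r v hy hPy
    obtain rfl := Nat.size_eq_zero.1 hy
    rw [bitLoop_zero]
    exact ⟨hPy, _, (Exec.loop_false (by simp [isBit_head_enc])).mono (by omega)⟩
  | succ n ih =>
    intro y r v hy hPy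
    have hy0 : y ≠ 0 := fun h0 => by simp [h0] at hy
    have hP' := hP y r hy0 hPy
    have hsize := size_div_two_add_one hy0
    rw [bitLoop_of_ne_zero _ hy0]
    obtain ⟨hfin, v', hv'⟩ := ih (y / 2) (h (r, y / 2, b)) reg₀.2 (by omega) hP'
    refine ⟨hfin, v', ?_⟩
    have h2 := exec_halve (x := y) (R := code b ++ R) (F := enc r ++ F)
    have h3 := exec_moveNum (a := .aux) (b := .data) (x := r) (v := reg₀) (R := F)
      (s := work (enc (y / 2) ++ (code b ++ R)) (enc r ++ F) [] []) (by decide) (by decide)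
      (by decide) rfl rfl
    have h4 := hc (r, y / 2, b) R F
    have h5 := exec_moveNum (a := .data) (b := .aux) (x := h (r, y / 2, b)) (v := reg₀)
      (R := enc r ++ (enc (y / 2) ++ (code b ++ R)))
      (s := work (enc (h (r, y / 2, b)) ++ (enc r ++ (enc (y / 2) ++ (code b ++ R)))) F [] [])
      (by decide) (by decide) (by decide) rfl rfl
    have h6 := exec_dropNum (x := r) (R := enc (y / 2) ++ (code b ++ R))
      (F := enc (h (r, y / 2, b)) ++ F) (v := reg₀) (t := []) (u := [])
    have h7 := exec_peek (R := code b ++ R) (F := enc (h (r, y / 2, b)) ++ F) (y / 2) reg₀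
    simp only [update_work_data, update_work_aux, work_data, work_aux, code_pair, code_nat,
      List.append_assoc] at h3 h4 h5
    refine (Exec.loop_true (by simp [isBit_head_enc, hy0])
      ((Exec.reset _ _).seq (h2.seq (h3.seq (h4.seq (h5.seq (h6.seq h7)))))) hv').mono ?_
    have e1 := hS _ _ hPy
    have e2 := hS _ _ hP'
    have e3 := hT _ _ hy0 hPy
    have e4 := Nat.succ_mul n (W + 20 * (S + 1) + 10)
    simp only [length_enc, Nat.succ_eq_add_one] at e4 ⊢
    omega

/-- Polynomial time for the step function alone would not suffice, since its iteration could let the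
accumulator grow exponentially. The invariant `P` supplies the size bound `S` that Cobham's
recursion scheme requires. -/
theorem PolyC.bitLoop {g r₀ : β → ℕ} {h : ℕ × ℕ × β → ℕ} (hg : PolyC g) (hr : PolyC r₀)
    (hh : PolyC h) (P : β → ℕ → ℕ → Prop) {S : β → ℕ} (hS : PolyBdd width S)
    (h0 : ∀ b, P b (g b) (r₀ b))
    (hP : ∀ b y r, y ≠ 0 → P b y r → P b (y / 2) (h (r, y / 2, b)))
    (hPS : ∀ b y r, P b y r → r.size ≤ S b) :
    PolyC fun b => bitLoop (fun y r => h (r, y, b)) (g b) (r₀ b) := by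
  obtain ⟨c₁, T₁, hT₁, hs₁, hc₁⟩ := hg
  obtain ⟨c₂, T₂, hT₂, hs₂, hc₂⟩ := hr
  obtain ⟨c, T, ⟨p, hp⟩, -, hc⟩ := hh
  have hM : PolyBdd width fun b : β => S b + 1 + (width (g b) + width b) :=
    (hS.add (.const 1)).add (hs₁.add .self)
  have hW : PolyBdd width fun b : β => p.eval (S b + 1 + (width (g b) + width b)) :=
    PolyBdd.comp (m' := fun x : ℕ => x) (S := fun x => p.eval x) ⟨p, fun _ => le_rfl⟩ _ hM
  have main : ∀ (b : β) (R F : List Γ'), (NumProg.bitLoop (fun y r => h (r, y, b)) (g b) (r₀ b)).size ≤ S b ∧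
      ∃ v', Exec (.loop (fun v => isBit v.1) (bitLoopBody c)) ((enc (g b)).head?, reg₀.2)
      (work (enc (g b) ++ (code b ++ R)) (enc (r₀ b) ++ F) [] []) v'
      (work (enc 0 ++ (code b ++ R))
        (enc (NumProg.bitLoop (fun y r => h (r, y, b)) (g b) (r₀ b)) ++ F) [] [])
      (width (g b) * (p.eval (S b + 1 + (width (g b) + width b)) + 20 * (S b + 1) + 10) + 1) := by
    intro b R F
    -- The conjunct `y ≤ g b` bounds the size of the counter, which is part of the argument of `h`.
    obtain ⟨h1, v', h2⟩ := exec_bitLoop (R := R) (F := F) hc b (fun y r => P b y r ∧ y ≤ g b) (S b)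
      (p.eval (S b + 1 + (width (g b) + width b)))
      (fun y r hy h => ⟨hP b y r hy h.1, (Nat.div_le_self _ _).trans h.2⟩)
      (fun y r h => hPS b y r h.1)
      (fun y r hy h => (hp _).trans (p.eval_le_eval_of_le (by
        have e1 := hPS b y r h.1
        have e2 := Nat.size_le_size ((Nat.div_le_self y 2).trans h.2)
        simp only [width_pair, width_nat]
        omega)))
      _ (g b) (r₀ b) reg₀.2 rfl ⟨h0 b, le_rfl⟩
    refine ⟨hPS b _ _ h1.1, v', h2.mono (Nat.add_le_add_right (Nat.mul_le_mul_right _ ?_) _)⟩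
    simp
  refine ⟨.seq c₂ (.seq (moveNum .data .aux) (.seq c₁ (.seq peek
    (.seq (.loop (fun v => isBit v.1) (bitLoopBody c))
      (.seq (drop .data) (moveNum .aux .data)))))),
    fun b => T₂ b + (7 * width (r₀ b) + (T₁ b + (2 + ((width (g b) *
      (p.eval (S b + 1 + (width (g b) + width b)) + 20 * (S b + 1) + 10) + 1) +
      (3 + 7 * (S b + 1)))))),
    hT₂.add (((PolyBdd.const 7).mul hs₂).add (hT₁.add ((PolyBdd.const 2).add
      (((hs₁.mul ((hW.add ((PolyBdd.const 20).mul (hS.add (.const 1)))).add (.const 10))).add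
        (.const 1)).add ((PolyBdd.const 3).add ((PolyBdd.const 7).mul (hS.add (.const 1)))))))),
    (hS.add (.const 1)).of_le fun b => ?_, fun b R F => ?_⟩
  · have := (main b [] []).1
    simpa using this
  · obtain ⟨hsz, v', hv'⟩ := main b R F
    have h2 := hc₂ b R F
    have h1 := hc₁ b R (enc (r₀ b) ++ F)
    have h3 := exec_moveNum (a := .data) (b := .aux) (x := r₀ b) (v := reg₀) (R := code b ++ R)
      (s := work (enc (r₀ b) ++ (code b ++ R)) F [] []) (by decide) (by decide)
      (by decide) rfl rfl
    have h4 := exec_moveNum (a := .aux) (b := .data)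
      (x := NumProg.bitLoop (fun y r => h (r, y, b)) (g b) (r₀ b)) (v := reg₀) (R := F)
      (s := work (code b ++ R)
        (enc (NumProg.bitLoop (fun y r => h (r, y, b)) (g b) (r₀ b)) ++ F) [] []) (by decide)
      (by decide) (by decide) rfl rfl
    simp only [update_work_data, update_work_aux, work_data, work_aux, code_nat] at h1 h2 h3 h4 ⊢
    refine (h2.seq (h3.seq (h1.seq ((exec_peek (g b) reg₀).seq (hv'.seq
      (exec_dropNum.seq h4)))))).mono ?_
    simp only [length_enc, width_nat, Nat.size_zero]
    omega

end NumProg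

/-! ### From functions on numbers to Turing machines on words -/

open Turing in
/-- The machine that runs a structured program. -/
noncomputable def StackCmd.machine {K : Type} [DecidableEq K] [Fintype K] {Γ : K → Type}
    {σ : Type} [Fintype σ] (c : StackCmd Γ σ) (v₀ : σ) (k₀ k₁ : K) [Fintype (Γ k₀)] : FinTM2 :=
  letI := c.labelFintype
  { k₀ := k₀
    k₁ := k₁
    Γ := Γ
    Λ := Option c.Label
    main := some c.entry
    σ := σ
    initialState := v₀
    m := fun
      | none => .halt
      | some l => c.code some none l }

namespace NumProg

open Computability Turing StateTransition

theorem encodeNat_eq_bits (n : ℕ) : encodeNat n = n.bits := by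
  have h : ∀ p : PosNum, encodePosNum p = (p : ℕ).bits := by
    intro p
    induction p with
    | one => simp [encodePosNum]
    | bit0 p ih =>
      rw [encodePosNum, ih, PosNum.cast_bit0, ← two_mul,
        Nat.bit0_bits _ (PosNum.cast_pos p).ne']
    | bit1 p ih =>
      rw [encodePosNum, ih, PosNum.cast_bit1, ← two_mul, Nat.bit1_bits]
  rw [encodeNat, ← Num.to_of_nat n]
  cases h' : (n : Num) with
  | zero => simp [encodeNum]
  | pos p => simp [encodeNum, h]

/-- The two bits that represent a symbol: for a bit, the bit itself and `false`; otherwise `true`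
and `true`. -/
def symBits : Γ' → List Bool
  | .bit b => [b, false]
  | _ => [true, true]

/-- The number that represents a word. -/
def wordNum (L : List Γ') : ℕ := ofBits (L.flatMap symBits)

/-- The final separator contributes the top digit `true`, so no digit is lost and the length of the
word can be recovered from the number. -/
theorem bits_wordNum (L : List Γ') : (wordNum (L ++ [Γ'.comma])).bits =
    (L ++ [Γ'.comma]).flatMap symBits := by
  rw [wordNum, bits_ofBits, List.flatMap_append, List.flatMap_singleton, symBits,
    List.rdropWhile_eq_self_iff]
  · simp
  · simp

theorem length_flatMap_symBits (L : List Γ') : (L.flatMap symBits).length = 2 * L.length := by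
  induction L with
  | nil => rfl
  | cons a L ih =>
    rw [List.flatMap_cons, List.length_append, ih]
    cases a <;> simp [symBits] <;> omega

theorem size_wordNum (L : List Γ') :
    (wordNum (L ++ [Γ'.comma])).size = 2 * (L ++ [Γ'.comma]).length := by
  rw [← Nat.size_eq_bits_len, bits_wordNum, length_flatMap_symBits]

/-- The first of the two bits that represent a popped symbol. -/
def valueBit : Option Γ' → Bool
  | some (.bit b) => b
  | _ => true

/-- Read the input word and turn it into a number on the data stack. -/
def readInput : Cmd :=
  .seq (popFst .input) (.seq (.loop (fun v => v.1.isSome)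
    (.seq (push .tmp fun v => .bit (valueBit v.1)) (.seq (push .tmp fun v => .bit (!isBit v.1))
      (popFst .input)))) (.seq reset (.seq (push .data fun _ => .comma) (moveBits .tmp .data))))

/-- The initial contents of the work stacks. -/
def initial (L : List Γ') : WorkStack → List Γ'
  | .input => L
  | _ => []

theorem exec_readInput_loop (L : List Γ') : ∀ (v : Reg) (s : WorkStack → List Γ'),
    v.1 = L.head? → s .input = L.tail →
    Exec (.loop (fun v => v.1.isSome) (.seq (push .tmp fun v => .bit (valueBit v.1))
      (.seq (push .tmp fun v => .bit (!isBit v.1)) (popFst .input)))) v s (none, v.2)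
      (Function.update (Function.update s .tmp ((L.flatMap symBits).reverse.map Γ'.bit ++ s .tmp))
        .input []) (4 * L.length + 1) := by
  induction L with
  | nil =>
    intro v s hv hs
    refine (Exec.loop_false (by simp [hv])).congr (Prod.ext hv rfl) ?_ (by simp)
    funext w
    cases w <;> simp [hs]
  | cons a L ih =>
    intro v s hv hs
    refine (Exec.loop_true (by simp [hv]) ((Exec.push _ _ _ _).seq ((Exec.push _ _ _ _).seq
      (Exec.popFst _ _ _))) (ih _ _ ?_ ?_)).congr rfl ?_ ?_
    · simp [hs]
    · simp [hs]
    · funext w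
      cases w <;> simp
      cases a <;> simp [hv, symBits, valueBit, isBit]
    · simp only [List.length_cons]
      omega

theorem exec_readInput (L : List Γ') :
    Exec readInput reg₀ (initial (L ++ [.comma])) reg₀
      (work (enc (wordNum (L ++ [.comma]))) [] [] []) (10 * (L ++ [Γ'.comma]).length + 7) := by
  have h := exec_moveBits (a := .tmp) (b := .data)
    (R := []) (l := ((L ++ [Γ'.comma]).flatMap symBits).reverse) (v := reg₀)
    (s := work [.comma] [] (((L ++ [Γ'.comma]).flatMap symBits).reverse.map Γ'.bit) [])
    (by decide) rfl (by simp)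
  refine ((Exec.popFst _ _ _).seq ((exec_readInput_loop (L ++ [.comma]) _ _ ?_ ?_).seq
    ((Exec.reset _ _).seq (((Exec.push _ _ _ _).congr rfl ?_ le_rfl).seq h)))).congr rfl ?_ ?_
  · simp [initial]
  · simp [initial]
  · funext w
    cases w <;> simp [initial, work]
  · simp [enc, bits_wordNum]
  · simp only [List.length_reverse, length_flatMap_symBits]
    omega

/-- Write the bits of the temporary stack to the output stack. -/
def writeOutput : Cmd :=
  .seq (popFst .tmp) (.seq (.loop (fun v => isBit v.1)
    (.seq (.push none fun v => bitVal v.1) (popFst .tmp))) reset)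

theorem exec_popFst_tmp (v : Reg) (o : List Bool) (t : List Γ') :
    StackCmd.Exec (popFst .tmp) v (allStacks o (work [] [] t [])) (t.head?, v.2)
      (allStacks o (work [] [] t.tail [])) 1 := by
  have h := StackCmd.Exec.pop (Γ := Alphabet) (some .tmp) (fun (v : Reg) a => (a, v.2)) v
    (allStacks o (work [] [] t []))
  rw [update_allStacks_some] at h
  exact (congrArg (fun t' => StackCmd.Exec (popFst .tmp) v _ _ (allStacks o t') 1)
    (update_work_tmp [] [] t [] t.tail)).mp h

theorem exec_writeOutput_loop (l : List Bool) : ∀ (v : Reg) (o : List Bool),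
    v.1 = (l.map Γ'.bit).head? →
    StackCmd.Exec (.loop (fun v => isBit v.1) (.seq (.push none fun v => bitVal v.1) (popFst .tmp)))
      v (allStacks o (work [] [] (l.map Γ'.bit).tail [])) (none, v.2)
      (allStacks (l.reverse ++ o) (work [] [] [] [])) (3 * l.length + 1) := by
  induction l with
  | nil =>
    intro v o hv
    have h : v = (none, v.2) := Prod.ext hv rfl
    rw [h]
    exact StackCmd.Exec.loop_false rfl
  | cons b l ih =>
    intro v o hv
    have h1 := StackCmd.Exec.push (Γ := Alphabet) none (fun v : Reg => bitVal v.1) v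
      (allStacks o (work [] [] ((b :: l).map Γ'.bit).tail []))
    rw [update_allStacks_none] at h1
    have h2 := ih ((l.map Γ'.bit).head?, v.2) (b :: o) rfl
    have hb : bitVal v.1 = b := by simp [hv, bitVal]
    rw [hb] at h1
    have h3 := StackCmd.Exec.loop_true (b := fun v : Reg => isBit v.1) (by simp [hv, isBit])
      (h1.seq (exec_popFst_tmp v (b :: o) _)) h2
    rw [List.reverse_cons, List.append_assoc, List.singleton_append]
    refine h3.mono ?_
    simp only [List.length_cons]
    omega

theorem exec_writeOutput (l : List Bool) : StackCmd.Exec writeOutput reg₀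
    (allStacks [] (work [] [] (l.map Γ'.bit) [])) reg₀
    (allStacks l.reverse (work [] [] [] [])) (3 * l.length + 3) := by
  have h := exec_writeOutput_loop l ((l.map Γ'.bit).head?, reg₀.2) [] rfl
  rw [List.append_nil] at h
  exact ((exec_popFst_tmp reg₀ [] (l.map Γ'.bit)).seq
    (h.seq (StackCmd.Exec.load _ _ _))).mono (by omega)

/-- Reading the word as a number doubles the length only, so bounds polynomial in the size of the
number are polynomial in the length of the word. -/
theorem countingInFP_of_polyC {α : Type} {code : α → List Γ'} {f : α → ℕ} {g : ℕ → ℕ}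
    (hg : PolyC g) (hcode : ∀ a, ∃ L, code a = L ++ [.comma])
    (h : ∀ a, g (wordNum (code a)) = f a) : CountingInFP code f := by
  obtain ⟨c, T, ⟨p, hp⟩, ⟨q, hq⟩, hc⟩ := hg
  set c' : Cmd := .seq readInput (.seq c (.seq (moveBits .data .tmp) (.seq (drop .data)
    writeOutput))) with hc'
  have main : ∀ L : List Γ', c'.Exec reg₀ (allStacks [] (initial (L ++ [.comma]))) reg₀
      (allStacks (g (wordNum (L ++ [.comma]))).bits (work [] [] [] []))
      (10 * (L ++ [Γ'.comma]).length + 7 + (p.eval (2 * (L ++ [Γ'.comma]).length + 1) +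
        (6 * q.eval (2 * (L ++ [Γ'.comma]).length + 1) +
          3 * (2 * (L ++ [Γ'.comma]).length + 1) + 6))) := by
    intro L
    set X := wordNum (L ++ [.comma]) with hX
    have hsize : X.size = 2 * (L ++ [Γ'.comma]).length := size_wordNum L
    have h2 := hc X [] []
    have h3 := exec_moveBits (a := .data) (b := .tmp) (R := .comma :: enc X) (l := (g X).bits)
      (v := reg₀) (s := work (enc (g X) ++ enc X) [] [] []) (by decide) rfl
      (by simp [enc])
    have h4 := exec_dropNum (x := X) (R := []) (F := []) (v := reg₀)
      (t := (g X).bits.reverse.map Γ'.bit) (u := [])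
    have h5 := exec_writeOutput (g X).bits.reverse
    simp only [code_nat, List.append_nil, work_tmp, update_work_tmp, update_work_data,
      List.tail_cons, List.reverse_reverse, List.length_reverse] at h2 h3 h4 h5
    have hpX := hp X
    have hqX := hq X
    simp only [width_nat, hsize] at hpX hqX
    refine (StackCmd.Exec.seq (exec_readInput L) (StackCmd.Exec.seq h2 (StackCmd.Exec.seq h3
      (StackCmd.Exec.seq h4 h5)))).mono ?_
    rw [Nat.size_eq_bits_len, length_enc, hsize]
    omega
  refine ⟨{
    tm := c'.machine reg₀ (some .input) none
    inputAlphabet := Equiv.refl Γ'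
    outputAlphabet := Equiv.refl Bool
    time := 10 * Polynomial.X + 7 + (p.comp (2 * Polynomial.X + 1) +
        (6 * q.comp (2 * Polynomial.X + 1) + 3 * (2 * Polynomial.X + 1) + 6)) + 1
    outputsFun := fun a => Classical.choice ?_ }⟩
  obtain ⟨L, hL⟩ := hcode a
  rw [hL]
  obtain ⟨e⟩ := main L _ (c'.machine reg₀ (some .input) none).m some none (fun _ => rfl)
  -- The exit label `none` carries the halting statement, whose execution is the last summand `1` in
  -- the time bound.
  have e' : EvalsToInTime (TM2.step (c'.machine reg₀ (some .input) none).m)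
      ⟨some none, reg₀, allStacks (g (wordNum (L ++ [.comma]))).bits (work [] [] [] [])⟩
      (some ⟨none, reg₀, allStacks (g (wordNum (L ++ [.comma]))).bits (work [] [] [] [])⟩) 1 :=
    StackCmd.evalsToInTimeOne rfl
  have e'' := EvalsToInTime.trans _ _ _ _ _ _ e e'
  have hinit : initList (c'.machine reg₀ (some .input) none) (L ++ [.comma]) =
      ⟨some (some c'.entry), reg₀, allStacks [] (initial (L ++ [.comma]))⟩ := by
    refine congrArg (TM2.Cfg.mk _ _) (funext fun k => ?_)
    rcases k with _ | w
    · rfl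
    · cases w <;> rfl
  have hhalt : haltList (c'.machine reg₀ (some .input) none) (g (wordNum (L ++ [.comma]))).bits =
      ⟨none, reg₀, allStacks (g (wordNum (L ++ [.comma]))).bits (work [] [] [] [])⟩ := by
    refine congrArg (TM2.Cfg.mk _ _) (funext fun k => ?_)
    rcases k with _ | w
    · rfl
    · cases w <;> rfl
  have hout : (encodeNat (f a)).map (Equiv.refl Bool).invFun = (g (wordNum (L ++ [.comma]))).bits :=
    (List.map_id _).trans (by rw [← hL, h a, encodeNat_eq_bits])
  refine ⟨⟨⟨e''.steps, ?_⟩, e''.steps_le_m.trans ?_⟩⟩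
  · exact (congrArg _ (congrArg some
      ((congrArg (initList (c'.machine reg₀ (some .input) none)) (List.map_id _)).trans hinit))).trans
      (e''.evals_in_steps.trans (congrArg some ((congrArg (haltList _) hout).trans hhalt).symm))
  · simp [Polynomial.eval_comp]
    omega

end NumProg

/-! ### Polynomial-time arithmetic, predicates, sums and products -/

namespace NumProg

open NatTuple

variable {β γ : Type} [NatTuple β] [NatTuple γ]

/-- Apply `h (n - 1)`, …, `h 1`, `h 0` in this order. -/
def foldDown (h : ℕ → ℕ → ℕ) : ℕ → ℕ → ℕ
  | 0, r => r
  | n + 1, r => foldDown h n (h n r)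

/-- When the step sees the counter only through its size, `y` serves as a clock with `y.size` ticks.
This turns recursion on notation into a loop over indices. -/
theorem bitLoop_size (h : ℕ → ℕ → ℕ) : ∀ (n y r : ℕ), y.size = n →
    bitLoop (fun y r => h y.size r) y r = foldDown h n r := by
  intro n
  induction n with
  | zero =>
    intro y r hy
    obtain rfl := Nat.size_eq_zero.1 hy
    rw [bitLoop_zero, foldDown]
  | succ n ih =>
    intro y r hy
    have hy0 : y ≠ 0 := fun h0 => by simp [h0] at hy
    have hs := size_div_two_add_one hy0
    have hs' : (y / 2).size = n := by omega
    rw [bitLoop_of_ne_zero _ hy0, foldDown, ih _ _ hs', hs']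

theorem foldDown_add (F : ℕ → ℕ) (n : ℕ) : ∀ r,
    foldDown (fun i r => r + F i) n r = r + ∑ i ∈ Finset.range n, F i := by
  induction n with
  | zero => intro r; simp [foldDown]
  | succ n ih => intro r; rw [foldDown, ih, Finset.sum_range_succ]; ring

theorem foldDown_mul (F : ℕ → ℕ) (n : ℕ) : ∀ r,
    foldDown (fun i r => r * F i) n r = r * ∏ i ∈ Finset.range n, F i := by
  induction n with
  | zero => intro r; simp [foldDown]
  | succ n ih => intro r; rw [foldDown, ih, Finset.prod_range_succ]; ring

theorem foldDown_half (e : ℕ) (n : ℕ) : ∀ r,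
    foldDown (fun i r => if i < e then r / 2 else r) n r = r / 2 ^ min e n := by
  induction n with
  | zero => intro r; simp [foldDown]
  | succ n ih =>
    intro r
    rw [foldDown, ih]
    split_ifs with h
    · rw [Nat.div_div_eq_div_mul, min_eq_right (by omega : n ≤ e),
        min_eq_right (by omega : n + 1 ≤ e), pow_succ']
    · rw [min_eq_left (by omega : e ≤ n), min_eq_left (by omega : e ≤ n + 1)]

/-- Horner's scheme: before the round with index `i` the accumulator is `x * (y / 2 ^ (i + 1))`;
doubling it and adding the digit `i` times `x` gives `x * (y / 2 ^ i)`. -/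
theorem foldDown_horner (x y : ℕ) (n : ℕ) :
    foldDown (fun i r => r + r + if (y / 2 ^ i) % 2 = 0 then 0 else x) n (x * (y / 2 ^ n)) =
      x * y := by
  induction n with
  | zero => simp [foldDown]
  | succ n ih =>
    rw [foldDown]
    convert ih using 2
    have h1 : y / 2 ^ (n + 1) = y / 2 ^ n / 2 := by rw [Nat.div_div_eq_div_mul, pow_succ]
    rw [h1]
    generalize y / 2 ^ n = q
    have h2 := Nat.div_add_mod q 2
    split_ifs with h
    · conv_rhs => rw [← h2, h]
      ring
    · conv_rhs => rw [← h2, (by omega : q % 2 = 1)]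
      ring

/-- Predicates on tuples of natural numbers that are decidable in polynomial time. -/
structure PolyP (p : β → Prop) : Prop where
  exists_test : ∃ t : β → ℕ, PolyC t ∧ ∀ b, p b ↔ t b ≠ 0

namespace PolyC

variable {f g : β → ℕ}

theorem one : PolyC fun _ : β => 1 := (doubleSucc.comp zero).congr fun _ => rfl

theorem add (hf : PolyC f) (hg : PolyC g) : PolyC fun b => f b + g b := add_pair.comp (hf.pair hg)

theorem sub (hf : PolyC f) (hg : PolyC g) : PolyC fun b => f b - g b := sub_pair.comp (hf.pair hg)

theorem half (hf : PolyC f) : PolyC fun b => f b / 2 := halve.comp hf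

theorem const (n : ℕ) : PolyC fun _ : β => n := by
  induction n with
  | zero => exact zero
  | succ n ih => exact ih.add one

theorem ite {p : β → Prop} [∀ b, Decidable (p b)] {f g : β → γ} (hp : PolyP p) (hf : PolyC f)
    (hg : PolyC g) : PolyC fun b => if p b then f b else g b := by
  obtain ⟨t, ht, h⟩ := hp
  exact (ite_ne_zero ht hf hg).congr fun b => if_congr (h b).symm rfl rfl

theorem foldDown {G r₀ : β → ℕ} {h : ℕ × ℕ × β → ℕ} (hG : PolyC G) (hr : PolyC r₀)
    (hh : PolyC fun p : ℕ × ℕ × β => h (p.1, p.2.1, p.2.2)) (hs : PolyC Nat.size)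
    (P : β → ℕ → ℕ → Prop) {S : β → ℕ} (hS : PolyBdd width S)
    (h0 : ∀ b, P b (G b).size (r₀ b))
    (hP : ∀ b n r, n < (G b).size → P b (n + 1) r → P b n (h (r, n, b)))
    (hPS : ∀ b n r, P b n r → r.size ≤ S b) :
    PolyC fun b => foldDown (fun i r => h (r, i, b)) (G b).size (r₀ b) := by
  have hh' : PolyC fun p : ℕ × ℕ × β => h (p.1, p.2.1.size, p.2.2) :=
    hh.comp (fst.pair ((hs.comp (fst.comp snd)).pair (snd.comp snd)))
  refine (PolyC.bitLoop hG hr hh' (fun b y r => P b y.size r ∧ y ≤ G b) hS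
    (fun b => ⟨h0 b, le_rfl⟩) (fun b y r hy h => ?_) fun b y r h => hPS b _ r h.1).congr fun b =>
      bitLoop_size (fun i r => h (r, i, b)) _ _ _ rfl
  have hs := size_div_two_add_one hy
  have hle := Nat.size_le_size h.2
  exact ⟨hP b _ r (by omega) (by rw [hs]; exact h.1), (Nat.div_le_self _ _).trans h.2⟩

theorem size_self_le (n : ℕ) : n.size ≤ n := Nat.size_le.2 Nat.lt_two_pow_self

theorem size : PolyC Nat.size := by
  have h : PolyC fun p : ℕ × ℕ × ℕ => p.1 + 1 := fst.add one
  refine (PolyC.bitLoop id zero h (fun b y r => r + y.size = b.size) PolyBdd.self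
    (fun b => by simp) (fun b y r hy h => ?_) fun b y r h => ?_).congr fun b =>
      (bitLoop_size (fun _ r => r + 1) _ _ _ rfl).trans ?_
  · have hs := size_div_two_add_one hy
    simp only
    omega
  · have := size_self_le r
    rw [width_nat]
    omega
  · rw [foldDown_add (fun _ => 1)]
    simp

theorem polyBdd_size (hf : PolyC f) : PolyBdd width fun b => (f b).size := by
  obtain ⟨c, T, hT, hs, hc⟩ := hf
  exact hs.of_le fun b => by simp

/-- Folding with an operation that does not increase sizes too much. -/
theorem fold {G r₀ : β → ℕ} {f : ℕ × β → ℕ} (op : ℕ → ℕ → ℕ)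
    (hop : PolyC fun p : ℕ × ℕ => op p.1 p.2)
    (hsz : ∀ x y, (op x y).size ≤ x.size + y.size) (hG : PolyC G) (hr : PolyC r₀)
    (hf : PolyC f) :
    PolyC fun b => NumProg.foldDown (fun i r => op r (f (i, b))) (G b).size (r₀ b) := by
  have hh : PolyC fun p : ℕ × ℕ × β => op p.1 (f (p.2.1, p.2.2)) :=
    hop.comp (fst.pair (hf.comp snd))
  obtain ⟨q, hq⟩ := polyBdd_size hf
  have hB : PolyBdd width fun b : β => q.eval (width (G b) + width b) := by
    obtain ⟨_, _, _, hs, _⟩ := hG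
    exact PolyBdd.comp (m' := fun x : ℕ => x) (S := fun x => q.eval x) ⟨q, fun _ => le_rfl⟩ _
      (hs.add .self)
  -- With `n` rounds left, `(G b).size - n` rounds are done, and each has added at most the size of
  -- one term. The index of a term is at most `G b`, so one polynomial bounds all terms.
  refine foldDown (h := fun p : ℕ × ℕ × β => op p.1 (f (p.2.1, p.2.2))) hG hr hh size
    (fun b n r => n ≤ (G b).size ∧ r.size ≤ (r₀ b).size +
    ((G b).size - n) * q.eval (width (G b) + width b))
    (S := fun b => (r₀ b).size + (G b).size * q.eval (width (G b) + width b))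
    ((polyBdd_size hr).add ((polyBdd_size hG).mul hB)) (fun b => by simp) (fun b n r hn h => ?_)
    fun b n r h => h.2.trans (Nat.add_le_add_left (Nat.mul_le_mul_right _ (Nat.sub_le _ _)) _)
  refine ⟨hn.le, (hsz _ _).trans ?_⟩
  have h1 : (f (n, b)).size ≤ q.eval (width (G b) + width b) :=
    (hq (n, b)).trans (q.eval_le_eval_of_le (by
      have := Nat.size_le_size (hn.le.trans (size_self_le _))
      simp only [width_pair, width_nat]
      omega))
  have h2 : (G b).size - n = (G b).size - (n + 1) + 1 := by omega
  rw [h2, Nat.succ_mul]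
  have := h.2
  dsimp only
  omega

theorem sum_size {G : β → ℕ} {f : ℕ × β → ℕ} (hG : PolyC G) (hf : PolyC f) :
    PolyC fun b => ∑ i ∈ Finset.range (G b).size, f (i, b) :=
  (fold (· + ·) add_pair size_add_le hG zero hf).congr fun b => by
    rw [foldDown_add fun i => f (i, b), zero_add]

end PolyC

namespace PolyP

variable {p q : β → Prop} {f g : β → ℕ}

theorem congr (h : PolyP p) (e : ∀ b, p b ↔ q b) : PolyP q := by
  obtain ⟨t, ht, h⟩ := h
  exact ⟨t, ht, fun b => (e b).symm.trans (h b)⟩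

theorem lt (hf : PolyC f) (hg : PolyC g) : PolyP fun b => f b < g b :=
  ⟨_, hg.sub hf, fun b => by omega⟩

theorem le (hf : PolyC f) (hg : PolyC g) : PolyP fun b => f b ≤ g b :=
  ⟨_, (hg.add .one).sub hf, fun b => by omega⟩

theorem and (hp : PolyP p) (hq : PolyP q) : PolyP fun b => p b ∧ q b := by
  obtain ⟨t, ht, h⟩ := hp
  obtain ⟨t', ht', h'⟩ := hq
  refine ⟨_, PolyC.ite_ne_zero ht ht' .zero, fun b => ?_⟩
  rw [h, h']
  by_cases h0 : t b = 0 <;> simp [h0]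

theorem not (hp : PolyP p) : PolyP fun b => ¬ p b := by
  obtain ⟨t, ht, h⟩ := hp
  refine ⟨_, PolyC.one.sub ht, fun b => ?_⟩
  rw [h]
  omega

theorem eq (hf : PolyC f) (hg : PolyC g) : PolyP fun b => f b = g b :=
  ((le hf hg).and (le hg hf)).congr fun _ => le_antisymm_iff.symm

end PolyP

namespace PolyC

variable {f g : β → ℕ}

/-- The loop runs over the size of `G b`, which is why `n b` must not exceed it; the terms from `n
b` on are replaced by zero. -/
theorem sum_range {n G : β → ℕ} {f : ℕ × β → ℕ} (hf : PolyC f) (hn : PolyC n) (hG : PolyC G)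
    (hle : ∀ b, n b ≤ (G b).size) : PolyC fun b => ∑ i ∈ Finset.range (n b), f (i, b) :=
  (sum_size hG (ite (PolyP.lt fst (hn.comp snd)) hf zero)).congr fun b => by
    rw [← Finset.sum_filter]
    refine Finset.sum_congr (Finset.ext fun i => ?_) fun _ _ => rfl
    have := hle b
    simp only [Finset.mem_filter, Finset.mem_range]
    omega

/-- Shifting to the right. -/
theorem div_two_pow (hf : PolyC f) (hg : PolyC g) : PolyC fun b => f b / 2 ^ g b := by
  have hh : PolyC fun p : ℕ × ℕ × β => if p.2.1 < g p.2.2 then p.1 / 2 else p.1 :=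
    ite (PolyP.lt (fst.comp snd) (hg.comp (snd.comp snd))) fst.half fst
  refine (foldDown (h := fun p : ℕ × ℕ × β => if p.2.1 < g p.2.2 then p.1 / 2 else p.1) hf hf hh
    size (fun b n r => r ≤ f b) (polyBdd_size hf) (fun _ => le_rfl)
    (fun b n r _ h => ?_) fun b n r h => Nat.size_le_size h).congr fun b =>
      (foldDown_half (g b) _ _).trans ?_
  · dsimp only
    split_ifs <;> omega
  · rcases le_total (g b) (f b).size with h | h
    · rw [min_eq_left h]
    · rw [min_eq_right h, Nat.div_eq_of_lt (Nat.lt_size_self _), Nat.div_eq_of_lt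
        ((Nat.lt_size_self _).trans_le (Nat.pow_le_pow_right two_pos h))]

theorem mod_two (hf : PolyC f) : PolyC fun b => f b % 2 :=
  (hf.sub (hf.half.add hf.half)).congr fun b => by omega

/-- Multiplication by Horner's scheme; the invariant gives the accumulator exactly, and so bounds
its size by that of the product. -/
theorem mul (hf : PolyC f) (hg : PolyC g) : PolyC fun b => f b * g b := by
  have hh : PolyC fun p : ℕ × ℕ × β =>
      p.1 + p.1 + if (g p.2.2 / 2 ^ p.2.1) % 2 = 0 then 0 else f p.2.2 :=
    (fst.add fst).add (ite (PolyP.eq (mod_two (div_two_pow (hg.comp (snd.comp snd))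
      (fst.comp snd))) zero) zero (hf.comp (snd.comp snd)))
  refine (foldDown (h := fun p : ℕ × ℕ × β =>
      p.1 + p.1 + if (g p.2.2 / 2 ^ p.2.1) % 2 = 0 then 0 else f p.2.2) hg zero hh
    size (fun b n r => r = f b * (g b / 2 ^ n)) ((polyBdd_size hf).add (polyBdd_size hg))
    (fun b => by rw [Nat.div_eq_of_lt (Nat.lt_size_self _), mul_zero])
    (fun b n r _ h => ?_) fun b n r h => ?_).congr fun b => ?_
  · have h1 : g b / 2 ^ (n + 1) = g b / 2 ^ n / 2 := by rw [Nat.div_div_eq_div_mul, pow_succ]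
    rw [h, h1]
    dsimp only
    generalize g b / 2 ^ n = q
    have h2 := Nat.div_add_mod q 2
    split_ifs with h
    · conv_rhs => rw [← h2, h]
      ring
    · conv_rhs => rw [← h2, (by omega : q % 2 = 1)]
      ring
  · rw [h]
    exact (size_mul_le _ _).trans (Nat.add_le_add_left (Nat.size_le_size (Nat.div_le_self _ _)) _)
  · have := foldDown_horner (f b) (g b) (g b).size
    rwa [Nat.div_eq_of_lt (Nat.lt_size_self _), mul_zero] at this

theorem prod_range {n G : β → ℕ} {f : ℕ × β → ℕ} (hf : PolyC f) (hn : PolyC n) (hG : PolyC G)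
    (hle : ∀ b, n b ≤ (G b).size) : PolyC fun b => ∏ i ∈ Finset.range (n b), f (i, b) :=
  (fold (· * ·) (fst.mul snd) size_mul_le hG one
    (ite (PolyP.lt fst (hn.comp snd)) hf one)).congr fun b => by
    rw [foldDown_mul fun i => if i < n b then f (i, b) else 1, one_mul, ← Finset.prod_filter]
    refine Finset.prod_congr (Finset.ext fun i => ?_) fun _ _ => rfl
    have := hle b
    simp only [Finset.mem_filter, Finset.mem_range]
    omega

theorem pow {G : β → ℕ} (hf : PolyC f) (hg : PolyC g) (hG : PolyC G)
    (hle : ∀ b, g b ≤ (G b).size) : PolyC fun b => f b ^ g b :=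
  (prod_range (hf.comp snd) hg hG hle).congr fun b => by simp

end PolyC

theorem PolyP.testBit {f g : β → ℕ} (hf : PolyC f) (hg : PolyC g) :
    PolyP fun b => (f b).testBit (g b) = true :=
  ⟨_, (hf.div_two_pow hg).mod_two, fun b => by
    rw [Nat.testBit_eq_decide_div_mod_eq, decide_eq_true_iff]
    omega⟩

end NumProg

/-! ### Winning committees and thresholds -/

section ScoreWinners

open Finset

variable {C : Type*} {sc a : C → ℕ} {k t : ℕ}

theorem sum_score_le (S : Finset C) (hS : #S = k) (t : ℕ) :
    ∑ c ∈ S, sc c ≤ k * t + ∑ c ∈ S, (sc c - t) := by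
  rw [← hS, ← smul_eq_mul, ← sum_const, ← sum_add_distrib]
  exact sum_le_sum fun c _ => by omega

variable [Fintype C]

/-- No member falls short of `t`, and nobody outside `S` has a positive excess over `t`, so nothing
is lost in the estimate `sum_score_le`. -/
theorem sum_score_eq {S : Finset C} (hS : #S = k) (h1 : ∀ c, t < sc c → c ∈ S)
    (h2 : ∀ c ∈ S, t ≤ sc c) : ∑ c ∈ S, sc c = k * t + ∑ c, (sc c - t) := by
  have h3 : ∑ c, (sc c - t) = ∑ c ∈ S, (sc c - t) :=
    (sum_subset (subset_univ S) fun c _ hc => by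
      have := mt (h1 c) hc
      omega).symm
  rw [h3, ← hS, ← smul_eq_mul, ← sum_const, ← sum_add_distrib]
  exact sum_congr rfl fun c hc => by
    have := h2 c hc
    omega

theorem exists_committee (h1 : #{c | t < sc c} ≤ k) (h2 : k ≤ #{c | t ≤ sc c}) :
    ∃ S : Finset C, #S = k ∧ (∀ c, t < sc c → c ∈ S) ∧ ∀ c ∈ S, t ≤ sc c := by
  obtain ⟨S, hS1, hS2, hS3⟩ := exists_subsuperset_card_eq
    (s := ({c | t < sc c} : Finset C)) (t := ({c | t ≤ sc c} : Finset C))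
    (fun c hc => by simpa using (mem_filter.1 hc).2.le) h1 h2
  exact ⟨S, hS3, fun c hc => hS1 (by simpa using hc), fun c hc => by simpa using hS2 hc⟩

theorem exists_threshold (sc : C → ℕ) (hk : 1 ≤ k) (hk' : k ≤ Fintype.card C) :
    ∃ t, #{c | t < sc c} < k ∧ k ≤ #{c | t ≤ sc c} := by
  have hex : ∃ t, #{c | t < sc c} < k := by
    refine ⟨∑ c, sc c, ?_⟩
    rw [filter_false_of_mem fun c _ => not_lt.2 (single_le_sum (fun _ _ => Nat.zero_le _)
      (mem_univ c))]
    simp only [card_empty]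
    omega
  refine ⟨Nat.find hex, Nat.find_spec hex, ?_⟩
  -- At threshold `0` every candidate counts. For `s + 1`, minimality says that `s` fails, so at
  -- least `k` candidates score above `s`.
  rcases h : Nat.find hex with _ | s
  · simpa using hk'
  · have := Nat.find_min hex (m := s) (by omega)
    simpa [Nat.succ_le_iff] using this

variable [DecidableEq C]

/-- The committees of size `k` with the highest total score. -/
def scoreWinners (sc : C → ℕ) (k : ℕ) : Finset (Finset C) :=
  (Finset.powersetCard k Finset.univ).filter fun S =>
    ∀ T ∈ Finset.powersetCard k (Finset.univ : Finset C), ∑ c ∈ T, sc c ≤ ∑ c ∈ S, sc c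

/-- The bound `k * t` plus the total excess over `t` is attained by some committee, so winners are
exactly the committees attaining it. A missing candidate above `t` or a member below `t` makes the
inequality strict. -/
theorem mem_scoreWinners (h1 : #{c | t < sc c} ≤ k) (h2 : k ≤ #{c | t ≤ sc c}) {S : Finset C} :
    S ∈ scoreWinners sc k ↔ #S = k ∧ (∀ c, t < sc c → c ∈ S) ∧ ∀ c ∈ S, t ≤ sc c := by
  rw [scoreWinners, mem_filter, mem_powersetCard_univ]
  constructor
  · rintro ⟨hS, hmax⟩
    obtain ⟨S₀, h3, h4, h5⟩ := exists_committee h1 h2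
    have h6 := hmax S₀ (by simpa using h3)
    rw [sum_score_eq h3 h4 h5] at h6
    have h7 : ∑ c ∈ S, sc c ≤ ∑ c ∈ S, (t + (sc c - t)) := sum_le_sum fun c _ => by omega
    have h8 : ∑ c ∈ S, (sc c - t) ≤ ∑ c, (sc c - t) := sum_le_sum_of_subset (subset_univ S)
    have h9 : ∑ c ∈ S, (t + (sc c - t)) = k * t + ∑ c ∈ S, (sc c - t) := by
      rw [sum_add_distrib, sum_const, hS, smul_eq_mul]
    refine ⟨hS, fun c hc => ?_, fun c hc => ?_⟩
    · by_contra hcS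
      have : ∑ c ∈ S, (sc c - t) < ∑ c, (sc c - t) :=
        sum_lt_sum_of_subset (subset_univ S) (mem_univ c) hcS (by omega) (by simp)
      omega
    · by_contra hlt
      have : ∑ c ∈ S, sc c < ∑ c ∈ S, (t + (sc c - t)) :=
        sum_lt_sum (fun c _ => by omega) ⟨c, hc, by omega⟩
      omega
  · rintro ⟨hS, h3, h4⟩
    refine ⟨hS, fun T hT => ?_⟩
    rw [mem_powersetCard_univ] at hT
    rw [sum_score_eq hS h3 h4]
    exact (sum_score_le T hT t).trans
      (Nat.add_le_add_left (sum_le_sum_of_subset (subset_univ T)) _)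

/-- Every candidate with at least the threshold score is in some winning committee. -/
theorem exists_mem_scoreWinners (h1 : #{c | t < sc c} < k) (h2 : k ≤ #{c | t ≤ sc c}) {x : C}
    (hx : t ≤ sc x) : ∃ S ∈ scoreWinners sc k, x ∈ S := by
  obtain ⟨S, hS1, hS2, hS3⟩ := exists_subsuperset_card_eq
    (s := insert x ({c | t < sc c} : Finset C)) (t := ({c | t ≤ sc c} : Finset C)) (n := k)
    (insert_subset (by simpa using hx) (fun c hc => by simpa using (mem_filter.1 hc).2.le))
    ((card_insert_le _ _).trans h1) h2
  exact ⟨S, (mem_scoreWinners h1.le h2).2 ⟨hS3, fun c hc => hS1 (by simp [hc]),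
    fun c hc => by simpa using hS2 hc⟩, hS1 (mem_insert_self _ _)⟩

/-- Every candidate with at most the threshold score is missing from some winning committee, if
there are ties. -/
theorem exists_notMem_scoreWinners (h1 : #{c | t < sc c} < k) (h2 : k < #{c | t ≤ sc c}) {x : C}
    (hx : sc x ≤ t) : ∃ S ∈ scoreWinners sc k, x ∉ S := by
  obtain ⟨S, hS1, hS2, hS3⟩ := exists_subsuperset_card_eq
    (s := ({c | t < sc c} : Finset C)) (t := ({c | t ≤ sc c} : Finset C).erase x) (n := k)
    (fun c hc => by
      simp only [mem_filter, mem_univ, true_and, mem_erase] at hc ⊢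
      exact ⟨fun h => by subst h; omega, hc.le⟩)
    h1.le (by have := pred_card_le_card_erase (s := ({c | t ≤ sc c} : Finset C)) (a := x); omega)
  refine ⟨S, (mem_scoreWinners h1.le h2.le).2 ⟨hS3, fun c hc => hS1 (by simp [hc]),
    fun c hc => ?_⟩, fun h => by simpa using hS2 h⟩
  simpa using (mem_erase.1 (hS2 hc)).2

theorem scoreWinners_of_card_eq (h : #{c | t ≤ sc c} = k) :
    scoreWinners sc k = {({c | t ≤ sc c} : Finset C)} := by
  have h1 : #{c | t < sc c} ≤ k := h ▸ card_le_card (fun c hc => by simpa using (mem_filter.1 hc).2.le)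
  ext S
  rw [mem_scoreWinners h1 h.ge, mem_singleton]
  constructor
  · rintro ⟨h2, -, h3⟩
    exact eq_of_subset_of_card_le (fun c hc => by simpa using h3 c hc) (by omega)
  · rintro rfl
    exact ⟨h, fun c hc => by simpa using hc.le, fun c hc => by simpa using hc⟩

/-- Without ties there is a single winner. If it is still the only winner, every candidate reaching
the new threshold `t'` belongs to it, and comparing cardinalities gives equality of the two sets. -/
theorem scoreWinners_eq_iff_of_card_eq (hk : 1 ≤ k) (hk' : k ≤ Fintype.card C)
    (h : #{c | t ≤ a c} = k) :
    scoreWinners sc k = scoreWinners a k ↔ ∃ t', ∀ c, t ≤ a c ↔ t' ≤ sc c := by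
  rw [scoreWinners_of_card_eq h]
  constructor
  · intro hw
    obtain ⟨t', h1, h2⟩ := exists_threshold sc hk hk'
    have hsub : univ.filter (fun c => t' ≤ sc c) ⊆ univ.filter fun c => t ≤ a c := fun x hx => by
      obtain ⟨S, hS, hxS⟩ := exists_mem_scoreWinners h1 h2 (x := x) (by simpa using hx)
      rw [hw, mem_singleton] at hS
      rwa [hS] at hxS
    have heq := eq_of_subset_of_card_le hsub (by omega)
    exact ⟨t', fun c => by simpa using (Finset.ext_iff.1 heq c).symm⟩
  · rintro ⟨t', ht'⟩
    have heq : univ.filter (fun c => t ≤ a c) = univ.filter fun c => t' ≤ sc c := filter_congr fun c _ => ht' c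
    rw [heq]
    exact scoreWinners_of_card_eq (by rw [← heq, h])

/-- With ties, the family of winners determines both levels: its union consists of the candidates
that reach the threshold, and its intersection of those strictly above. -/
theorem scoreWinners_eq_iff_of_lt_card (hk : 1 ≤ k) (h1 : #{c | t < a c} < k)
    (h2 : k < #{c | t ≤ a c}) :
    scoreWinners sc k = scoreWinners a k ↔
      ∃ t', ∀ c, (t < a c ↔ t' < sc c) ∧ (t ≤ a c ↔ t' ≤ sc c) := by
  constructor
  · intro hw
    obtain ⟨t', h3, h4⟩ := exists_threshold sc hk (h2.le.trans (card_le_univ _))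
    have hU : univ.filter (fun c => t ≤ a c) = univ.filter fun c => t' ≤ sc c := by
      ext x
      simp only [mem_filter, mem_univ, true_and]
      constructor
      · intro hx
        obtain ⟨S, hS, hxS⟩ := exists_mem_scoreWinners h1 h2.le hx
        rw [← hw, mem_scoreWinners h3.le h4] at hS
        exact hS.2.2 x hxS
      · intro hx
        obtain ⟨S, hS, hxS⟩ := exists_mem_scoreWinners h3 h4 hx
        rw [hw, mem_scoreWinners h1.le h2.le] at hS
        exact hS.2.2 x hxS
    refine ⟨t', fun c => ⟨?_, by simpa using Finset.ext_iff.1 hU c⟩⟩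
    rw [hU] at h2
    rw [← not_iff_not, not_lt, not_lt]
    constructor
    · intro hx
      obtain ⟨S, hS, hxS⟩ := exists_notMem_scoreWinners h1 (hU ▸ h2) hx
      rw [← hw, mem_scoreWinners h3.le h4] at hS
      exact not_lt.1 (mt (hS.2.1 c) hxS)
    · intro hx
      obtain ⟨S, hS, hxS⟩ := exists_notMem_scoreWinners h3 h2 hx
      rw [hw, mem_scoreWinners h1.le (by rw [hU]; exact h2.le)] at hS
      exact not_lt.1 (mt (hS.2.1 c) hxS)
  · rintro ⟨t', ht'⟩
    have e1 : univ.filter (fun c => t < a c) = univ.filter fun c => t' < sc c := filter_congr fun c _ => (ht' c).1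
    have e2 : univ.filter (fun c => t ≤ a c) = univ.filter fun c => t' ≤ sc c := filter_congr fun c _ => (ht' c).2
    ext S
    rw [mem_scoreWinners (t := t') (by rw [← e1]; exact h1.le) (by rw [← e2]; exact h2.le),
      mem_scoreWinners h1.le h2.le]
    simp only [fun c => (ht' c).1, fun c => (ht' c).2]

end ScoreWinners

/-! ### Reading coefficients from one value -/

section Coefficients

open Finset

/-- Extraction of a coefficient of a generating function evaluated at a large number. -/
theorem sum_pow_div_pow_mod {ι : Type*} (s : Finset ι) (w : ι → ℕ) {z : ℕ} (hz : #s < z) (e : ℕ) :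
    (∑ i ∈ s, z ^ w i) / z ^ e % z = #{i ∈ s | w i = e} := by
  have hz0 : 0 < z := by omega
  -- The terms of exponent below `e` are fewer than `z` in number and at most `z ^ (e - 1)` each, so
  -- they produce no carry into position `e`.
  have h1 : ∑ i ∈ s with w i < e, z ^ w i < z ^ e := by
    rcases e with _ | e
    · simp
    · calc ∑ i ∈ s with w i < e + 1, z ^ w i ≤ ∑ i ∈ s with w i < e + 1, z ^ e :=
            sum_le_sum fun i hi => Nat.pow_le_pow_right hz0 (by
              have := (mem_filter.1 hi).2
              omega)
        _ = #{i ∈ s | w i < e + 1} * z ^ e := by rw [sum_const, smul_eq_mul]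
        _ ≤ #s * z ^ e := Nat.mul_le_mul_right _ (card_filter_le _ _)
        _ < z * z ^ e := Nat.mul_lt_mul_of_pos_right hz (pow_pos hz0 e)
        _ = z ^ (e + 1) := (pow_succ' z e).symm
  have h2 : ∑ i ∈ s with ¬ w i < e, z ^ w i =
      z ^ e * ∑ i ∈ s with ¬ w i < e, z ^ (w i - e) := by
    rw [mul_sum]
    refine sum_congr rfl fun i hi => ?_
    rw [← pow_add]
    congr 1
    have := (mem_filter.1 hi).2
    omega
  have h3 : ∑ i ∈ s with ¬ w i < e, z ^ (w i - e) = #{i ∈ s | w i = e} +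
      z * ∑ i ∈ s with e < w i, z ^ (w i - e - 1) := by
    rw [← sum_filter_add_sum_filter_not _ (fun i => w i = e), filter_filter, filter_filter]
    have e1 : s.filter (fun i => ¬ w i < e ∧ w i = e) = s.filter (fun i => w i = e) :=
      filter_congr fun i _ => by omega
    have e2 : s.filter (fun i => ¬ w i < e ∧ ¬ w i = e) = s.filter (fun i => e < w i) :=
      filter_congr fun i _ => by omega
    rw [e1, e2, mul_sum, card_eq_sum_ones]
    congr 1
    · exact sum_congr rfl fun i hi => by rw [(mem_filter.1 hi).2, Nat.sub_self, pow_zero]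
    · refine sum_congr rfl fun i hi => ?_
      rw [← pow_succ']
      congr 1
      have := (mem_filter.1 hi).2
      omega
  rw [← sum_filter_add_sum_filter_not s (fun i => w i < e), h2, h3,
    Nat.add_mul_div_left _ _ (pow_pos hz0 e), Nat.div_eq_of_lt h1, zero_add,
    Nat.add_mul_mod_self_left, Nat.mod_eq_of_lt ((card_filter_le _ _).trans_lt hz)]

/-- Applied to the subsets of a `d`-set weighted by cardinality, this yields binomial coefficients
from a power, a quotient and a remainder. -/
theorem one_add_pow_div_pow_mod {z d : ℕ} (hz : 2 ^ d < z) (j : ℕ) :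
    (1 + z) ^ d / z ^ j % z = d.choose j := by
  have h := sum_pow_div_pow_mod (range d).powerset card (z := z) (by simpa using hz) j
  have h2 : ∑ i ∈ (range d).powerset, z ^ #i = (1 + z) ^ d := by
    have := prod_one_add (f := fun _ : ℕ => z) (range d)
    simpa using this.symm
  rw [h2] at h
  rw [h, ← powersetCard_eq_filter, card_powersetCard, card_range]

end Coefficients

/-! ### Ways of changing approvals as tables of approver sets -/

section ApprovalTables

open Finset

namespace ApprovalElection

variable {C V : Type*} [DecidableEq C] [Fintype V]

/-- The voters that approve a candidate. -/
def approvers (E : ApprovalElection C V) (c : C) : Finset V := univ.filter fun v => c ∈ E.ballot v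

theorem mem_approvers {E : ApprovalElection C V} {c : C} {v : V} :
    v ∈ E.approvers c ↔ c ∈ E.ballot v := by simp [approvers]

theorem card_approvers (E : ApprovalElection C V) (c : C) : #(E.approvers c) = E.app c := rfl

variable [Fintype C]

theorem sum_card_approvers (E : ApprovalElection C V) :
    ∑ c, #(E.approvers c) = #E.approvals := by
  rw [approvals, ← univ_product_univ, card_filter, sum_product_right]
  simp only [approvers, card_filter]

theorem avWinners_eq_scoreWinners (E : ApprovalElection C V) (k : ℕ) :
    E.avWinners k = scoreWinners (fun c => #(E.approvers c)) k := rfl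

variable [DecidableEq V]

theorem card_approvals_addApprovals (E : ApprovalElection C V) {P : Finset (V × C)}
    (hP : P ⊆ E.nonApprovals) : #(E.addApprovals P).approvals = #E.approvals + #P := by
  rw [← card_union_of_disjoint]
  · congr 1
    ext ⟨v, c⟩
    simp [approvals, addApprovals]
  · rw [disjoint_left]
    intro x hx hxP
    have := hP hxP
    simp only [approvals, nonApprovals, mem_filter] at hx this
    exact this.2 hx.2

theorem card_approvals_removeApprovals (E : ApprovalElection C V) {P : Finset (V × C)}
    (hP : P ⊆ E.approvals) : #(E.removeApprovals P).approvals + #P = #E.approvals := by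
  rw [← card_sdiff_add_card_eq_card hP]
  congr 2
  ext ⟨v, c⟩
  simp [approvals, removeApprovals]

/-- A set of added approvals amounts to an enlarged approver set for each candidate. The size
constraint becomes a constraint on the total, and the winners depend on the column sizes only. -/
theorem avAddCount_eq (E : ApprovalElection C V) (k B : ℕ) :
    E.avAddCount k B = #{p ∈ Fintype.piFinset fun c => univ.filter (E.approvers c ⊆ ·) |
      ∑ c, #(p c) = #E.approvals + B ∧
        scoreWinners (fun c => #(p c)) k = scoreWinners E.app k} := by
  have hQ : ∀ p : C → Finset V, (univ.filter fun x : V × C => x.1 ∈ p x.2 ∧ x.2 ∉ E.ballot x.1) ⊆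
      E.nonApprovals := fun p x hx => by
    simp only [nonApprovals, mem_filter, mem_univ, true_and] at hx ⊢
    exact hx.2
  have hinv : ∀ p : C → Finset V, (∀ c, E.approvers c ⊆ p c) →
      (E.addApprovals (univ.filter fun x : V × C => x.1 ∈ p x.2 ∧ x.2 ∉ E.ballot x.1)).approvers =
        p := fun p hp => by
    ext c v
    have := @hp c v
    rw [mem_approvers] at this
    simp only [mem_approvers, addApprovals, mem_filter, mem_univ, true_and]
    tauto
  refine card_bij' (fun P _ => (E.addApprovals P).approvers)
    (fun p _ => univ.filter fun x : V × C => x.1 ∈ p x.2 ∧ x.2 ∉ E.ballot x.1) ?_ ?_ ?_ ?_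
  · intro P hP
    simp only [mem_filter, mem_powersetCard, Fintype.mem_piFinset] at hP ⊢
    refine ⟨fun c => ⟨mem_univ _, fun v hv => ?_⟩, ?_, hP.2⟩
    · rw [mem_approvers] at hv ⊢
      simp [addApprovals, hv]
    · rw [sum_card_approvers, card_approvals_addApprovals E hP.1.1, hP.1.2]
  · intro p hp
    simp only [mem_filter, mem_powersetCard, Fintype.mem_piFinset, mem_univ, true_and] at hp ⊢
    refine ⟨⟨hQ p, ?_⟩, ?_⟩
    · have h := card_approvals_addApprovals E (hQ p)
      rw [← sum_card_approvers, hinv p hp.1, hp.2.1] at h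
      omega
    · rw [avWinners_eq_scoreWinners, hinv p hp.1]
      exact hp.2.2
  · intro P hP
    simp only [mem_filter, mem_powersetCard] at hP
    ext ⟨v, c⟩
    have h : (v, c) ∈ P → _ := fun h => hP.1.1 h
    simp only [nonApprovals, mem_filter, mem_univ, true_and] at h
    simp only [mem_approvers, addApprovals, mem_filter, mem_univ, true_and]
    tauto
  · intro p hp
    simp only [mem_filter, Fintype.mem_piFinset, mem_univ, true_and] at hp
    exact hinv p hp.1

/-- Removal shrinks each approver set. The hypothesis `hB` keeps the truncated difference honest:
for larger `B` it would be `0` and the empty table could be counted. -/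
theorem avRemoveCount_eq (E : ApprovalElection C V) {k B : ℕ} (hB : B ≤ #E.approvals) :
    E.avRemoveCount k B = #{p ∈ Fintype.piFinset fun c => (E.approvers c).powerset |
      ∑ c, #(p c) = #E.approvals - B ∧
        scoreWinners (fun c => #(p c)) k = scoreWinners E.app k} := by
  have hQ : ∀ p : C → Finset V, (univ.filter fun x : V × C => x.1 ∉ p x.2 ∧ x.2 ∈ E.ballot x.1) ⊆
      E.approvals := fun p x hx => by
    simp only [approvals, mem_filter, mem_univ, true_and] at hx ⊢
    exact hx.2
  have hinv : ∀ p : C → Finset V, (∀ c, p c ⊆ E.approvers c) →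
      (E.removeApprovals
        (univ.filter fun x : V × C => x.1 ∉ p x.2 ∧ x.2 ∈ E.ballot x.1)).approvers = p :=
      fun p hp => by
    ext c v
    have := @hp c v
    rw [mem_approvers] at this
    simp only [mem_approvers, removeApprovals, mem_filter, mem_univ, true_and]
    tauto
  refine card_bij' (fun P _ => (E.removeApprovals P).approvers)
    (fun p _ => univ.filter fun x : V × C => x.1 ∉ p x.2 ∧ x.2 ∈ E.ballot x.1) ?_ ?_ ?_ ?_
  · intro P hP
    simp only [mem_filter, mem_powersetCard, Fintype.mem_piFinset, mem_powerset] at hP ⊢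
    refine ⟨fun c v hv => ?_, ?_, hP.2⟩
    · rw [mem_approvers] at hv ⊢
      simp only [removeApprovals, mem_filter] at hv
      exact hv.2.1
    · have := card_approvals_removeApprovals E hP.1.1
      rw [sum_card_approvers]
      omega
  · intro p hp
    simp only [mem_filter, mem_powersetCard, Fintype.mem_piFinset, mem_powerset] at hp ⊢
    refine ⟨⟨hQ p, ?_⟩, ?_⟩
    · have h := card_approvals_removeApprovals E (hQ p)
      rw [← sum_card_approvers, hinv p hp.1, hp.2.1] at h
      omega
    · rw [avWinners_eq_scoreWinners, hinv p hp.1]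
      exact hp.2.2
  · intro P hP
    simp only [mem_filter, mem_powersetCard] at hP
    ext ⟨v, c⟩
    have h : (v, c) ∈ P → _ := fun h => hP.1.1 h
    simp only [approvals, mem_filter, mem_univ, true_and] at h
    simp only [mem_approvers, removeApprovals, mem_filter, mem_univ, true_and]
    tauto
  · intro p hp
    simp only [mem_filter, Fintype.mem_piFinset, mem_powerset] at hp
    exact hinv p hp.1

theorem avRemoveCount_of_lt (E : ApprovalElection C V) {k B : ℕ} (hB : #E.approvals < B) :
    E.avRemoveCount k B = 0 := by
  rw [avRemoveCount, powersetCard_eq_empty.2 hB, filter_empty, card_empty]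

end ApprovalElection

/-- Removing `A` identifies supersets of `A` with subsets of its complement. -/
theorem card_supersets_of_card {V : Type*} [Fintype V] [DecidableEq V] (A : Finset V) (s : ℕ) :
    #{S ∈ univ.filter (A ⊆ ·) | #S = s} =
      if #A ≤ s then (Fintype.card V - #A).choose (s - #A) else 0 := by
  split_ifs with h
  · rw [← card_compl, ← card_powersetCard]
    refine card_bij' (fun S _ => S \ A) (fun T _ => T ∪ A) ?_ ?_ ?_ ?_
    · intro S hS
      simp only [mem_filter, mem_univ, true_and, mem_powersetCard] at hS ⊢
      exact ⟨fun x hx => by simpa using (mem_sdiff.1 hx).2, by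
        rw [card_sdiff_of_subset hS.1, hS.2]⟩
    · intro T hT
      simp only [mem_filter, mem_univ, true_and, mem_powersetCard] at hT ⊢
      refine ⟨subset_union_right, ?_⟩
      rw [card_union_of_disjoint (disjoint_left.2 fun x hx => by simpa using hT.1 hx), hT.2]
      omega
    · intro S hS
      simp only [mem_filter, mem_univ, true_and] at hS
      exact sdiff_union_of_subset hS.1
    · intro T hT
      simp only [mem_powersetCard] at hT
      ext x
      have : x ∈ T → _ := fun h => hT.1 h
      simp only [mem_compl] at this
      simp only [mem_sdiff, mem_union]
      tauto
  · rw [card_eq_zero, filter_eq_empty_iff]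
    intro S hS hs
    exact h (hs ▸ card_le_card (mem_filter.1 hS).2)

end ApprovalTables

/-! ### Generating functions for tables with bounded columns -/

section GeneratingFunctions

open Finset

variable {C V : Type*} [Fintype C] [DecidableEq C] [Fintype V]

theorem card_filter_eq_sum_of_unique {ι : Type*} [DecidableEq ι] {s : Finset ι} {Q : ι → Prop} [DecidablePred Q]
    {D : ℕ → ι → Prop} [∀ i, DecidablePred (D i)] {N : ℕ}
    (h1 : ∀ p ∈ s, Q p ↔ ∃ i < N, D i p) (h2 : ∀ p ∈ s, ∀ i j, i < j → D i p → ¬ D j p) :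
    #{p ∈ s | Q p} = ∑ i ∈ range N, #{p ∈ s | D i p} := by
  rw [← card_biUnion]
  · congr 1
    ext p
    simp only [mem_filter, mem_biUnion, mem_range]
    exact ⟨fun h => ((h1 p h.1).1 h.2).imp fun i hi => ⟨hi.1, h.1, hi.2⟩,
      fun ⟨i, hi, hp, hd⟩ => ⟨hp, (h1 p hp).2 ⟨i, hi, hd⟩⟩⟩
  · intro i _ j _ hij
    refine disjoint_left.2 fun p hp hp' => ?_
    rw [mem_filter] at hp hp'
    rcases hij.lt_or_gt with h | h
    · exact h2 p hp.1 i j h hp.2 hp'.2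
    · exact h2 p hp.1 j i h hp'.2 hp.2

theorem sum_pow_card_filter (F : Finset (Finset V)) {cnt : ℕ → ℕ}
    (hcnt : ∀ s, #{S ∈ F | #S = s} = cnt s) (z lo hi : ℕ) {N : ℕ} (hN : Fintype.card V < N) :
    ∑ S ∈ F with lo ≤ #S ∧ #S < hi, z ^ #S =
      ∑ s ∈ range N, if lo ≤ s ∧ s < hi then cnt s * z ^ s else 0 := by
  rw [← sum_fiberwise_of_maps_to (t := range N) (g := card)
    fun S _ => mem_range.2 ((card_le_univ S).trans_lt hN)]
  refine sum_congr rfl fun s _ => ?_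
  rw [filter_filter]
  split_ifs with h
  · rw [← hcnt, ← smul_eq_mul, ← sum_const]
    refine sum_congr (filter_congr fun S _ => ?_) fun S hS => by rw [(mem_filter.1 hS).2]
    constructor
    · exact fun h => h.2
    · rintro rfl
      exact ⟨h, rfl⟩
  · refine sum_eq_zero fun S hS => ?_
    obtain ⟨-, h1, rfl⟩ := mem_filter.1 hS
    exact absurd h1 h

/-- Expanding the product means choosing one set per candidate, and the exponents add up to the
total. There are at most `2 ^ (n * m)` tables for `n` voters and `m` candidates, fewer than the base
`2 ^ N`, so coefficients do not overflow. -/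
theorem card_box (F : C → Finset (Finset V)) {cnt : C → ℕ → ℕ}
    (hcnt : ∀ c s, #{S ∈ F c | #S = s} = cnt c s) {N : ℕ} (hN : Fintype.card V < N)
    (hN' : Fintype.card V * Fintype.card C < N) (lo hi : C → ℕ) (e : ℕ) :
    (∏ c, ∑ s ∈ range N, if lo c ≤ s ∧ s < hi c then cnt c s * (2 ^ N) ^ s else 0) /
        (2 ^ N) ^ e % 2 ^ N =
      #{p ∈ Fintype.piFinset F |
        (∀ c, lo c ≤ #(p c) ∧ #(p c) < hi c) ∧ ∑ c, #(p c) = e} := by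
  have h1 : ∀ c, (∑ s ∈ range N, if lo c ≤ s ∧ s < hi c then cnt c s * (2 ^ N) ^ s else 0) =
      ∑ S ∈ F c with lo c ≤ #S ∧ #S < hi c, (2 ^ N) ^ #S := fun c =>
    (sum_pow_card_filter (F c) (hcnt c) _ _ _ hN).symm
  simp only [h1]
  rw [prod_univ_sum]
  simp only [prod_pow_eq_pow_sum]
  rw [sum_pow_div_pow_mod]
  · congr 1
    ext p
    simp only [mem_filter, Fintype.mem_piFinset]
    rw [forall_and, and_assoc]
  · refine (card_le_univ _).trans_lt ?_
    rw [Fintype.card_pi, prod_const, Fintype.card_finset, ← pow_mul, card_univ]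
    exact Nat.pow_lt_pow_right (by norm_num) hN'

end GeneratingFunctions

/-! ### The counting formula -/

section Formula

open Finset

theorem card_filter_and_not_of_imp {ι : Type*} [DecidableEq ι] {s : Finset ι} {p q : ι → Prop}
    [DecidablePred p] [DecidablePred q] (h : ∀ x ∈ s, q x → p x) :
    #{x ∈ s | p x ∧ ¬ q x} = #{x ∈ s | p x} - #{x ∈ s | q x} := by
  rw [filter_and_not, card_sdiff_of_subset]
  exact fun x hx => mem_filter.2 ⟨(mem_filter.1 hx).1, h x (mem_filter.1 hx).1 (mem_filter.1 hx).2⟩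

variable {C ι : Type*} [Fintype C] [DecidableEq ι] {s : Finset ι} {sc : ι → C → ℕ} {a : C → ℕ}
  {N t : ℕ}

/-- Counting by the lowest score of a candidate above the threshold. -/
theorem card_of_threshold (hN : ∀ p ∈ s, ∀ c, sc p c < N) (ht : ∃ c, t ≤ a c) (R : ι → Prop)
    [DecidablePred R] [DecidablePred fun p => ∃ i, ∀ c, t ≤ a c ↔ i ≤ sc p c] :
    #{p ∈ s | R p ∧ ∃ i, ∀ c, t ≤ a c ↔ i ≤ sc p c} = ∑ i ∈ range N,
      (#{p ∈ s | (∀ c, (if t ≤ a c then i else 0) ≤ sc p c ∧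
          sc p c < if t ≤ a c then N else i) ∧ R p} -
        #{p ∈ s | (∀ c, (if t ≤ a c then i + 1 else 0) ≤ sc p c ∧
          sc p c < if t ≤ a c then N else i) ∧ R p}) := by
  obtain ⟨c₀, hc₀⟩ := ht
  have key : ∀ p ∈ s, ∀ j i c, ((if t ≤ a c then j else 0) ≤ sc p c ∧
      sc p c < if t ≤ a c then N else i) ↔ (t ≤ a c → j ≤ sc p c) ∧ (a c < t → sc p c < i) := by
    intro p hp j i c
    have := hN p hp c
    split_ifs <;> omega
  have h0 : ∀ j i, s.filter (fun p => (∀ c, (if t ≤ a c then j else 0) ≤ sc p c ∧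
      sc p c < if t ≤ a c then N else i) ∧ R p) = s.filter fun p =>
        (∀ c, (t ≤ a c → j ≤ sc p c) ∧ (a c < t → sc p c < i)) ∧ R p := fun j i =>
    filter_congr fun p hp => by simp only [key p hp]
  simp only [h0]
  rw [card_filter_eq_sum_of_unique (N := N) (D := fun i p =>
    ((∀ c, (t ≤ a c → i ≤ sc p c) ∧ (a c < t → sc p c < i)) ∧ R p) ∧
      ¬ ((∀ c, (t ≤ a c → i + 1 ≤ sc p c) ∧ (a c < t → sc p c < i)) ∧ R p))]
  · refine sum_congr rfl fun i _ => card_filter_and_not_of_imp fun p hp h => ⟨fun c => ?_, h.2⟩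
    have := h.1 c
    exact ⟨fun hc => by have := this.1 hc; omega, this.2⟩
  · intro p hp
    constructor
    · rintro ⟨hR, hex⟩
      -- The candidate `c₀` bounds the admissible `i`; without it all large `i` would qualify.
      have hb : ∀ i, (∀ c, t ≤ a c ↔ i ≤ sc p c) → i < N := fun i hi =>
        ((hi c₀).1 hc₀).trans_lt (hN p hp c₀)
      obtain ⟨i₀, hi₀⟩ := hex
      classical
      -- Several `i` may give the same cut. The largest is singled out because the box for `i + 1`
      -- with the same upper bounds no longer contains `p`; this explains the difference of two
      -- counts.
      have h1 := Nat.findGreatest_spec (P := fun i => ∀ c, t ≤ a c ↔ i ≤ sc p c)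
        (hb i₀ hi₀).le hi₀
      set i := Nat.findGreatest (fun i => ∀ c, t ≤ a c ↔ i ≤ sc p c) N with hi
      refine ⟨i, hb i h1, ⟨fun c => ⟨(h1 c).1, fun h => ?_⟩, hR⟩, fun h => ?_⟩
      · have := (h1 c).2
        omega
      · have h2 : ∀ c, t ≤ a c ↔ i + 1 ≤ sc p c := fun c => by
          have := h.1 c
          have := h1 c
          omega
        exact Nat.findGreatest_is_greatest (P := fun i => ∀ c, t ≤ a c ↔ i ≤ sc p c) (n := N)
          (k := i + 1) (by omega) (hb _ h2).le h2
    · rintro ⟨i, -, ⟨h, hR⟩, -⟩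
      exact ⟨hR, i, fun c => by have := h c; omega⟩
  · rintro p hp i j hij ⟨⟨h1, hR⟩, h2⟩ ⟨⟨h3, -⟩, -⟩
    refine h2 ⟨fun c => ⟨fun hc => ?_, (h1 c).2⟩, hR⟩
    have := (h3 c).1 hc
    omega

/-- Counting by the score of the candidates at the threshold. -/
theorem card_of_threshold_tie (hN : ∀ p ∈ s, ∀ c, sc p c < N) (ht : ∃ c, a c = t) (R : ι → Prop)
    [DecidablePred R]
    [DecidablePred fun p => ∃ i, ∀ c, (t < a c ↔ i < sc p c) ∧ (t ≤ a c ↔ i ≤ sc p c)] :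
    #{p ∈ s | R p ∧ ∃ i, ∀ c, (t < a c ↔ i < sc p c) ∧ (t ≤ a c ↔ i ≤ sc p c)} = ∑ i ∈ range N,
      #{p ∈ s | (∀ c, (if t < a c then i + 1 else if t ≤ a c then i else 0) ≤ sc p c ∧
          sc p c < if t < a c then N else if t ≤ a c then i + 1 else i) ∧ R p} := by
  obtain ⟨c₀, hc₀⟩ := ht
  have key : ∀ p ∈ s, ∀ i c, ((if t < a c then i + 1 else if t ≤ a c then i else 0) ≤ sc p c ∧
      sc p c < if t < a c then N else if t ≤ a c then i + 1 else i) ↔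
        (t < a c ↔ i < sc p c) ∧ (t ≤ a c ↔ i ≤ sc p c) := by
    intro p hp i c
    have := hN p hp c
    split_ifs <;> omega
  have h0 : ∀ i, s.filter (fun p => (∀ c, (if t < a c then i + 1 else if t ≤ a c then i else 0) ≤
      sc p c ∧ sc p c < if t < a c then N else if t ≤ a c then i + 1 else i) ∧ R p) =
        s.filter fun p => (∀ c, (t < a c ↔ i < sc p c) ∧ (t ≤ a c ↔ i ≤ sc p c)) ∧ R p := fun i =>
    filter_congr fun p hp => by simp only [key p hp]
  simp only [h0]
  refine card_filter_eq_sum_of_unique (fun p hp => ⟨?_, ?_⟩) ?_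
  · rintro ⟨hR, i, hi⟩
    exact ⟨i, ((hi c₀).2.1 hc₀.ge).trans_lt (hN p hp c₀), hi, hR⟩
  · rintro ⟨i, -, hi, hR⟩
    exact ⟨hR, i, hi⟩
  -- With ties `i` is unique, being the score of `c₀`, and no subtraction is needed.
  · rintro p hp i j hij ⟨h1, -⟩ ⟨h2, -⟩
    have := h1 c₀
    have := h2 c₀
    omega

/-- The number of candidates among the first `m` with score at least `t`. -/
def numAtLeast (m : ℕ) (a : ℕ → ℕ) (t : ℕ) : ℕ := ∑ c ∈ range m, if t ≤ a c then 1 else 0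

/-- A coefficient of a product of polynomials, by evaluation at `2 ^ N`. -/
def boxCoeff (N m e : ℕ) (cnt : ℕ → ℕ → ℕ) (lo hi : ℕ → ℕ) : ℕ :=
  (∏ c ∈ range m, ∑ s ∈ range N, if lo c ≤ s ∧ s < hi c then cnt c s * (2 ^ N) ^ s else 0) /
    (2 ^ N) ^ e % 2 ^ N

/-- The number of tables with total `e` and the same winners as `a`, where `cnt c s` is the number
of possible columns with sum `s` for the candidate `c`. -/
def tableCount (N m k e : ℕ) (a : ℕ → ℕ) (cnt : ℕ → ℕ → ℕ) : ℕ :=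
  ∑ t ∈ range N, if numAtLeast m a (t + 1) < k ∧ k ≤ numAtLeast m a t then
    ∑ i ∈ range N, if numAtLeast m a t = k then
      boxCoeff N m e cnt (fun c => if t ≤ a c then i else 0) (fun c => if t ≤ a c then N else i) -
        boxCoeff N m e cnt (fun c => if t ≤ a c then i + 1 else 0)
          (fun c => if t ≤ a c then N else i)
    else boxCoeff N m e cnt (fun c => if t < a c then i + 1 else if t ≤ a c then i else 0)
      (fun c => if t < a c then N else if t ≤ a c then i + 1 else i)
  else 0

theorem numAtLeast_eq (m : ℕ) (a : ℕ → ℕ) (t : ℕ) :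
    numAtLeast m a t = #{c : Fin m | t ≤ a c} := by
  rw [numAtLeast, Finset.sum_range, card_filter]

theorem numAtLeast_anti (m : ℕ) (a : ℕ → ℕ) {t u : ℕ} (h : t ≤ u) :
    numAtLeast m a u ≤ numAtLeast m a t := by
  rw [numAtLeast_eq, numAtLeast_eq]
  exact card_le_card fun c hc => by simpa using h.trans (mem_filter.1 hc).2

theorem card_eq_tableCount {m n N k e : ℕ} {F : Fin m → Finset (Finset (Fin n))} {a : ℕ → ℕ}
    {cnt : ℕ → ℕ → ℕ} (hk : 1 ≤ k) (hkm : k ≤ m) (hN : n * m < N) (ha : ∀ c : Fin m, a c ≤ n)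
    (hcnt : ∀ (c : Fin m) s, #{S ∈ F c | #S = s} = cnt c s) :
    #{p ∈ Fintype.piFinset F | ∑ c, #(p c) = e ∧
        scoreWinners (fun c => #(p c)) k = scoreWinners (fun c : Fin m => a c) k} =
      tableCount N m k e a cnt := by
  have hnN : n < N := (Nat.le_mul_of_pos_right n (by omega)).trans_lt hN
  have hbox : ∀ lo hi : ℕ → ℕ, boxCoeff N m e cnt lo hi = #{p ∈ Fintype.piFinset F |
        (∀ c : Fin m, lo c ≤ #(p c) ∧ #(p c) < hi c) ∧ ∑ c, #(p c) = e} := fun lo hi => by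
    rw [boxCoeff, Finset.prod_range]
    convert card_box F (cnt := fun c : Fin m => cnt c) hcnt (by simpa using hnN) (by simpa using hN)
      (fun c => lo c) (fun c => hi c) e
  have hsc : ∀ p ∈ Fintype.piFinset F, ∀ c, #(p c) < N := fun p _ c =>
    (card_le_univ _).trans_lt (by simpa using hnN)
  obtain ⟨t, h1, h2⟩ := exists_threshold (fun c : Fin m => a c) hk (by simpa using hkm)
  have h1' : numAtLeast m a (t + 1) < k := by rw [numAtLeast_eq]; exact h1
  have h2' : k ≤ numAtLeast m a t := by rw [numAtLeast_eq]; exact h2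
  have hex : ∃ c : Fin m, t ≤ a c := by
    obtain ⟨c, hc⟩ := card_pos.1 (hk.trans h2)
    exact ⟨c, (mem_filter.1 hc).2⟩
  have htN : t < N := by
    obtain ⟨c, hc⟩ := hex
    exact (hc.trans (ha c)).trans_lt hnN
  -- The outer sum has one nonzero term: by antitonicity of `numAtLeast`, only one threshold meets
  -- both conditions.
  rw [tableCount, sum_eq_single t]
  · rw [if_pos ⟨h1', h2'⟩]
    simp only [hbox]
    rcases h2'.eq_or_lt with h | h
    · simp only [if_pos h.symm]
      classical
      have h4 := card_of_threshold hsc hex fun p => ∑ c, #(p c) = e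
      refine Eq.trans (congrArg card (filter_congr fun p _ => and_congr_right fun _ => ?_))
        (h4.trans (sum_congr rfl fun i _ => ?_))
      · exact scoreWinners_eq_iff_of_card_eq hk (by simpa using hkm) (by rw [h, numAtLeast_eq])
      · congr!
    · simp only [if_neg h.ne']
      have h3 : k < #{c : Fin m | t ≤ a c} := by rwa [← numAtLeast_eq]
      -- More than `k` candidates reach `t` but fewer than `k` exceed it, so some candidate scores
      -- exactly `t`.
      have htie : ∃ c : Fin m, a c = t := by
        by_contra! hne
        have : #{c : Fin m | t ≤ a c} ≤ #{c : Fin m | t < a c} := card_le_card fun c hc => by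
          have := (mem_filter.1 hc).2
          have := hne c
          simp only [mem_filter, mem_univ, true_and]
          omega
        omega
      classical
      have h4 := card_of_threshold_tie hsc htie fun p => ∑ c, #(p c) = e
      refine Eq.trans (congrArg card (filter_congr fun p _ => and_congr_right fun _ => ?_))
        (h4.trans (sum_congr rfl fun i _ => ?_))
      · exact scoreWinners_eq_iff_of_lt_card hk h1 h3
      · congr!
  · intro u _ hu
    refine if_neg fun h => ?_
    rcases hu.lt_or_gt with hu | hu
    · have := numAtLeast_anti m a (show u + 1 ≤ t from hu)
      omega
    · have := numAtLeast_anti m a (show t + 1 ≤ u from hu)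
      omega
  · exact fun h => absurd (mem_range.2 htN) h

end Formula

/-! ### Parsing the fields of a word coded as a number -/

namespace NumProg

open Computability (Γ')
open Finset

/-- The number of separators among the first `i` symbols of a word given as a number. -/
def numSeps (X i : ℕ) : ℕ := ∑ j ∈ range i, if X.testBit (2 * j + 1) = true then 1 else 0

/-- A weighted sum over the symbols of the field `q` of a word given as a number, where only the
first `M` symbols are considered. -/
def fieldSum (M : ℕ) (w : ℕ → Bool → ℕ) (X q : ℕ) : ℕ :=
  ∑ i ∈ range M, if ¬ X.testBit (2 * i + 1) = true ∧ numSeps X i = q then w i (X.testBit (2 * i))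
    else 0

/-- A weighted sum over the entries of a list. -/
def bitsSum (w : ℕ → Bool → ℕ) : List Bool → ℕ
  | [] => 0
  | b :: l => w 0 b + bitsSum (fun i => w (i + 1)) l

theorem testBit_ofBits_zero (b : Bool) (l : List Bool) : (ofBits (b :: l)).testBit 0 = b :=
  Nat.testBit_bit_zero ..

theorem testBit_ofBits_succ (b : Bool) (l : List Bool) (j : ℕ) :
    (ofBits (b :: l)).testBit (j + 1) = (ofBits l).testBit j :=
  Nat.testBit_bit_succ ..

theorem testBit_wordNum_bit_zero (b : Bool) (L : List Γ') :
    (wordNum (.bit b :: L)).testBit 0 = b := testBit_ofBits_zero _ _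

theorem testBit_wordNum_bit_one (b : Bool) (L : List Γ') :
    (wordNum (.bit b :: L)).testBit 1 = false :=
  (testBit_ofBits_succ _ _ 0).trans (testBit_ofBits_zero _ _)

theorem testBit_wordNum_comma_one (L : List Γ') :
    (wordNum (.comma :: L)).testBit 1 = true :=
  (testBit_ofBits_succ _ _ 0).trans (testBit_ofBits_zero _ _)

theorem testBit_wordNum_cons (a : Γ') (L : List Γ') (j : ℕ) :
    (wordNum (a :: L)).testBit (j + 2) = (wordNum L).testBit j := by
  cases a <;> exact (testBit_ofBits_succ _ _ (j + 1)).trans (testBit_ofBits_succ _ _ j)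

theorem numSeps_bit (b : Bool) (L : List Γ') (i : ℕ) :
    numSeps (wordNum (.bit b :: L)) (i + 1) = numSeps (wordNum L) i := by
  rw [numSeps, sum_range_succ', mul_zero, zero_add, testBit_wordNum_bit_one]
  simp [numSeps, mul_add, add_right_comm _ 2 1, testBit_wordNum_cons]

theorem numSeps_comma (L : List Γ') (i : ℕ) :
    numSeps (wordNum (.comma :: L)) (i + 1) = numSeps (wordNum L) i + 1 := by
  rw [numSeps, sum_range_succ', mul_zero, zero_add, testBit_wordNum_comma_one]
  simp [numSeps, mul_add, add_right_comm _ 2 1, testBit_wordNum_cons]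

theorem numSeps_nil (i : ℕ) : numSeps (wordNum []) i = 0 := by
  simp [numSeps, wordNum, ofBits]

theorem fieldSum_bit (M : ℕ) (w : ℕ → Bool → ℕ) (b : Bool) (L : List Γ') (q : ℕ) :
    fieldSum (M + 1) w (wordNum (.bit b :: L)) q =
      fieldSum M (fun i => w (i + 1)) (wordNum L) q + if q = 0 then w 0 b else 0 := by
  rw [fieldSum, sum_range_succ', mul_zero, zero_add, testBit_wordNum_bit_one,
    testBit_wordNum_bit_zero]
  congr 1
  · simp [fieldSum, mul_add, add_right_comm _ 2 1, testBit_wordNum_cons, numSeps_bit]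
  · simp [numSeps, eq_comm (a := 0)]

theorem fieldSum_comma_zero (M : ℕ) (w : ℕ → Bool → ℕ) (L : List Γ') :
    fieldSum M w (wordNum (.comma :: L)) 0 = 0 := by
  refine sum_eq_zero fun i _ => if_neg ?_
  rcases i with _ | i
  · simp [testBit_wordNum_comma_one]
  · simp [numSeps_comma]

theorem fieldSum_comma_succ (M : ℕ) (w : ℕ → Bool → ℕ) (L : List Γ') (q : ℕ) :
    fieldSum (M + 1) w (wordNum (.comma :: L)) (q + 1) =
      fieldSum M (fun i => w (i + 1)) (wordNum L) q := by
  rw [fieldSum, sum_range_succ', mul_zero, zero_add, testBit_wordNum_comma_one]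
  simp [fieldSum, mul_add, add_right_comm _ 2 1, testBit_wordNum_cons, numSeps_comma]

/-- The word with the given fields. -/
def word (Bs : List (List Bool)) : List Γ' := Bs.flatMap fun l => l.map Γ'.bit ++ [Γ'.comma]

theorem word_cons (l : List Bool) (Bs : List (List Bool)) :
    word (l :: Bs) = l.map Γ'.bit ++ Γ'.comma :: word Bs := by simp [word]

/-- Digits past the end of the word are zero and never look like a separator, so scanning may
continue up to the size of the number, twice the word length. -/
theorem numSeps_word (Bs : List (List Bool)) : ∀ M, (word Bs).length ≤ M →
    numSeps (wordNum (word Bs)) M = Bs.length := by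
  induction Bs with
  | nil => exact fun M _ => numSeps_nil M
  | cons l Bs ih =>
    rw [word_cons]
    induction l with
    | nil =>
      intro M hM
      obtain ⟨M, rfl⟩ : ∃ M', M = M' + 1 := ⟨M - 1, by simp at hM; omega⟩
      simp only [List.map_nil, List.nil_append, List.length_cons] at hM ⊢
      rw [numSeps_comma, ih M (by omega)]
    | cons b l ih' =>
      intro M hM
      obtain ⟨M, rfl⟩ : ∃ M', M = M' + 1 := ⟨M - 1, by simp at hM; omega⟩
      simp only [List.map_cons, List.cons_append, List.length_cons] at hM ⊢
      rw [numSeps_bit, ih' M (by omega), List.length_cons]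

theorem fieldSum_word_zero (l : List Bool) (Bs : List (List Bool)) :
    ∀ (M : ℕ) (w : ℕ → Bool → ℕ), l.length ≤ M →
      fieldSum M w (wordNum (word (l :: Bs))) 0 = bitsSum w l := by
  rw [word_cons]
  induction l with
  | nil => exact fun M w _ => fieldSum_comma_zero M w _
  | cons b l ih =>
    intro M w hM
    obtain ⟨M, rfl⟩ : ∃ M', M = M' + 1 := ⟨M - 1, by simp at hM; omega⟩
    rw [List.map_cons, List.cons_append, fieldSum_bit, if_pos rfl, ih _ _ (by simpa using hM),
      bitsSum, add_comm]

/-- Skipping a field shifts the positions by its length and by one more for its separator, and the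
weights move accordingly. -/
theorem fieldSum_word_succ (l : List Bool) (Bs : List (List Bool)) (q : ℕ) :
    ∀ (M : ℕ) (w : ℕ → Bool → ℕ),
      fieldSum (M + (l.length + 1)) w (wordNum (word (l :: Bs))) (q + 1) =
        fieldSum M (fun i => w (i + (l.length + 1))) (wordNum (word Bs)) q := by
  rw [word_cons]
  induction l with
  | nil => exact fun M w => fieldSum_comma_succ M w _ _
  | cons b l ih =>
    intro M w
    rw [List.map_cons, List.cons_append, List.length_cons, ← add_assoc M, fieldSum_bit,
      if_neg (Nat.succ_ne_zero q), ih, add_zero]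
    rfl

theorem length_word_cons (l : List Bool) (Bs : List (List Bool)) :
    (word (l :: Bs)).length = (word Bs).length + (l.length + 1) := by
  simp [word_cons]
  omega

/-- If the weights do not depend on the position, then the weighted sum over a field depends only
on this field. -/
theorem fieldSum_word (w : Bool → ℕ) (Bs : List (List Bool)) :
    ∀ (q M : ℕ) (hq : q < Bs.length), (word Bs).length ≤ M →
      fieldSum M (fun _ => w) (wordNum (word Bs)) q = bitsSum (fun _ => w) Bs[q] := by
  induction Bs with
  | nil => exact fun q M hq => absurd hq (by simp)
  | cons l Bs ih =>
    intro q M hq hM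
    rw [length_word_cons] at hM
    rcases q with _ | q
    · exact fieldSum_word_zero l Bs M _ (by omega)
    · obtain ⟨M, rfl⟩ : ∃ M', M = M' + (l.length + 1) := ⟨M - (l.length + 1), by omega⟩
      rw [fieldSum_word_succ, ih q M (by simpa using hq) (by omega), List.getElem_cons_succ]

theorem bitsSum_one (l : List Bool) : bitsSum (fun _ _ => 1) l = l.length := by
  induction l with
  | nil => rfl
  | cons b l ih => rw [bitsSum, ih, List.length_cons, add_comm]

theorem bitsSum_ones (l : List Bool) :
    bitsSum (fun _ b => if b = true then 1 else 0) l = l.count true := by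
  induction l with
  | nil => rfl
  | cons b l ih =>
    rw [bitsSum, ih, List.count_cons, add_comm]
    simp

theorem bitsSum_two_pow (l : List Bool) : ∀ j,
    bitsSum (fun i b => if b = true then 2 ^ (i + j) else 0) l = ofBits l * 2 ^ j := by
  induction l with
  | nil => simp [bitsSum, ofBits]
  | cons b l ih =>
    intro j
    have h : (fun i : ℕ => fun b : Bool => if b = true then 2 ^ (i + 1 + j) else 0) =
        fun i b => if b = true then 2 ^ (i + (j + 1)) else 0 := by
      funext i b
      rw [add_assoc, add_comm 1]
    rw [bitsSum, h, ih]
    cases b <;> simp [ofBits] <;> ring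

theorem fieldSum_le (M : ℕ) {w : ℕ → Bool → ℕ} (hw : ∀ i b, w i b ≤ 1) (X q : ℕ) :
    fieldSum M w X q ≤ M := by
  calc fieldSum M w X q ≤ ∑ i ∈ range M, 1 := sum_le_sum fun i _ => by
        split_ifs
        · exact hw _ _
        · exact zero_le_one
    _ = M := by simp

theorem numSeps_le (X M : ℕ) : numSeps X M ≤ M := by
  calc numSeps X M ≤ ∑ i ∈ range M, 1 := sum_le_sum fun i _ => by
        split_ifs
        · exact le_rfl
        · exact zero_le_one
    _ = M := by simp

end NumProg

/-! ### Polynomial-time computability of the counting formula -/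

namespace NumProg

open NatTuple Finset

variable {β : Type} [NatTuple β] {f g N m k e G X q n : β → ℕ}

namespace PolyC

theorem min (hf : PolyC f) (hg : PolyC g) : PolyC fun b => Min.min (f b) (g b) :=
  (ite (PolyP.lt hf hg) hf hg).congr fun b => by
    split_ifs with h
    · exact (min_eq_left h.le).symm
    · exact (min_eq_right (not_lt.1 h)).symm

/-- Capping the exponent at a size keeps the power polynomially long for every argument; inside the
sums the cap has no effect. -/
theorem pow_min (hf : PolyC f) (hg : PolyC g) (hG : PolyC G) :
    PolyC fun b => f b ^ Min.min (g b) (G b).size :=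
  pow hf (hg.min (size.comp hG)) hG fun _ => min_le_right _ _

/-- Sums whose terms have to be computed only for small indices. -/
theorem sum_range_of_eq {f : β → ℕ → ℕ} {f' : ℕ × β → ℕ} (hf : PolyC f') (hn : PolyC n)
    (hG : PolyC G) (hle : ∀ b, n b ≤ (G b).size) (h : ∀ b, ∀ i < n b, f' (i, b) = f b i) :
    PolyC fun b => ∑ i ∈ range (n b), f b i :=
  (sum_range hf hn hG hle).congr fun b => sum_congr rfl fun i hi => h b i (mem_range.1 hi)

theorem mod_two_pow (hf : PolyC f) (hG : PolyC G) : PolyC fun b => f b % 2 ^ (G b).size :=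
  (hf.sub ((hf.div_two_pow (size.comp hG)).mul
    (pow (const 2) (size.comp hG) hG fun _ => le_rfl))).congr fun b => by
      have := Nat.div_add_mod' (f b) (2 ^ (G b).size)
      omega

theorem numSeps (hX : PolyC X) (hn : PolyC n) :
    PolyC fun b => numSeps (X b) (Min.min (n b) (X b).size) :=
  sum_range (f := fun p => if (X p.2).testBit (2 * p.1 + 1) = true then 1 else 0)
    (ite (PolyP.testBit (hX.comp snd) (((const 2).mul fst).add one)) one zero)
    (hn.min (size.comp hX)) hX fun _ => min_le_right _ _

theorem fieldSum {w : β → ℕ → Bool → ℕ} {w₀ w₁ : ℕ × β → ℕ} (hX : PolyC X) (hq : PolyC q)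
    (h₀ : PolyC w₀) (h₁ : PolyC w₁)
    (hw : ∀ b, ∀ i < (X b).size, ∀ v, w b i v = if v = true then w₁ (i, b) else w₀ (i, b)) :
    PolyC fun b => fieldSum (X b).size (w b) (X b) (q b) := by
  have hX' : PolyC fun p : ℕ × β => X p.2 := hX.comp snd
  refine sum_range_of_eq (ite (((PolyP.testBit hX' (((const 2).mul fst).add one)).not).and
    (PolyP.eq (numSeps hX' fst) (hq.comp snd))) (ite (PolyP.testBit hX' ((const 2).mul fst)) h₁ h₀)
    zero) (size.comp hX) hX (fun _ => le_rfl) fun b i hi => ?_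
  simp only [min_eq_left hi.le, hw b i hi]

theorem numAtLeast {a : ℕ × β → ℕ} {t : β → ℕ} (hm : PolyC m) (ha : PolyC a) (ht : PolyC t)
    (hG : PolyC G) (hle : ∀ b, m b ≤ (G b).size) :
    PolyC fun b => numAtLeast (m b) (fun c => a (c, b)) (t b) :=
  sum_range (f := fun p => if t p.2 ≤ a p then 1 else 0)
    (ite (PolyP.le (ht.comp snd) ha) one zero) hm hG hle

/-- The exponent `e` may be exponential in the input length, since `B` is given in binary. The power
`(2 ^ N) ^ e` is therefore never formed: the division is a shift by `N * e`. -/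
theorem boxCoeff {cnt : ℕ × ℕ × β → ℕ} {lo hi : ℕ × β → ℕ} (hG : PolyC G) (hm : PolyC m)
    (he : PolyC e) (hcnt : PolyC cnt) (hlo : PolyC lo) (hhi : PolyC hi)
    (hle : ∀ b, m b ≤ (G b).size) :
    PolyC fun b => boxCoeff (G b).size (m b) (e b) (fun c s => cnt (c, s, b))
      (fun c => lo (c, b)) (fun c => hi (c, b)) := by
  have hG' : PolyC fun p : ℕ × β => G p.2 := hG.comp snd
  have hz : PolyC fun b => 2 ^ (G b).size :=
    pow (const 2) (size.comp hG) hG fun _ => le_rfl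
  have hcol : PolyC fun p : ℕ × β => ∑ s ∈ range (G p.2).size,
      if lo p ≤ s ∧ s < hi p then cnt (p.1, s, p.2) * (2 ^ (G p.2).size) ^ s else 0 := by
    refine sum_range_of_eq (ite ((PolyP.le (hlo.comp snd) fst).and (PolyP.lt fst (hhi.comp snd)))
      ((hcnt.comp ((fst.comp snd).pair (fst.pair (snd.comp snd)))).mul
        (pow_min (hz.comp (snd.comp snd)) fst (hG'.comp snd))) zero) (size.comp hG') hG'
      (fun _ => le_rfl) fun p s hs => ?_
    simp only [min_eq_left hs.le]
  refine (mod_two_pow (div_two_pow (prod_range hcol hm hG hle)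
    ((size.comp hG).mul he)) hG).congr fun b => ?_
  rw [_root_.boxCoeff, pow_mul]

theorem tableCount {a : ℕ × β → ℕ} {cnt : ℕ × ℕ × β → ℕ} (hG : PolyC G) (hm : PolyC m)
    (hk : PolyC k) (he : PolyC e) (ha : PolyC a) (hcnt : PolyC cnt)
    (hle : ∀ b, m b ≤ (G b).size) :
    PolyC fun b => tableCount (G b).size (m b) (k b) (e b) (fun c => a (c, b))
      (fun c s => cnt (c, s, b)) := by
  have hGe : PolyC fun p : ℕ × β => G p.2 := hG.comp snd
  have hge : ∀ {t : ℕ × β → ℕ}, PolyC t →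
      PolyC fun p : ℕ × β => _root_.numAtLeast (m p.2) (fun c => a (c, p.2)) (t p) := fun ht =>
    numAtLeast (a := fun p : ℕ × ℕ × β => a (p.1, p.2.2)) (hm.comp snd)
      (ha.comp (fst.pair (snd.comp snd))) ht hGe fun _ => hle _
  have hbox : ∀ {lo hi : ℕ × ℕ × ℕ × β → ℕ}, PolyC lo → PolyC hi →
      PolyC fun p : ℕ × ℕ × β => _root_.boxCoeff (G p.2.2).size (m p.2.2) (e p.2.2)
        (fun c s => cnt (c, s, p.2.2)) (fun c => lo (c, p)) (fun c => hi (c, p)) :=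
    fun hlo hhi => boxCoeff (cnt := fun p : ℕ × ℕ × ℕ × ℕ × β => cnt (p.1, p.2.1, p.2.2.2.2))
      (hG.comp (snd.comp snd)) (hm.comp (snd.comp snd)) (he.comp (snd.comp snd))
      (hcnt.comp (fst.pair ((fst.comp snd).pair (snd.comp (snd.comp (snd.comp snd))))))
      hlo hhi fun _ => hle _
  -- The components of `p` are the candidate, the new threshold `i`, the old threshold `t` and the
  -- remaining input.
  have hi : PolyC fun p : ℕ × ℕ × ℕ × β => p.2.1 := fst.comp snd
  have ht : PolyC fun p : ℕ × ℕ × ℕ × β => p.2.2.1 := fst.comp (snd.comp snd)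
  have hac : PolyC fun p : ℕ × ℕ × ℕ × β => a (p.1, p.2.2.2) :=
    ha.comp (fst.pair (snd.comp (snd.comp snd)))
  have hN : PolyC fun p : ℕ × ℕ × ℕ × β => (G p.2.2.2).size :=
    size.comp (hG.comp (snd.comp (snd.comp snd)))
  refine sum_range (ite ((PolyP.lt (hge (fst.add one)) (hk.comp snd)).and
    (PolyP.le (hk.comp snd) (hge fst))) (sum_range (f := fun p : ℕ × ℕ × β => _)
      (ite (PolyP.eq ((hge fst).comp snd) (hk.comp (snd.comp snd)))
        ((hbox (ite (PolyP.le ht hac) hi zero) (ite (PolyP.le ht hac) hN hi)).sub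
          (hbox (ite (PolyP.le ht hac) (hi.add one) zero) (ite (PolyP.le ht hac) hN hi)))
        (hbox (ite (PolyP.lt ht hac) (hi.add one) (ite (PolyP.le ht hac) hi zero))
          (ite (PolyP.lt ht hac) hN (ite (PolyP.le ht hac) (hi.add one) hi))))
      (size.comp hGe) hGe fun _ => le_rfl) zero) (size.comp hG) hG fun _ => le_rfl

end PolyC

end NumProg

/-! ### The two answers as functions of the input number -/

namespace NumProg

open Computability (Γ')
open NatTuple Finset

theorem exists_word_eq {Bs : List (List Bool)} (h : Bs ≠ []) : ∃ L, word Bs = L ++ [.comma] := by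
  obtain ⟨Bs, l, rfl⟩ := (List.eq_nil_or_concat Bs).resolve_left h
  exact ⟨word Bs ++ l.map Γ'.bit, by simp [word]⟩

/-- The binomial coefficient `d.choose j`, if it is less than `2 ^ N`. -/
def binomCoeff (N d j : ℕ) : ℕ := (1 + 2 ^ N) ^ d / (2 ^ N) ^ j % 2 ^ N

theorem binomCoeff_eq {N d : ℕ} (h : d < N) (j : ℕ) : binomCoeff N d j = d.choose j :=
  one_add_pow_div_pow_mod (Nat.pow_lt_pow_right one_lt_two h) j

/-- The number in the first field. -/
def firstNumber (X : ℕ) : ℕ := fieldSum X.size (fun i b => if b = true then 2 ^ i else 0) X 0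

/-- The length of a field. -/
def fieldLength (X q : ℕ) : ℕ := fieldSum X.size (fun _ _ => 1) X q

/-- The number in the second field. -/
def secondNumber (X : ℕ) : ℕ :=
  fieldSum X.size (fun i b => if b = true then 2 ^ (i - (fieldLength X 0 + 1)) else 0) X 1

/-- The number of candidates. -/
def numCols (X : ℕ) : ℕ := numSeps X X.size - 2

/-- The score of a candidate. -/
def colSum (X c : ℕ) : ℕ := fieldSum X.size (fun _ b => if b = true then 1 else 0) X (c + 2)

/-- The number of approvals. -/
def totalSum (X : ℕ) : ℕ := ∑ c ∈ range (numCols X), colSum X c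

/-- The number of ways of adding approvals. -/
def addAnswer (X : ℕ) : ℕ :=
  tableCount X.size (numCols X) (firstNumber X) (totalSum X + secondNumber X)
    (fun c => colSum X c) fun c s => if colSum X c ≤ s then
      binomCoeff X.size (fieldLength X 2 - colSum X c) (s - colSum X c) else 0

/-- The number of ways of removing approvals. -/
def removeAnswer (X : ℕ) : ℕ :=
  if secondNumber X ≤ totalSum X then
    tableCount X.size (numCols X) (firstNumber X) (totalSum X - secondNumber X)
      (fun c => colSum X c) fun c s => binomCoeff X.size (colSum X c) s
  else 0

theorem numCols_le (X : ℕ) : numCols X ≤ X.size := (Nat.sub_le _ _).trans (numSeps_le _ _)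

theorem colSum_le (X c : ℕ) : colSum X c ≤ X.size :=
  fieldSum_le _ (fun _ b => by cases b <;> simp) _ _

theorem fieldLength_le (X q : ℕ) : fieldLength X q ≤ X.size :=
  fieldSum_le _ (fun _ _ => le_rfl) _ _

namespace PolyC

variable {β : Type} [NatTuple β] {d j G : β → ℕ}

theorem binomCoeff (hG : PolyC G) (hd : PolyC d) (hj : PolyC j) (hle : ∀ b, d b ≤ (G b).size) :
    PolyC fun b => binomCoeff (G b).size (d b) (j b) := by
  have hz : PolyC fun b => 2 ^ (G b).size := pow (const 2) (size.comp hG) hG fun _ => le_rfl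
  refine (mod_two_pow (div_two_pow (pow (one.add hz) hd hG hle)
    ((size.comp hG).mul hj)) hG).congr fun b => ?_
  rw [NumProg.binomCoeff, pow_mul]

theorem firstNumber : PolyC firstNumber :=
  fieldSum (w₀ := fun _ => 0) (w₁ := fun p => 2 ^ Min.min p.1 p.2.size) id zero zero
    (pow_min (const 2) fst snd) fun b i hi v => by rw [min_eq_left hi.le]

theorem fieldLength : PolyC fun p : ℕ × ℕ => fieldLength p.2 p.1 :=
  fieldSum (w₀ := fun _ => 1) (w₁ := fun _ => 1) snd fst one one fun _ _ _ _ => by simp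

theorem secondNumber : PolyC secondNumber :=
  fieldSum (w₀ := fun _ => 0)
    (w₁ := fun p => 2 ^ Min.min (p.1 - (NumProg.fieldLength p.2 0 + 1)) p.2.size) id one zero
    (pow_min (const 2) (fst.sub ((fieldLength.comp (zero.pair snd)).add one)) snd)
    fun b i hi v => by rw [min_eq_left ((Nat.sub_le _ _).trans hi.le)]

theorem numCols : PolyC numCols :=
  ((numSeps id size).sub (const 2)).congr fun b => by rw [min_self]; rfl

theorem colSum : PolyC fun p : ℕ × ℕ => colSum p.2 p.1 :=
  fieldSum (w₀ := fun _ => 0) (w₁ := fun _ => 1) snd (fst.add (const 2)) zero one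
    fun _ _ _ _ => rfl

theorem totalSum : PolyC totalSum := sum_range colSum numCols id numCols_le

theorem addAnswer : PolyC addAnswer := by
  have hc : PolyC fun p : ℕ × ℕ × ℕ => NumProg.colSum p.2.2 p.1 :=
    colSum.comp (fst.pair (snd.comp snd))
  have hX : PolyC fun p : ℕ × ℕ × ℕ => p.2.2 := snd.comp snd
  exact tableCount (a := fun p => NumProg.colSum p.2 p.1) (cnt := fun p =>
      if NumProg.colSum p.2.2 p.1 ≤ p.2.1 then NumProg.binomCoeff p.2.2.size
        (NumProg.fieldLength p.2.2 2 - NumProg.colSum p.2.2 p.1)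
          (p.2.1 - NumProg.colSum p.2.2 p.1) else 0) id numCols firstNumber
    (totalSum.add secondNumber) colSum (ite (PolyP.le hc (fst.comp snd)) (binomCoeff hX
      ((fieldLength.comp ((const 2).pair hX)).sub hc) ((fst.comp snd).sub hc)
      fun p => (Nat.sub_le _ _).trans (fieldLength_le _ _)) zero) numCols_le

theorem removeAnswer : PolyC removeAnswer :=
  ite (PolyP.le secondNumber totalSum) (tableCount (a := fun p => NumProg.colSum p.2 p.1)
    (cnt := fun p => NumProg.binomCoeff p.2.2.size (NumProg.colSum p.2.2 p.1) p.2.1) id numCols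
    firstNumber (totalSum.sub secondNumber) colSum (binomCoeff (snd.comp snd)
      (colSum.comp (fst.pair (snd.comp snd))) (fst.comp snd) fun _ => colSum_le _ _)
    numCols_le) zero

end PolyC

end NumProg

/-! ### Correctness on encoded inputs -/

namespace AVCountingInput

open Computability NumProg Finset

/-- The fields of the code of an input. -/
def fields (I : AVCountingInput) : List (List Bool) :=
  I.k.bits :: I.B.bits :: (List.finRange I.m).map fun c =>
    (List.finRange I.n).map fun v => decide (c ∈ I.election.ballot v)

theorem encode_eq_word (I : AVCountingInput) : I.encode = word I.fields := by
  rw [encode, fields, word_cons, word_cons, word, List.flatMap_map]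
  have h : I.encodeColumn = fun c => ((List.finRange I.n).map fun v =>
      decide (c ∈ I.election.ballot v)).map Γ'.bit ++ [Γ'.comma] := funext fun c => by
    rw [encodeColumn, List.map_map]
    rfl
  simp [encodeNumber, encodeNat_eq_bits, h]

/-- The code of an input as a number. -/
def number (I : AVCountingInput) : ℕ := wordNum I.encode

theorem exists_encode_eq (I : AVCountingInput) : ∃ L, I.encode = L ++ [.comma] := by
  rw [encode_eq_word]
  exact exists_word_eq (List.cons_ne_nil _ _)

theorem size_number (I : AVCountingInput) : I.number.size = 2 * (word I.fields).length := by
  obtain ⟨L, hL⟩ := I.exists_encode_eq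
  rw [← encode_eq_word, number, hL, size_wordNum]

theorem length_word_fields (I : AVCountingInput) :
    (word I.fields).length = I.k.size + 1 + (I.B.size + 1) + I.m * (I.n + 1) := by
  rw [fields, length_word_cons, length_word_cons, word, List.length_flatMap]
  simp [Function.comp_def, Nat.size_eq_bits_len]
  ring

theorem length_fields (I : AVCountingInput) : I.fields.length = I.m + 2 := by simp [fields]

/-- Every matrix entry occupies a symbol of the word, so the size of the input number can serve as
the `N` of the formula. -/
theorem mul_lt_size_number (I : AVCountingInput) : I.n * I.m < I.number.size := by
  rw [size_number, length_word_fields, mul_comm I.n]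
  have := Nat.mul_le_mul_left I.m (Nat.le_add_right I.n 1)
  omega

theorem n_lt_size_number (I : AVCountingInput) : I.n < I.number.size :=
  (Nat.le_mul_of_pos_right _ (I.one_le_k.trans I.k_le_m)).trans_lt I.mul_lt_size_number

theorem fieldSum_number (I : AVCountingInput) (w : Bool → ℕ) {q : ℕ} (hq : q < I.m + 2) :
    fieldSum I.number.size (fun _ => w) I.number q =
      bitsSum (fun _ => w) (I.fields[q]'(by rwa [length_fields])) := by
  rw [size_number, number, encode_eq_word]
  exact fieldSum_word w _ _ _ _ (by omega)

theorem numCols_number (I : AVCountingInput) : numCols I.number = I.m := by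
  rw [numCols, size_number, number, encode_eq_word, numSeps_word _ _ (by omega), length_fields,
    Nat.add_sub_cancel]

theorem firstNumber_number (I : AVCountingInput) : firstNumber I.number = I.k := by
  have h := I.length_word_fields
  rw [firstNumber, size_number, number, encode_eq_word]
  rw [fields] at h ⊢
  rw [fieldSum_word_zero _ _ _ _ (by rw [Nat.size_eq_bits_len]; omega)]
  have := bitsSum_two_pow I.k.bits 0
  simpa [ofBits_bits] using this

theorem fieldLength_number_zero (I : AVCountingInput) : fieldLength I.number 0 = I.k.size := by
  rw [fieldLength, I.fieldSum_number (fun _ => 1) (by omega), bitsSum_one]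
  simp [fields, Nat.size_eq_bits_len]

theorem fieldLength_number_two (I : AVCountingInput) : fieldLength I.number 2 = I.n := by
  -- There is at least one candidate, so the field with index 2 exists; it is the first column and
  -- has one bit per voter.
  have := I.one_le_k.trans I.k_le_m
  rw [fieldLength, I.fieldSum_number (fun _ => 1) (by omega), bitsSum_one]
  simp [fields]

theorem secondNumber_number (I : AVCountingInput) : secondNumber I.number = I.B := by
  have h := I.length_word_fields
  rw [secondNumber, fieldLength_number_zero, size_number]
  -- The scan is split after the first field and its separator, which matches the offset subtracted
  -- in `secondNumber`.
  obtain ⟨M, hM⟩ : ∃ M, 2 * (word I.fields).length = M + (I.k.bits.length + 1) :=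
    ⟨2 * (word I.fields).length - (I.k.bits.length + 1), by rw [Nat.size_eq_bits_len]; omega⟩
  rw [hM, number, encode_eq_word]
  have hB : I.B.bits.length ≤ M := by
    rw [Nat.size_eq_bits_len] at hM ⊢
    omega
  rw [fields, fieldSum_word_succ, fieldSum_word_zero _ _ _ _ hB]
  have := bitsSum_two_pow I.B.bits 0
  simpa [ofBits_bits, Nat.size_eq_bits_len] using this

theorem colSum_number (I : AVCountingInput) (c : Fin I.m) :
    colSum I.number c = I.election.app c := by
  rw [colSum, I.fieldSum_number (fun b => if b = true then 1 else 0) (by omega), bitsSum_ones]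
  simp [fields, ApprovalElection.app, List.count, List.countP_eq_length_filter,
    Finset.card_def, Fin.univ_def, List.filter_map, Function.comp_def]

theorem totalSum_number (I : AVCountingInput) : totalSum I.number = #I.election.approvals := by
  rw [totalSum, numCols_number, Finset.sum_range, ← ApprovalElection.sum_card_approvers]
  exact sum_congr rfl fun c _ => I.colSum_number c

theorem app_le (I : AVCountingInput) (c : Fin I.m) : I.election.app c ≤ I.n :=
  (card_le_univ (I.election.approvers c)).trans_eq (Fintype.card_fin _)

theorem addAnswer_number (I : AVCountingInput) : addAnswer I.number = I.addCount := by
  have hw : (fun c : Fin I.m => colSum I.number c) = I.election.app := funext I.colSum_number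
  rw [addAnswer, addCount, ApprovalElection.avAddCount_eq, ← hw, numCols_number,
    firstNumber_number, totalSum_number, secondNumber_number, fieldLength_number_two]
  refine (card_eq_tableCount I.one_le_k I.k_le_m I.mul_lt_size_number
    (fun c => (I.colSum_number c).trans_le (I.app_le c)) fun c s => ?_).symm
  rw [card_supersets_of_card, ApprovalElection.card_approvers, I.colSum_number,
    binomCoeff_eq ((Nat.sub_le _ _).trans_lt I.n_lt_size_number), Fintype.card_fin]

theorem removeAnswer_number (I : AVCountingInput) : removeAnswer I.number = I.removeCount := by
  have hw : (fun c : Fin I.m => colSum I.number c) = I.election.app := funext I.colSum_number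
  rw [removeAnswer, totalSum_number, secondNumber_number, removeCount]
  split_ifs with hB
  · rw [ApprovalElection.avRemoveCount_eq _ hB, ← hw, numCols_number, firstNumber_number]
    refine (card_eq_tableCount I.one_le_k I.k_le_m I.mul_lt_size_number
      (fun c => (I.colSum_number c).trans_le (I.app_le c)) fun c s => ?_).symm
    rw [← powersetCard_eq_filter, card_powersetCard, ApprovalElection.card_approvers,
      I.colSum_number, binomCoeff_eq ((I.app_le c).trans_lt I.n_lt_size_number)]
  · exact (ApprovalElection.avRemoveCount_of_lt _ (not_le.1 hB)).symm

end AVCountingInput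

theorem mainTheorem9 :
    CountingInFP AVCountingInput.encode AVCountingInput.addCount ∧
      CountingInFP AVCountingInput.encode AVCountingInput.removeCount :=
  ⟨NumProg.countingInFP_of_polyC NumProg.PolyC.addAnswer AVCountingInput.exists_encode_eq
      AVCountingInput.addAnswer_number,
    NumProg.countingInFP_of_polyC NumProg.PolyC.removeAnswer AVCountingInput.exists_encode_eq
      AVCountingInput.removeAnswer_number⟩
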